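/- **Setting.** Let $N\ge 2$, $m,k_BT,t_0>0$. Write $\mathbf r,\mathbf p\in\mathbb R^3$. Given are an external potential $U_1(\mathbf r,t)$ ($t$ being the rescaled time below), differentiable in $\mathbf r$, a pair potential $U_2(\mathbf r,\mathbf r')$, differentiable in $\mathbf r$ for $\mathbf r\ne\mathbf r'$, symmetric $3\times3$ matrices $\mathbf Z_1(\mathbf r,\mathbf r')$, $\mathbf Z_2(\mathbf r,\mathbf r')$, and a pair-distribution function $g(\mathbf r,\mathbf r')$. Put $V_j=U_j/k_BT$. The $3N\times 3N$ friction tensor $$\boldsymbol\Gamma_{ij}=\delta_{ij}\Big(\mathbf 1+\sum_{\ell\ne i}\mathbf Z_1(\mathbf r_i,\mathbf r_\ell)\Big)+(1-\delta_{ij})\mathbf Z_2(\mathbf r_i,\mathbf r_j)$$ is positive definite for all pairwise distinct $\mathbf r_1,\dots,\mathbf r_N$. For a friction constant $\gamma>0$ put $\epsilon=\sqrt{k_BT/m}\,\gamma^{-1}$ and $\mu=k_BT/(m\gamma)$; the original time $\tau$ and the rescaled time $t$ are related by $t=\mu\tau$. **Kinetic equation.** For $0<\epsilon<\epsilon_0$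 let $f=f^\epsilon(\mathbf r,\mathbf p,t)>0$, $t\in[0,t_0]$, be a classical solution (continuous in $t\in[0,t_0]$ and in $(\mathbf r,\mathbf p)$, and for $0<t<t_0$ differentiable in $t$ and $C^2$ in $(\mathbf r,\mathbf p)$) of $$\partial_t f=\tfrac1\epsilon\big[-\mathbf p\cdot\nabla_{\mathbf r}f+\nabla_{\mathbf r}V_1\cdot\nabla_{\mathbf p}f+\mathcal N_1(f,f)\big]+\tfrac1{\epsilon^2}\big[\nabla_{\mathbf p}\cdot(\mathbf p+\nabla_{\mathbf p})f+\mathcal N_0(f,f)\big]\quad(0<t<t_0),$$ $$\mathcal N_1(f,f)=\int d\mathbf r'd\mathbf p'\,f(\mathbf r',\mathbf p',t)g(\mathbf r,\mathbf r')\nabla_{\mathbf r}V_2(\mathbf r,\mathbf r')\cdot\nabla_{\mathbf p}f(\mathbf r,\mathbf p,t),$$ $$\mathcal N_0(f,f)=\nabla_{\mathbf p}\cdot\int d\mathbf r'd\mathbf p'\,g(\mathbf r,\mathbf r')\big[\mathbf Z_1(\mathbf r,\mathbf r')f(\mathbf r',\mathbf p',t)(\mathbf p+\nabla_{\mathbf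 p})f(\mathbf r,\mathbf p,t)+\mathbf Z_2(\mathbf r,\mathbf r')(\mathbf p'+\nabla_{\mathbf p'})f(\mathbf r',\mathbf p',t)\,f(\mathbf r,\mathbf p,t)\big].$$ At each time in $[0,t_0]$, $f$ is the one-body reduced distribution of some symmetric $N$-body probability density on phase space whose two-body reduced distribution is $f(\mathbf r,\mathbf p,t)f(\mathbf r',\mathbf p',t)g(\mathbf r,\mathbf r')$ (the $n$-body reduced distribution is $\frac{N!}{(N-n)!}$ times the integral over the last $N-n$ particles). The initial value is $f^\epsilon(\mathbf r,\mathbf p,0)=(2\pi)^{-3/2}e^{-|\mathbf p|^2/2}\rho_{\rm init}(\mathbf r)$, with $\rho_{\rm init}$ independent of $\epsilon$. **Decay and expansion.** There are functions $h,w\ge0$ on $\mathbb R^3$ such that $h$ is bounded and integrable, $\int|\mathbf p|^kw\,d\mathbf p<\infty$ for all $k\in\mathbb N$, and for every $\mathbf r$ the functions $gh$, $g\,\mathbf Z_jh$, $g\,h\,\nabla_{\mathbf r}V_2$ of $\mathbf r'$ (where $h=h(\mathbf r')$) are integrable; and there are functions $f_0,f_1,f_2$ of $(\mathbf r,\mathbf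 p,t)$ independent of $\epsilon$ (for $0<t<t_0$ differentiable in $t$ and $C^2$ in $(\mathbf r,\mathbf p)$) such that: * for every $s\in(0,t_0)$ there is a constant $C_s$ with: on $s<t<t_0$, each $f_n$, its first derivatives in $t,\mathbf r,\mathbf p$ and its second derivatives in $\mathbf p$ are bounded by $C_s\,h(\mathbf r)w(\mathbf p)$, and the same quantities for $f^\epsilon-f_0-\epsilon f_1-\epsilon^2f_2$ by $C_s\epsilon^3h(\mathbf r)w(\mathbf p)$, for all $\epsilon\in(0,\epsilon_0)$; * for each $\epsilon\in(0,\epsilon_0)$ and $t\in[0,t_0]$, $f^\epsilon\le C_{\epsilon,t}\,h(\mathbf r)w(\mathbf p)$; * the densities $\rho^\epsilon=\int f^\epsilon d\mathbf p$, $\rho_0=\int f_0\,d\mathbf p$, $\psi=\int f_1\,d\mathbf p$ satisfy, on all of $[0,t_0]$: $\rho_0,\psi$ are continuous in $t$, $|\rho_0|,|\psi|\le Ch$ and $|\rho^\epsilon-\rho_0-\epsilon\psi|\le C\epsilon^2h$, with $C$ independent of $\epsilon,t,\mathbf r$. **Non-negativity.** Let $\mathbf a$ denote any solution, for $0<t<t_0$,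 of $$\mathbf a+\int d\mathbf r'g\rho_0(\mathbf r')\mathbf Z_1\,\mathbf a+\rho_0\int d\mathbf r'g\,\mathbf Z_2\,\mathbf a(\mathbf r')=-\Big[\nabla+\nabla V_1+\int d\mathbf r'\rho_0(\mathbf r')g\nabla_{\mathbf r}V_2\Big]\rho_0,$$ and consider the linear equation $\partial_t\psi=-\nabla\cdot\mathbf a_2$, $0<t<t_0$, where $$\begin{aligned}&\mathbf a_2+\int d\mathbf r'g\rho_0(\mathbf r')\mathbf Z_1\,\mathbf a_2+\rho_0\int d\mathbf r'g\,\mathbf Z_2\,\mathbf a_2(\mathbf r')=-\Big[\nabla\psi+\psi\nabla V_1+\psi\int d\mathbf r'\rho_0(\mathbf r')g\nabla_{\mathbf r}V_2\\&\qquad+\rho_0\int d\mathbf r'\psi(\mathbf r')g\nabla_{\mathbf r}V_2+\int d\mathbf r'\psi(\mathbf r')g\mathbf Z_1\,\mathbf a+\psi\int d\mathbf r'g\,\mathbf Z_2\,\mathbf a(\mathbf r')\Big].\end{aligned}$$ Assume that it preserves non-negativity in the following (weak) sense: every solution $\psi$ with $\psi(\cdot,0)=0$ is non-negative on $[0,t_0]$.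 Here solutions are taken $C^1$ in $\mathbf r$, with $\mathbf a_2$ differentiable in $\mathbf r$, $\psi$ continuous in $t\in[0,t_0]$, $|\psi|\le Ch$ on $[0,t_0]$, and $|\nabla\psi|,|\partial_t\psi|,|\mathbf a_2|\le C_sh$ on $(s,t_0)$ for every $s\in(0,t_0)$. **Result.** Suppose $\mathbf Z_2\equiv0$. For a density $\varrho$ put $\varrho^{(2)}(\mathbf r,\mathbf r')=\varrho(\mathbf r)\varrho(\mathbf r')g(\mathbf r,\mathbf r')$, $$\mathbf D[\varrho](\mathbf r)=\frac{k_BT}{m\gamma}\Big[\mathbf 1+\int d\mathbf r'\,g(\mathbf r,\mathbf r')\varrho(\mathbf r')\mathbf Z_1(\mathbf r,\mathbf r')\Big]^{-1},$$ $$\mathbf F_\tau[\varrho]=\mathbf D[\varrho]\Big[\nabla\varrho+\tfrac1{k_BT}\varrho\,\nabla U_1(\cdot,\mu\tau)+\tfrac1{k_BT}\int d\mathbf r'\,\varrho^{(2)}(\mathbf r,\mathbf r')\nabla_{\mathbf r}U_2(\mathbf r,\mathbf r')\Big].$$ In the original time let $\rho_\gamma(\mathbf r,\tau)=\rho^\epsilon(\mathbf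 r,\mu\tau)$ (for those $\gamma$ with $\epsilon<\epsilon_0$) and $R_\gamma(\mathbf r,\tau)=\rho_0(\mathbf r,\mu\tau)$, $\tau\in[0,\tfrac{m\gamma}{k_BT}t_0]$. Then the position dynamics are, up to errors of $\mathcal O(\epsilon^2)$, governed by the Smoluchowski equation with diffusion tensor $\mathbf D$, in the following sense. 1. For every $\gamma>0$, $R_\gamma$ is continuous in $\tau$ on $[0,\tfrac{m\gamma}{k_BT}t_0]$, $R_\gamma(\cdot,0)=\rho_{\rm init}$, and for $0<\tau<\tfrac{m\gamma}{k_BT}t_0$ $$\partial_\tau R_\gamma=\nabla_{\mathbf r}\cdot\mathbf F_\tau[R_\gamma],$$ all derivatives existing in the classical sense. 2. There is a constant $C$ with $|\rho_\gamma(\mathbf r,\tau)-R_\gamma(\mathbf r,\tau)|\le C\epsilon^2$ for all $\gamma$ with $\epsilon<\epsilon_0$, all $\tau\in[0,\tfrac{m\gamma}{k_BT}t_0]$ and all $\mathbf r$. 3. The density $\rho_\gamma$ itself satisfies, for $0<\tau<\tfrac{m\gamma}{k_BT}t_0$ and $\epsilon<\epsilon_0$, $$\partial_\tau\rho_\gamma=\nabla_{\mathbf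 r}\cdot\Big(\mathbf F_\tau[\rho_\gamma]+\tfrac{k_BT}{m\gamma}\,\mathbf e_\gamma(\cdot,\mu\tau)\Big),$$ where $\mathbf e_\gamma(\mathbf r,t)=\mathcal O(\epsilon^2)$ as $\gamma\to\infty$ for each fixed $\mathbf r$ and $t\in(0,t_0)$; the field in parentheses is differentiable in $\mathbf r$. 4. The tensors $\mathbf D[R_\gamma(\cdot,\tau)](\mathbf r)$, and for $\epsilon<\epsilon_0$ also $\mathbf D[\rho_\gamma(\cdot,\tau)](\mathbf r)$, are symmetric positive definite for all $\mathbf r$ and all $\tau\in[0,\tfrac{m\gamma}{k_BT}t_0]$. -/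

import Mathlib

open MeasureTheory Set Filter Topology Asymptotics

noncomputable section

namespace Colloid

/-- Three-dimensional Euclidean space, used both for positions `r` and for (rescaled) momenta `p`. -/
abbrev E3 := EuclideanSpace ℝ (Fin 3)

/-- A real `3 × 3` matrix. -/
abbrev Mat3 := Matrix (Fin 3) (Fin 3) ℝ

/-- The matrix-vector product on Euclidean space. -/
def app (A : Mat3) (v : E3) : E3 := Matrix.toEuclideanLin A v

/-- The divergence of a vector field on `ℝ³`. -/
def divergence (W : E3 → E3) (x : E3) : ℝ :=
  ∑ i : Fin 3, (fderiv ℝ W x (EuclideanSpace.single i 1)) i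

/-- The physical data of the model.  `U₁ t r` is the external potential at position `r` and at
(rescaled, diffusive) time `t`; `U₂ r r'` is the pair potential; `Z₁`, `Z₂` are the diagonal and
off-diagonal pair contributions to the friction tensor; `g` is the pair-distribution function. -/
structure Model where
  N : ℕ
  m : ℝ
  kBT : ℝ
  U₁ : ℝ → E3 → ℝ
  U₂ : E3 → E3 → ℝ
  Z₁ : E3 → E3 → Mat3
  Z₂ : E3 → E3 → Mat3
  g : E3 → E3 → ℝ

namespace Model

variable (S : Model)

/-- External potential measured in units of `k_B T`. -/
def V₁ (t : ℝ) (r : E3) : ℝ := S.U₁ t r / S.kBT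

/-- Pair potential measured in units of `k_B T`. -/
def V₂ (r r' : E3) : ℝ := S.U₂ r r' / S.kBT

/-- The pairwise additive friction tensor
`Γᵢⱼ = δᵢⱼ (1 + ∑_{l ≠ i} Z₁(rᵢ, r_l)) + (1 - δᵢⱼ) Z₂(rᵢ, rⱼ)`, a `3N × 3N` matrix. -/
def friction (r : Fin S.N → E3) : Matrix (Fin S.N × Fin 3) (Fin S.N × Fin 3) ℝ :=
  Matrix.of fun x y =>
    if x.1 = y.1 then
      ((1 : Mat3) + ∑ l ∈ Finset.univ.filter (fun l => l ≠ x.1), S.Z₁ (r x.1) (r l)) x.2 y.2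
    else S.Z₂ (r x.1) (r y.1) x.2 y.2

/-- Standing assumptions on the physical data. The friction tensor is only required to be positive
definite at configurations in which no two particles coincide, and the pair potential is only
required to be differentiable away from contact. -/
structure Standing (t₀ : ℝ) : Prop where
  two_le : 2 ≤ S.N
  m_pos : 0 < S.m
  kBT_pos : 0 < S.kBT
  Z₁_symm : ∀ r r', (S.Z₁ r r').IsSymm
  Z₂_symm : ∀ r r', (S.Z₂ r r').IsSymm
  friction_posDef : ∀ r : Fin S.N → E3, Function.Injective r → (S.friction r).PosDef
  U₁_diff : ∀ t ∈ Icc 0 t₀, Differentiable ℝ (S.U₁ t)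
  U₂_diff : ∀ r r', r ≠ r' → DifferentiableAt ℝ (fun x => S.U₂ x r') r

end Model

/-! ### The one-body kinetic equation -/

/-- Gradient in the position variable of a phase-space function. -/
def gradR (u : E3 → E3 → ℝ) (r p : E3) : E3 := gradient (fun x => u x p) r

/-- Gradient in the momentum variable of a phase-space function. -/
def gradP (u : E3 → E3 → ℝ) (r p : E3) : E3 := gradient (fun q => u r q) p

/-- `(p + ∇_p) u`. -/
def pAddGradP (u : E3 → E3 → ℝ) (r p : E3) : E3 := u r p • p + gradP u r p

/-- The position density `∫ u(r, p) dp`. -/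
def density (u : E3 → E3 → ℝ) (r : E3) : ℝ := ∫ p, u r p

namespace Model

variable (S : Model)

/-- `L₀ u = div_p [(p + ∇_p) u]`. -/
def L₀ (u : E3 → E3 → ℝ) (r p : E3) : ℝ := divergence (fun q => pAddGradP u r q) p

/-- `L₁ u = [-p · ∇_r + ∇_r V₁(r, t) · ∇_p] u`. -/
def L₁ (t : ℝ) (u : E3 → E3 → ℝ) (r p : E3) : ℝ :=
  -inner ℝ p (gradR u r p) + inner ℝ (gradient (S.V₁ t) r) (gradP u r p)

/-- `N₀(u, v) = div_p [ (∫∫ g Z₁ u(r', p') dr' dp') (p + ∇_p) v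
  + (∫∫ g Z₂ (p' + ∇_{p'}) u(r', p') dr' dp') v ]`. -/
def N₀ (u v : E3 → E3 → ℝ) (r p : E3) : ℝ :=
  divergence (fun q =>
    app (Matrix.of fun i j => ∫ z : E3 × E3, S.g r z.1 * S.Z₁ r z.1 i j * u z.1 z.2)
      (pAddGradP v r q)
    + v r q • ∫ z : E3 × E3, S.g r z.1 • app (S.Z₂ r z.1) (pAddGradP u z.1 z.2)) p

/-- `N₁(u, v) = (∫∫ u(r', p') g(r, r') ∇_r V₂(r, r') dr' dp') · ∇_p v`. -/
def N₁ (u v : E3 → E3 → ℝ) (r p : E3) : ℝ :=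
  inner ℝ (∫ z : E3 × E3, (u z.1 z.2 * S.g r z.1) • gradient (fun x => S.V₂ x z.1) r)
    (gradP v r p)

end Model

/-- The `n`-body reduced distribution of an `N`-body phase-space density:
`N! / (N - n)! ∫ f^(N) dr_{n+1} dp_{n+1} … dr_N dp_N`. -/
def reduced {N : ℕ} (n : ℕ) (fN : (Fin N → E3 × E3) → ℝ) (x : Fin n → E3 × E3) : ℝ :=
  (N.descFactorial n : ℝ) * ∫ y : Fin (N - n) → E3 × E3,
    fN (fun i => if h : (i : ℕ) < n then x ⟨i, h⟩ else y ⟨i - n, by omega⟩)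

/-- `u` is the one-body reduced distribution of a symmetric `N`-body probability density whose
two-body reduced distribution has the Enskog form `u(r, p) u(r', p') g(r, r')`. -/
def Model.IsEnskog (S : Model) (u : E3 → E3 → ℝ) : Prop :=
  ∃ fN : (Fin S.N → E3 × E3) → ℝ,
    (∀ x, 0 ≤ fN x) ∧
    (∀ (s : Equiv.Perm (Fin S.N)) (x), fN (x ∘ s) = fN x) ∧
    Integrable fN ∧ ∫ x, fN x = 1 ∧
    (∀ r p, u r p = reduced 1 fN ![(r, p)]) ∧
    (∀ r p r' p', reduced 2 fN ![(r, p), (r', p')] = u r p * u r' p' * S.g r r')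

/-- Classical regularity on `(0, t₀)`: twice continuously differentiable in phase space and
differentiable in time. -/
structure RegularOn (t₀ : ℝ) (u : ℝ → E3 → E3 → ℝ) : Prop where
  phase : ∀ t ∈ Ioo 0 t₀, ContDiff ℝ 2 (fun z : E3 × E3 => u t z.1 z.2)
  time : ∀ t ∈ Ioo 0 t₀, ∀ r p, DifferentiableAt ℝ (fun s => u s r p) t

/-- `f` is a positive solution on `[0, t₀]` of the one-body kinetic equation with parameter `ε`,
`∂_t f = (1/ε) [L₁ f + N₁(f, f)] + (1/ε²) [L₀ f + N₀(f, f)]`, closed by the Enskog relation. -/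
structure Model.IsOneBodySolution (S : Model) (t₀ ε : ℝ) (f : ℝ → E3 → E3 → ℝ) : Prop where
  pos : ∀ t ∈ Icc 0 t₀, ∀ r p, 0 < f t r p
  enskog : ∀ t ∈ Icc 0 t₀, S.IsEnskog (f t)
  cont_phase : ∀ t ∈ Icc 0 t₀, Continuous (fun z : E3 × E3 => f t z.1 z.2)
  cont_time : ∀ r p, ContinuousOn (fun t => f t r p) (Icc 0 t₀)
  regular : RegularOn t₀ f
  equation : ∀ t ∈ Ioo 0 t₀, ∀ r p,
    deriv (fun s => f s r p) t =
      (1 / ε) * (S.L₁ t (f t) r p + S.N₁ (f t) (f t) r p)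
      + (1 / ε ^ 2) * (L₀ (f t) r p + S.N₀ (f t) (f t) r p)

/-! ### Decay and the expansion in powers of `ε` -/

/-- Decay: `h(r) w(p)` is an envelope for phase-space functions.  The spatial envelope is bounded
and integrable, also against the pair kernels of the model, and the momentum envelope has finite
moments. -/
structure Model.Envelope (S : Model) (h w : E3 → ℝ) : Prop where
  h_nonneg : ∀ r, 0 ≤ h r
  w_nonneg : ∀ p, 0 ≤ w p
  h_bdd : ∃ H, ∀ r, h r ≤ H
  h_int : Integrable h
  w_int : ∀ k : ℕ, Integrable (fun p : E3 => ‖p‖ ^ k * w p)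
  g_int : ∀ r, Integrable (fun r' => S.g r r' * h r')
  Z₁_int : ∀ r i j, Integrable (fun r' => S.g r r' * S.Z₁ r r' i j * h r')
  Z₂_int : ∀ r i j, Integrable (fun r' => S.g r r' * S.Z₂ r r' i j * h r')
  V₂_int : ∀ r, Integrable (fun r' => (h r' * S.g r r') • gradient (fun x => S.V₂ x r') r)

/-- `u`, its first derivatives in `t`, `r`, `p` and its second derivatives in `p` are bounded by `B`
at `(t, r, p)`. -/
def JetBound (u : ℝ → E3 → E3 → ℝ) (t : ℝ) (r p : E3) (B : ℝ) : Prop :=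
  |u t r p| ≤ B ∧ |deriv (fun s => u s r p) t| ≤ B ∧ ‖gradR (u t) r p‖ ≤ B ∧
    ‖gradP (u t) r p‖ ≤ B ∧ ‖fderiv ℝ (fun q => gradP (u t) r q) p‖ ≤ B

/-- The family `f ε` is expanded in powers of `ε` with `ε`-independent coefficients `c n`.

Away from the initial time the family agrees with `c 0 + ε c 1 + ε² c 2` up to `O(ε³)`, together with
the derivatives that occur in the kinetic equation.  Because of the initial layer, in which momenta
relax, nothing of the kind is asked at times close to `0`; there only the position density is
expanded, to first order. -/
structure HilbertExpansion (h w : E3 → ℝ) (t₀ ε₀ : ℝ) (f : ℝ → ℝ → E3 → E3 → ℝ)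
    (c : ℕ → ℝ → E3 → E3 → ℝ) : Prop where
  regular : ∀ n < 3, RegularOn t₀ (c n)
  bound : ∀ n < 3, ∀ s ∈ Ioo 0 t₀, ∃ C, ∀ t ∈ Ioo s t₀, ∀ r p,
    JetBound (c n) t r p (C * (h r * w p))
  remainder : ∀ s ∈ Ioo 0 t₀, ∃ C, ∀ ε ∈ Ioo 0 ε₀, ∀ t ∈ Ioo s t₀, ∀ r p,
    JetBound (fun t r p => f ε t r p - ∑ n ∈ Finset.range 3, ε ^ n * c n t r p) t r p
      (C * ε ^ 3 * (h r * w p))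
  decay : ∀ ε ∈ Ioo 0 ε₀, ∀ t ∈ Icc 0 t₀, ∃ C, ∀ r p, |f ε t r p| ≤ C * (h r * w p)
  density_cont : ∀ n < 2, ∀ r, ContinuousOn (fun t => density (c n t) r) (Icc 0 t₀)
  density_bound : ∀ n < 2, ∃ C, ∀ t ∈ Icc 0 t₀, ∀ r, |density (c n t) r| ≤ C * h r
  density_remainder : ∃ C, ∀ ε ∈ Ioo 0 ε₀, ∀ t ∈ Icc 0 t₀, ∀ r,
    |density (f ε t) r - ∑ n ∈ Finset.range 2, ε ^ n * density (c n t) r| ≤ C * ε ^ 2 * h r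

/-! ### The evolution equation for the density at order `ε` -/

namespace Model

variable (S : Model)

/-- The matrix `∫ g(r, r') ρ(r') Z₁(r, r') dr'`. -/
def meanZ₁ (ρ : E3 → ℝ) (r : E3) : Mat3 :=
  Matrix.of fun i j => ∫ r', S.g r r' * ρ r' * S.Z₁ r r' i j

/-- The mean force term `∫ ρ(r') g(r, r') ∇_r V₂(r, r') dr'`. -/
def meanForce (ρ : E3 → ℝ) (r : E3) : E3 :=
  ∫ r', (ρ r' * S.g r r') • gradient (fun x => S.V₂ x r') r

/-- The vector `∫ g(r, r') Z₂(r, r') b(r') dr'`. -/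
def meanZ₂ (b : E3 → E3) (r : E3) : E3 := ∫ r', S.g r r' • app (S.Z₂ r r') (b r')

/-- `b + ∫ g ρ Z₁ dr' b + ρ ∫ g Z₂ b(r') dr'`. -/
def resist (ρ : E3 → ℝ) (b : E3 → E3) (r : E3) : E3 :=
  b r + app (S.meanZ₁ ρ r) (b r) + ρ r • S.meanZ₂ b r

/-- `a` is the flux belonging to the density `ρ` at time `t`:
`a + ∫ g ρ Z₁ dr' a + ρ ∫ g Z₂ a(r') dr' = -[∇ + ∇V₁ + ∫ ρ g ∇V₂ dr'] ρ`. -/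
def IsFlux (t : ℝ) (ρ : E3 → ℝ) (a : E3 → E3) : Prop :=
  ∀ r, S.resist ρ a r
    = -(gradient ρ r + ρ r • gradient (S.V₁ t) r + ρ r • S.meanForce ρ r)

/-- The driving term of the order-`ε` flux. -/
def psiDrive (t : ℝ) (ρ : E3 → ℝ) (a : E3 → E3) (ψ : E3 → ℝ) (r : E3) : E3 :=
  gradient ψ r + ψ r • gradient (S.V₁ t) r + ψ r • S.meanForce ρ r + ρ r • S.meanForce ψ r
    + app (S.meanZ₁ ψ r) (a r) + ψ r • S.meanZ₂ a r

/-- `ψ` solves, on `[0, t₀]` and in the class of functions dominated by the envelope `h`, the linear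
evolution equation `∂_t ψ = -div a₂`, where `a₂` is the solution of
`a₂ + ∫ g ρ Z₁ dr' a₂ + ρ ∫ g Z₂ a₂(r') dr' = -psiDrive`. -/
structure IsPsiSolution (h : E3 → ℝ) (t₀ : ℝ) (ρ : ℝ → E3 → ℝ) (a : ℝ → E3 → E3)
    (ψ : ℝ → E3 → ℝ) : Prop where
  cont : ∀ r, ContinuousOn (fun t => ψ t r) (Icc 0 t₀)
  bound : ∃ C, ∀ t ∈ Icc 0 t₀, ∀ r, |ψ t r| ≤ C * h r
  smooth : ∀ t ∈ Ioo 0 t₀, ContDiff ℝ 1 (ψ t)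
  deriv_bound : ∀ s ∈ Ioo 0 t₀, ∃ C, ∀ t ∈ Ioo s t₀, ∀ r,
    ‖gradient (ψ t) r‖ ≤ C * h r ∧ |deriv (fun s => ψ s r) t| ≤ C * h r
  equation : ∃ a₂ : ℝ → E3 → E3,
    (∀ s ∈ Ioo 0 t₀, ∃ C, ∀ t ∈ Ioo s t₀, ∀ r, ‖a₂ t r‖ ≤ C * h r) ∧
    ∀ t ∈ Ioo 0 t₀, ∀ r,
      DifferentiableAt ℝ (a₂ t) r ∧
      S.resist (ρ t) (a₂ t) r = -S.psiDrive t (ρ t) (a t) (ψ t) r ∧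
      HasDerivAt (fun s => ψ s r) (-divergence (a₂ t) r) t

/-- The evolution of `ψ` preserves non-negativity.  Only the case of a zero initial datum is
required here, which is weaker than requiring it for every non-negative initial datum. -/
def PreservesNonneg (h : E3 → ℝ) (t₀ : ℝ) (ρ : ℝ → E3 → ℝ) : Prop :=
  ∀ a : ℝ → E3 → E3, (∀ t ∈ Ioo 0 t₀, S.IsFlux t (ρ t) (a t)) →
    ∀ ψ : ℝ → E3 → ℝ, S.IsPsiSolution h t₀ ρ a ψ → (∀ r, ψ 0 r = 0) →
      ∀ t ∈ Icc 0 t₀, ∀ r, 0 ≤ ψ t r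

/-! ### The Smoluchowski equation in the original variables -/

/-- The small parameter `ε = √(k_B T / m) / γ`. -/
def eps (γ : ℝ) : ℝ := Real.sqrt (S.kBT / S.m) / γ

/-- The isolated-particle diffusion constant `k_B T / (m γ)`, which is also the factor between the
rescaled time `t` and the original time `τ`: `t = (k_B T / (m γ)) τ`. -/
def diff₀ (γ : ℝ) : ℝ := S.kBT / (S.m * γ)

/-- The diffusion tensor `D = (k_B T / (m γ)) [1 + ∫ g(r, r') ρ(r') Z₁(r, r') dr']⁻¹`. -/
def diffusionTensor (γ : ℝ) (ρ : E3 → ℝ) (r : E3) : Mat3 :=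
  S.diff₀ γ • (1 + S.meanZ₁ ρ r)⁻¹

/-- The two-body density `ρ⁽²⁾(r, r') = ρ(r) ρ(r') g(r, r')`. -/
def rho2 (ρ : E3 → ℝ) (r r' : E3) : ℝ := ρ r * ρ r' * S.g r r'

/-- The field `D [∇ρ + (1 / k_B T) ρ ∇U₁ + (1 / k_B T) ∫ ρ⁽²⁾(r, r') ∇_r U₂(r, r') dr']`, for the
density `ρ` and the external potential `U` at a given instant. -/
def smolField (γ : ℝ) (U : E3 → ℝ) (ρ : E3 → ℝ) (r : E3) : E3 :=
  app (S.diffusionTensor γ ρ r)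
    (gradient ρ r + (1 / S.kBT) • (ρ r • gradient U r)
      + (1 / S.kBT) • ∫ r', S.rho2 ρ r r' • gradient (fun x => S.U₂ x r') r)

end Model

end Colloid

end

/-!
Write `⟨q⟩` for the velocity moment `∫ q(p) f(r, p, t) dp` and `A = 1 + ∫ g ρ Z₁ dr'` for the mean
friction matrix. Integrating the kinetic equation by parts in `p` gives, for every weight `q` of
polynomial growth, an exact equation for `∂ₜ⟨q⟩` (`Model.moment_equation`). Since the kernels `g`,
`g Z₁`, `g ∇V₂` are integrable against the envelope `h`, its terms are products of linear
functionals bounded in the weighted norms of the expansion. Each of these has an expansion in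
powers of `ε` (`Setting.hasExp`), and the coefficients can be compared
(`Setting.order_equations`).

No compactness or spectral theory of the collision operator is needed: weights of degree at most
three suffice, and on them the collision operator acts through the positive definite matrix `A`
alone. At order `ε⁻²` the equations `A ⟨p⟩ = 0`, `A Q + Q A = 0` for `Q = ⟨p ⊗ p⟩ - ρ₀ 1`, and the
rank-three analogue have only the zero solution (`posDef_lyapunov_unique`,
`posDef_lyapunov_three_unique`), so the leading distribution has no flux, an isotropic stress and
no third moment. At order `ε⁻¹` the stress is isotropic again (`Setting.stress_first`) and the
flux is `-A⁻¹ (∇ρ₀ + ρ₀ ∇V₁ + …)` (`Setting.flux_first`); the continuity equation then is the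
Smoluchowski equation for `ρ₀`.

The `O(ε)` correction `ψ` of the density solves the linear equation of the hypothesis
(`Setting.isPsiSolution`) and vanishes initially, because the initial density does not depend on
`ε`. As that equation is linear, `-ψ` is a solution too, and preservation of non-negativity forces
`ψ = 0` (`Setting.density_first_eq_zero`); hence the error `O(ε²)`.

For the true density the continuity equation is exact, and by the momentum balance its flux
differs from the Smoluchowski flux by `A⁻¹` applied to `ε ∂ₜ⟨p⟩ + ∇ · (⟨p ⊗ p⟩ - ρ 1)`, whose
coefficients of `1` and `ε` vanish (`Setting.flux_error_isBigO`).

Positive definiteness of `A` (`Model.Standing.posDef_one_add_meanZ₁`) rests on the normalization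
`∫ g ρ dr' = N - 1`, which holds for `ρ^ε` by integrating the two-body distribution
(`Model.IsEnskog.integral_g_mul_density`) and passes to the limit. It makes `A` the integral of
`(N - 1)⁻¹ 1 + Z₁(r, r')` against `g ρ dr'`. In a given direction this integrand is positive for
all but finitely many `r'`, since `N - 1` exceptional points together with `r` would make up a
configuration whose friction tensor is not positive definite (`Model.Standing.finite_bad`).
-/

noncomputable section

namespace Colloid

/-! ### Linear equations driven by a positive definite matrix -/

/-- If `∑ₖ vₖ · A vₖ = 0` with `A` positive definite, every `vₖ` vanishes. -/
theorem posDef_family_eq_zero {A : Mat3} (hA : A.PosDef) {ι : Type*} [Fintype ι]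
    (v : ι → Fin 3 → ℝ) (h : ∑ k, ∑ a, v k a * ∑ j, A a j * v k j = 0) : v = 0 := by
  have key : ∀ k, ∑ a, v k a * ∑ j, A a j * v k j = v k ⬝ᵥ (A.mulVec (v k)) := fun k => rfl
  have hnn : ∀ k, 0 ≤ ∑ a, v k a * ∑ j, A a j * v k j := fun k => by
    rw [key]
    simpa using hA.posSemidef.dotProduct_mulVec_nonneg (v k)
  funext k
  by_contra hk
  have h0 := (Finset.sum_eq_zero_iff_of_nonneg (fun k _ => hnn k)).1 h k (Finset.mem_univ k)
  have := hA.dotProduct_mulVec_pos hk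
  rw [key] at h0
  simp [h0] at this

theorem posDef_solve_unique {A : Mat3} (hA : A.PosDef) (x : Fin 3 → ℝ)
    (h : ∀ a, ∑ j, A a j * x j = 0) : x = 0 := by
  have := posDef_family_eq_zero hA (fun _ : Unit => x) (by simp [h])
  exact congrFun this ()

/-- The Lyapunov operator `Q ↦ A Q + Q A` is injective on symmetric matrices. -/
theorem posDef_lyapunov_unique {A : Mat3} (hA : A.PosDef) (Q : Fin 3 → Fin 3 → ℝ)
    (hQ : ∀ a b, Q a b = Q b a)
    (h : ∀ a b, ∑ j, A a j * Q j b + ∑ j, A b j * Q j a = 0) (a b : Fin 3) : Q a b = 0 := by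
  have h1 : ∑ b, ∑ a, Q a b * ∑ j, A a j * Q j b = 0 := by
    -- contracting the equation with `Q` counts the quadratic form of `A` on the columns twice
    have e : ∑ b, ∑ a, Q a b * ∑ j, A b j * Q j a = ∑ b, ∑ a, Q a b * ∑ j, A a j * Q j b := by
      rw [Finset.sum_comm]
      exact Finset.sum_congr rfl fun a _ => Finset.sum_congr rfl fun b _ => by rw [hQ a b]
    have s : ∑ b, ∑ a, Q a b * (∑ j, A a j * Q j b + ∑ j, A b j * Q j a) = 0 := by
      simp [h]
    simp only [mul_add, Finset.sum_add_distrib] at s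
    linarith
  have := posDef_family_eq_zero hA (fun b a => Q a b) h1
  exact congrFun (congrFun this b) a

/-- The analogue of `posDef_lyapunov_unique` for fully symmetric tensors of rank three. -/
theorem posDef_lyapunov_three_unique {A : Mat3} (hA : A.PosDef) (T : Fin 3 → Fin 3 → Fin 3 → ℝ)
    (h12 : ∀ a b c, T a b c = T b a c) (h23 : ∀ a b c, T a b c = T a c b)
    (h : ∀ a b c, ∑ j, A a j * T j b c + ∑ j, A b j * T j a c + ∑ j, A c j * T j a b = 0)
    (a b c : Fin 3) : T a b c = 0 := by
  have h1 : ∑ k : Fin 3 × Fin 3, ∑ a, T a k.1 k.2 * ∑ j, A a j * T j k.1 k.2 = 0 := by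
    rw [Fintype.sum_prod_type]
    have e2 : ∑ b, ∑ c, ∑ a, T a b c * ∑ j, A b j * T j a c
        = ∑ b, ∑ c, ∑ a, T a b c * ∑ j, A a j * T j b c := by
      have : ∀ F : Fin 3 → Fin 3 → Fin 3 → ℝ,
          ∑ b, ∑ c, ∑ a, F b c a = ∑ a, ∑ c, ∑ b, F b c a := fun F => by
        rw [Finset.sum_comm]
        conv_rhs => rw [Finset.sum_comm]
        exact Finset.sum_congr rfl fun c _ => Finset.sum_comm
      rw [this]
      exact Finset.sum_congr rfl fun a _ => Finset.sum_congr rfl fun c _ =>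
        Finset.sum_congr rfl fun b _ => by rw [h12 a b c]
    have e3 : ∑ b, ∑ c, ∑ a, T a b c * ∑ j, A c j * T j a b
        = ∑ b, ∑ c, ∑ a, T a b c * ∑ j, A a j * T j b c := by
      refine Finset.sum_congr rfl fun b _ => ?_
      rw [Finset.sum_comm]
      exact Finset.sum_congr rfl fun a _ => Finset.sum_congr rfl fun c _ => by
        rw [h12 a b c, h23 b a c, h12 b c a]
        congr 1
        exact Finset.sum_congr rfl fun j _ => by rw [h23 j a b]
    have s : ∑ b, ∑ c, ∑ a, T a b c *
        (∑ j, A a j * T j b c + ∑ j, A b j * T j a c + ∑ j, A c j * T j a b) = 0 := by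
      simp [h]
    simp only [mul_add, Finset.sum_add_distrib] at s
    linarith
  have := posDef_family_eq_zero hA (fun (k : Fin 3 × Fin 3) a => T a k.1 k.2) h1
  exact congrFun (congrFun this (b, c)) a

/-! ### Second-order expansions in a small parameter -/

/-- `x ε = a₀ + ε a₁ + ε² a₂ + O(ε³)` as `ε → 0⁺`. -/
def HasExp (x : ℝ → ℝ) (a₀ a₁ a₂ : ℝ) : Prop :=
  (fun ε => x ε - (a₀ + ε * a₁ + ε ^ 2 * a₂)) =O[𝓝[>] 0] fun ε : ℝ => ε ^ 3

namespace HasExp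

theorem isBigO_pow {m n : ℕ} (h : m ≤ n) :
    (fun ε : ℝ => ε ^ n) =O[𝓝[>] 0] fun ε : ℝ => ε ^ m := by
  obtain ⟨k, rfl⟩ := Nat.exists_eq_add_of_le h
  have h1 : (fun ε : ℝ => ε ^ k) =O[𝓝[>] 0] fun _ => (1 : ℝ) :=
    (((continuous_pow k).tendsto (0 : ℝ)).mono_left nhdsWithin_le_nhds).isBigO_one ℝ
  simpa [pow_add] using (isBigO_refl (fun ε : ℝ => ε ^ m) (𝓝[>] 0)).mul h1

theorem isBigO_one_of_continuous {x : ℝ → ℝ} (hx : Continuous x) :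
    x =O[𝓝[>] 0] fun _ : ℝ => (1 : ℝ) :=
  ((hx.tendsto 0).mono_left nhdsWithin_le_nhds).isBigO_one ℝ

theorem congr' {x y : ℝ → ℝ} {a₀ a₁ a₂ : ℝ} (hx : HasExp x a₀ a₁ a₂)
    (h : ∀ᶠ ε in 𝓝[>] 0, x ε = y ε) : HasExp y a₀ a₁ a₂ :=
  IsBigO.congr' hx (h.mono fun ε hε => by simp only [hε]) EventuallyEq.rfl

theorem const (a : ℝ) : HasExp (fun _ => a) a 0 0 := by
  simpa [HasExp] using isBigO_zero _ _

theorem add {x y : ℝ → ℝ} {a₀ a₁ a₂ b₀ b₁ b₂ : ℝ} (hx : HasExp x a₀ a₁ a₂)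
    (hy : HasExp y b₀ b₁ b₂) :
    HasExp (fun ε => x ε + y ε) (a₀ + b₀) (a₁ + b₁) (a₂ + b₂) :=
  (IsBigO.add hx hy).congr_left fun ε => by ring

theorem sum {ι : Type*} (s : Finset ι) {x : ι → ℝ → ℝ} {a₀ a₁ a₂ : ι → ℝ}
    (hx : ∀ i, HasExp (x i) (a₀ i) (a₁ i) (a₂ i)) :
    HasExp (fun ε => ∑ i ∈ s, x i ε) (∑ i ∈ s, a₀ i) (∑ i ∈ s, a₁ i) (∑ i ∈ s, a₂ i) :=
  (IsBigO.sum fun i (_ : i ∈ s) => hx i).congr_left fun ε => by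
    simp [Finset.sum_sub_distrib, Finset.sum_add_distrib, Finset.mul_sum]

theorem isBigO_one {x : ℝ → ℝ} {a₀ a₁ a₂ : ℝ} (hx : HasExp x a₀ a₁ a₂) :
    x =O[𝓝[>] 0] fun _ => (1 : ℝ) := by
  have h1 := (hx.trans (isBigO_pow (Nat.zero_le 3))).congr_right fun _ => pow_zero _
  have h2 := isBigO_one_of_continuous
    (show Continuous fun ε : ℝ => a₀ + ε * a₁ + ε ^ 2 * a₂ by fun_prop)
  exact (h1.add h2).congr_left fun ε => by ring

theorem mul {x y : ℝ → ℝ} {a₀ a₁ a₂ b₀ b₁ b₂ : ℝ} (hx : HasExp x a₀ a₁ a₂)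
    (hy : HasExp y b₀ b₁ b₂) :
    HasExp (fun ε => x ε * y ε) (a₀ * b₀) (a₀ * b₁ + a₁ * b₀)
      (a₀ * b₂ + a₁ * b₁ + a₂ * b₀) := by
  have h1 := (IsBigO.mul hx hy.isBigO_one).congr_right fun ε => mul_one (ε ^ 3)
  have h2 := (IsBigO.mul (isBigO_one_of_continuous
    (show Continuous fun ε : ℝ => a₀ + ε * a₁ + ε ^ 2 * a₂ by fun_prop)) hy).congr_right
      fun ε => one_mul (ε ^ 3)
  have h3 := (IsBigO.mul (isBigO_refl (fun ε : ℝ => ε ^ 3) (𝓝[>] 0)) (isBigO_one_of_continuous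
    (show Continuous fun ε : ℝ => (a₁ * b₂ + a₂ * b₁) + ε * (a₂ * b₂) by fun_prop))).congr_right
      fun ε => mul_one (ε ^ 3)
  exact ((h1.add h2).add h3).congr_left fun ε => by ring

theorem sub {x y : ℝ → ℝ} {a₀ a₁ a₂ b₀ b₁ b₂ : ℝ} (hx : HasExp x a₀ a₁ a₂)
    (hy : HasExp y b₀ b₁ b₂) :
    HasExp (fun ε => x ε - y ε) (a₀ - b₀) (a₁ - b₁) (a₂ - b₂) :=
  (IsBigO.sub hx hy).congr_left fun ε => by ring

theorem eps_mul {x : ℝ → ℝ} {a₀ a₁ a₂ : ℝ} (hx : HasExp x a₀ a₁ a₂) :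
    HasExp (fun ε => ε * x ε) 0 a₀ a₁ := by
  have h : HasExp (fun ε => ε) 0 1 0 := by simpa [HasExp] using isBigO_zero _ _
  simpa using h.mul hx

/-- The coefficients of an expansion of zero vanish. -/
theorem coeff_eq_zero {a₀ a₁ a₂ : ℝ} (h : HasExp (fun _ => 0) a₀ a₁ a₂) :
    a₀ = 0 ∧ a₁ = 0 ∧ a₂ = 0 := by
  have lim : ∀ {x : ℝ → ℝ}, Continuous x → ∀ n : ℕ, x =O[𝓝[>] 0] (fun ε : ℝ => ε ^ (n + 1)) →
      x 0 = 0 := fun {x} hx n hO => by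
    have t0 : Tendsto (fun ε : ℝ => ε ^ (n + 1)) (𝓝[>] 0) (𝓝 0) := by
      have := ((continuous_pow (n + 1)).tendsto (0 : ℝ)).mono_left
        (nhdsWithin_le_nhds (s := Ioi 0))
      simpa using this
    exact tendsto_nhds_unique ((hx.tendsto 0).mono_left nhdsWithin_le_nhds)
      (hO.trans_tendsto t0)
  have div : ∀ {x y : ℝ → ℝ} (n : ℕ), (∀ ε, x ε = ε * y ε) →
      x =O[𝓝[>] 0] (fun ε : ℝ => ε ^ (n + 1)) → y =O[𝓝[>] 0] (fun ε : ℝ => ε ^ n) := by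
    intro x y n hxy hO
    have := (isBigO_refl (fun ε : ℝ => ε⁻¹) (𝓝[>] 0)).mul hO
    refine this.congr' ?_ ?_ <;> filter_upwards [self_mem_nhdsWithin] with ε hε
    · rw [hxy]; field_simp [(mem_Ioi.1 hε).ne']
    · rw [pow_succ]; field_simp [(mem_Ioi.1 hε).ne']
  have h0 : (fun ε : ℝ => a₀ + ε * a₁ + ε ^ 2 * a₂) =O[𝓝[>] 0] fun ε : ℝ => ε ^ 3 :=
    (IsBigO.neg_left h).congr_left fun ε => by ring
  have e0 : a₀ = 0 := by simpa using lim (by fun_prop) 2 h0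
  have h1 : (fun ε : ℝ => a₁ + ε * a₂) =O[𝓝[>] 0] fun ε : ℝ => ε ^ 2 :=
    div 2 (fun ε => by rw [e0]; ring) h0
  have e1 : a₁ = 0 := by simpa using lim (by fun_prop) 1 h1
  have h2 : (fun _ : ℝ => a₂) =O[𝓝[>] 0] fun ε : ℝ => ε ^ 1 :=
    div 1 (fun ε => by rw [e1]; ring) h1
  exact ⟨e0, e1, by simpa using lim (by fun_prop) 0 h2⟩

end HasExp

/-! ### Positive definiteness of the mean friction matrix -/

/-- Integrating the two-body reduced distribution over one particle gives `N - 1` times the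
one-body reduced distribution, at every point where the latter does not vanish (there the section
of the `N`-body density is automatically integrable). -/
theorem integral_reduced_two {N : ℕ} (hN : 2 ≤ N) (fN : (Fin N → E3 × E3) → ℝ) (x : E3 × E3)
    (hx : reduced 1 fN ![x] ≠ 0) :
    ∫ z, reduced 2 fN ![x, z] = ((N : ℝ) - 1) * reduced 1 fN ![x] := by
  obtain ⟨k, rfl⟩ := Nat.exists_eq_add_of_le' hN
  have e1 : reduced 1 fN ![x] = ((k + 2 : ℕ) : ℝ) * ∫ y : Fin (k + 1) → E3 × E3,
      fN (Fin.cons x y) := by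
    unfold reduced
    rw [Nat.descFactorial_one]
    congr 1
    change ∫ y : Fin (k + 1) → E3 × E3, _ = _
    refine integral_congr_ae (Eventually.of_forall fun y => ?_)
    change fN _ = fN _
    congr 1
    funext i
    refine Fin.cases ?_ (fun j => ?_) i
    · simp
    · simp
  have e2 : ∀ z, reduced 2 fN ![x, z] = (((k + 2 : ℕ) : ℝ) * (k + 1 : ℕ)) *
      ∫ y : Fin k → E3 × E3, fN (Fin.cons x (Fin.cons z y)) := by
    intro z
    unfold reduced
    have : (k + 2).descFactorial 2 = (k + 2) * (k + 1) := by
      simp [Nat.descFactorial_succ, mul_comm]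
    rw [this, Nat.cast_mul]
    congr 1
    change ∫ y : Fin k → E3 × E3, _ = _
    refine integral_congr_ae (Eventually.of_forall fun y => ?_)
    change fN _ = fN _
    congr 1
    funext i
    refine Fin.cases ?_ (fun j => ?_) i
    · simp
    · refine Fin.cases ?_ (fun l => ?_) j
      · simp
      · simp
  -- a non-zero Bochner integral certifies the integrability that Fubini's theorem requires
  have hne : ∫ y : Fin (k + 1) → E3 × E3, fN (Fin.cons x y) ≠ 0 := by
    intro h0
    rw [e1, h0, mul_zero] at hx
    exact hx rfl
  have hint : Integrable (fun y : Fin (k + 1) → E3 × E3 => fN (Fin.cons x y)) :=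
    Integrable.of_integral_ne_zero hne
  have mp := (volume_preserving_piFinSuccAbove (fun _ : Fin (k + 1) => E3 × E3) 0).symm
  have cons_eq : ∀ q : (E3 × E3) × (Fin k → E3 × E3),
      (MeasurableEquiv.piFinSuccAbove (fun _ : Fin (k + 1) => E3 × E3) 0).symm q
        = Fin.cons q.1 q.2 := fun q => by
    simp only [MeasurableEquiv.piFinSuccAbove, Fin.insertNthEquiv_zero]
    rfl
  have i1 := mp.integral_comp (MeasurableEquiv.measurableEmbedding _)
    (fun y : Fin (k + 1) → E3 × E3 => fN (Fin.cons x y))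
  have i2 := (mp.integrable_comp_emb (MeasurableEquiv.measurableEmbedding _)).2 hint
  simp only [Function.comp_def, cons_eq] at i1 i2
  have : SigmaFinite (volume : Measure (Fin k → E3 × E3)) :=
    Measure.pi.sigmaFinite fun _ => volume
  have i3 := integral_prod (μ := (volume : Measure (E3 × E3)))
    (ν := (volume : Measure (Fin k → E3 × E3)))
    (fun q => fN (Fin.cons x (Fin.cons q.1 q.2))) i2
  simp_rw [e2]
  rw [integral_const_mul, e1, ← i1]
  erw [i3]
  push_cast
  ring

theorem reduced_nonneg {N n : ℕ} {fN : (Fin N → E3 × E3) → ℝ} (h : ∀ x, 0 ≤ fN x)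
    (x : Fin n → E3 × E3) : 0 ≤ reduced n fN x :=
  mul_nonneg (Nat.cast_nonneg _) (integral_nonneg fun _ => h _)

namespace Model

variable {S : Model}

theorem IsEnskog.g_nonneg {u : E3 → E3 → ℝ} (hu : S.IsEnskog u) (pos : ∀ r p, 0 < u r p)
    (r r' : E3) : 0 ≤ S.g r r' := by
  obtain ⟨fN, h0, -, -, -, -, h2⟩ := hu
  have := reduced_nonneg h0 ![(r, (0 : E3)), (r', (0 : E3))]
  rw [h2] at this
  exact nonneg_of_mul_nonneg_right this (mul_pos (pos _ _) (pos _ _))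

/-- The pair distribution is normalized: a particle at `r` sees the `N - 1` others. -/
theorem IsEnskog.integral_g_mul_density {u : E3 → E3 → ℝ} (hN : 2 ≤ S.N) (hu : S.IsEnskog u)
    (pos : ∀ r p, 0 < u r p) (r : E3) :
    ∫ r', S.g r r' * density u r' = (S.N : ℝ) - 1 := by
  obtain ⟨fN, -, -, -, -, h1, h2⟩ := hu
  have hN' : (2 : ℝ) ≤ S.N := by exact_mod_cast hN
  have hne : reduced 1 fN ![(r, (0 : E3))] ≠ 0 := by rw [← h1]; exact (pos _ _).ne'
  have key := integral_reduced_two hN fN (r, 0) hne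
  have e : ∀ z : E3 × E3, reduced 2 fN ![(r, 0), z] = u r 0 * (u z.1 z.2 * S.g r z.1) :=
    fun z => by rw [← mul_assoc]; exact h2 r 0 z.1 z.2
  simp_rw [e] at key
  rw [integral_const_mul, ← h1, mul_comm] at key
  have key' := mul_right_cancel₀ (pos r 0).ne' key
  -- integrable because its integral is `N - 1 ≠ 0`
  have hint : Integrable (fun z : E3 × E3 => u z.1 z.2 * S.g r z.1) :=
    Integrable.of_integral_ne_zero (by rw [key']; linarith)
  rw [← key']
  erw [integral_prod _ hint]
  refine integral_congr_ae (Eventually.of_forall fun r' => ?_)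
  change _ = ∫ p, u r' p * S.g r r'
  rw [integral_mul_const, mul_comm]
  rfl

/-- Configurations with `N - 1` particles placed at bad positions are excluded by the positive
definiteness of the friction tensor, so there are only finitely many bad positions. -/
theorem Standing.finite_bad {t₀ : ℝ} (hS : S.Standing t₀) (r : E3) (v : Fin 3 → ℝ) (hv : v ≠ 0) :
    {r' | r' ≠ r ∧ v ⬝ᵥ v + ((S.N : ℝ) - 1) * (v ⬝ᵥ (S.Z₁ r r').mulVec v) ≤ 0}.Finite := by
  by_contra hinf
  have hinf : Set.Infinite _ := hinf
  set φ := hinf.natEmbedding with hφ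
  have hN := hS.two_le
  have hN' : (2 : ℝ) ≤ S.N := by exact_mod_cast hN
  let i₀ : Fin S.N := ⟨0, by omega⟩
  let c : Fin S.N → E3 := fun i => if i = i₀ then r else (φ i : E3)
  -- one particle at `r`, all others at distinct bad positions
  have hc : Function.Injective c := by
    intro i j hij
    by_cases hi : i = i₀ <;> by_cases hj : j = i₀ <;> simp only [c, hi, hj, if_true, if_false] at hij
    · rw [hi, hj]
    · exact absurd hij.symm (φ j).2.1
    · exact absurd hij (φ i).2.1
    · exact Fin.ext (φ.injective (Subtype.ext hij))
  have hpd := hS.friction_posDef c hc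
  -- only the particle at `r` moves, which selects its diagonal block of the friction tensor
  let x : Fin S.N × Fin 3 → ℝ := fun y => if y.1 = i₀ then v y.2 else 0
  have hx : x ≠ 0 := by
    obtain ⟨a, ha⟩ := Function.ne_iff.1 hv
    exact Function.ne_iff.2 ⟨(i₀, a), by simpa [x] using ha⟩
  have hpos := hpd.dotProduct_mulVec_pos hx
  have hval : star x ⬝ᵥ (S.friction c).mulVec x = v ⬝ᵥ v +
      ∑ l ∈ Finset.univ.filter (fun l => l ≠ i₀), v ⬝ᵥ (S.Z₁ r (c l)).mulVec v := by
    have h1 : star x ⬝ᵥ (S.friction c).mulVec x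
        = v ⬝ᵥ ((1 : Mat3) + ∑ l ∈ Finset.univ.filter (fun l => l ≠ i₀),
            S.Z₁ r (c l)).mulVec v := by
      simp only [dotProduct, Matrix.mulVec, Fintype.sum_prod_type, friction, Matrix.of_apply, x,
        Pi.star_apply, star_trivial]
      rw [Finset.sum_eq_single i₀ (fun b _ hb => by simp [hb]) (by simp)]
      refine Finset.sum_congr rfl fun a _ => ?_
      rw [Finset.sum_eq_single i₀ (fun b _ hb => by simp [hb]) (by simp)]
      simp [c]
    rw [h1, Matrix.add_mulVec, Matrix.one_mulVec, dotProduct_add, Matrix.sum_mulVec,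
      dotProduct_sum]
  rw [hval] at hpos
  have hle : ∀ l ∈ Finset.univ.filter (fun l => l ≠ i₀),
      v ⬝ᵥ (S.Z₁ r (c l)).mulVec v ≤ -(v ⬝ᵥ v) / ((S.N : ℝ) - 1) := fun l hl => by
    have hl' : l ≠ i₀ := by simpa using hl
    have := (φ l).2.2
    rw [le_div_iff₀ (by linarith)]
    simp only [c, hl', if_false]
    linarith
  have hsum := Finset.sum_le_sum hle
  have hcard : ((Finset.univ.filter (fun l => l ≠ i₀)).card : ℝ) = (S.N : ℝ) - 1 := by
    rw [Finset.filter_ne', Finset.card_erase_of_mem (Finset.mem_univ _), Finset.card_univ,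
      Fintype.card_fin, Nat.cast_sub (by omega), Nat.cast_one]
  rw [Finset.sum_const, nsmul_eq_mul, hcard, mul_div_cancel₀ _ (by linarith)] at hsum
  linarith

/-- The mean friction matrix `1 + ∫ g ρ Z₁ dr'` is the average of the matrices
`(N - 1)⁻¹ + Z₁(r, r')`, almost all of which are positive in any given direction. -/
theorem Standing.posDef_one_add_meanZ₁ {t₀ : ℝ} (hS : S.Standing t₀) {ρ : E3 → ℝ} {r : E3}
    (hpos : ∀ r', 0 ≤ S.g r r' * ρ r')
    (hnorm : ∫ r', S.g r r' * ρ r' = (S.N : ℝ) - 1)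
    (hint : ∀ i j, Integrable fun r' => S.g r r' * ρ r' * S.Z₁ r r' i j) :
    (1 + S.meanZ₁ ρ r).PosDef := by
  have hN' : (2 : ℝ) ≤ S.N := by exact_mod_cast hS.two_le
  have hg : Integrable fun r' => S.g r r' * ρ r' :=
    Integrable.of_integral_ne_zero (by rw [hnorm]; linarith)
  have hsymm : (1 + S.meanZ₁ ρ r).IsHermitian := by
    ext i j
    have : ∀ r', S.Z₁ r r' j i = S.Z₁ r r' i j := fun r' => (hS.Z₁_symm r r').apply i j
    simp [meanZ₁, this, Matrix.one_apply, eq_comm]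
  refine Matrix.PosDef.of_dotProduct_mulVec_pos hsymm fun v hv => ?_
  set F : E3 → ℝ := fun r' => S.g r r' * ρ r' * ((v ⬝ᵥ v) * ((S.N : ℝ) - 1)⁻¹
    + v ⬝ᵥ (S.Z₁ r r').mulVec v) with hF
  have hFeq : F = fun r' => S.g r r' * ρ r' * ((v ⬝ᵥ v) * ((S.N : ℝ) - 1)⁻¹)
      + ∑ i, ∑ j, v i * v j * (S.g r r' * ρ r' * S.Z₁ r r' i j) := by
    funext r'
    simp only [hF, mul_add, dotProduct, Matrix.mulVec, Finset.mul_sum]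
    congr 1
    exact Finset.sum_congr rfl fun i _ => Finset.sum_congr rfl fun j _ => by ring
  have hFint : Integrable F := by
    rw [hFeq]
    exact (hg.mul_const _).add (integrable_finsetSum _ fun i _ => integrable_finsetSum _
      fun j _ => (hint i j).const_mul _)
  have hval : star v ⬝ᵥ (1 + S.meanZ₁ ρ r).mulVec v = ∫ r', F r' := by
    rw [hFeq, integral_add (hg.mul_const _) (integrable_finsetSum _ fun i _ =>
      integrable_finsetSum _ fun j _ => (hint i j).const_mul _), integral_mul_const, hnorm,
      integral_finsetSum _ fun i _ => integrable_finsetSum _ fun j _ => (hint i j).const_mul _]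
    have e : ∀ i, ∫ r', ∑ j, v i * v j * (S.g r r' * ρ r' * S.Z₁ r r' i j)
        = ∑ j, v i * v j * S.meanZ₁ ρ r i j := fun i => by
      rw [integral_finsetSum _ fun j _ => (hint i j).const_mul _]
      simp only [integral_const_mul, meanZ₁, Matrix.of_apply]
    simp only [e]
    rw [star_trivial, Matrix.add_mulVec, Matrix.one_mulVec, dotProduct_add,
      mul_comm (v ⬝ᵥ v), ← mul_assoc, mul_inv_cancel₀ (by linarith), one_mul]
    congr 1
    simp only [dotProduct, Matrix.mulVec, Finset.mul_sum]
    exact Finset.sum_congr rfl fun i _ => Finset.sum_congr rfl fun j _ => by ring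
  -- `r' = r` is discarded as well: nothing is known about `Z₁ r r`
  have hgood : ∀ᵐ r', 0 < (v ⬝ᵥ v) * ((S.N : ℝ) - 1)⁻¹ + v ⬝ᵥ (S.Z₁ r r').mulVec v := by
    have h1 : ∀ᵐ r' : E3, r' ∉ insert r {r' | r' ≠ r ∧
        v ⬝ᵥ v + ((S.N : ℝ) - 1) * (v ⬝ᵥ (S.Z₁ r r').mulVec v) ≤ 0} :=
      measure_eq_zero_iff_ae_notMem.1 (((hS.finite_bad r v hv).insert r).measure_zero _)
    filter_upwards [h1] with r' hr'
    simp only [mem_insert_iff, mem_ofPred_eq, not_or, not_and, not_le] at hr'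
    have h2 := hr'.2 hr'.1
    have h3 : (v ⬝ᵥ v) * ((S.N : ℝ) - 1)⁻¹ + v ⬝ᵥ (S.Z₁ r r').mulVec v
        = (v ⬝ᵥ v + ((S.N : ℝ) - 1) * (v ⬝ᵥ (S.Z₁ r r').mulVec v)) * ((S.N : ℝ) - 1)⁻¹ := by
      have : (S.N : ℝ) - 1 ≠ 0 := by linarith
      field_simp
    rw [h3]
    exact mul_pos h2 (inv_pos.2 (by linarith))
  have hFnn : 0 ≤ᵐ[volume] F := by
    filter_upwards [hgood] with r' hr' using mul_nonneg (hpos r') hr'.le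
  rw [hval]
  refine lt_of_le_of_ne (integral_nonneg_of_ae hFnn) fun h0 => ?_
  have hz := (integral_eq_zero_iff_of_nonneg_ae hFnn hFint).1 h0.symm
  have hz' : (fun r' => S.g r r' * ρ r') =ᵐ[volume] fun _ => 0 := by
    filter_upwards [hz, hgood] with r' h1 h2
    exact (mul_eq_zero.1 h1).resolve_right h2.ne'
  rw [integral_congr_ae hz', integral_zero] at hnorm
  linarith

end Model

/-! ### Coordinates -/

/-- The `i`-th partial derivative of a scalar function on `ℝ³`. -/
def pd (i : Fin 3) (q : E3 → ℝ) (p : E3) : ℝ := fderiv ℝ q p (EuclideanSpace.single i 1)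

theorem norm_gradient (q : E3 → ℝ) (p : E3) : ‖gradient q p‖ = ‖fderiv ℝ q p‖ :=
  LinearIsometryEquiv.norm_map _ _

theorem gradient_apply (q : E3 → ℝ) (p : E3) (i : Fin 3) : gradient q p i = pd i q p := by
  have h := InnerProductSpace.toDual_symm_apply (𝕜 := ℝ) (x := EuclideanSpace.single i (1 : ℝ))
    (y := fderiv ℝ q p)
  rw [EuclideanSpace.inner_single_right] at h
  simpa [pd, gradient] using h

theorem inner_eq_sum (x y : E3) : inner ℝ x y = ∑ i, x i * y i := by
  simp [PiLp.inner_apply, mul_comm]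

theorem app_apply (A : Mat3) (v : E3) (i : Fin 3) : app A v i = ∑ j, A i j * v j := rfl

theorem abs_coord_le (v : E3) (i : Fin 3) : |v i| ≤ ‖v‖ := PiLp.norm_apply_le v i

theorem abs_pd_le (q : E3 → ℝ) (p : E3) (i : Fin 3) : |pd i q p| ≤ ‖fderiv ℝ q p‖ := by
  rw [← gradient_apply, ← norm_gradient]
  exact abs_coord_le _ _

/-- The `i`-th coordinate as a continuous linear functional. -/
def coordL (i : Fin 3) : E3 →L[ℝ] ℝ := EuclideanSpace.proj i

theorem hasFDerivAt_coord {W : E3 → E3} {x : E3} (hW : DifferentiableAt ℝ W x) (i : Fin 3) :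
    HasFDerivAt (fun y => W y i) ((coordL i).comp (fderiv ℝ W x)) x :=
  (coordL i).hasFDerivAt.comp x hW.hasFDerivAt

theorem pd_coord {W : E3 → E3} {x : E3} (hW : DifferentiableAt ℝ W x) (i j : Fin 3) :
    pd i (fun y => W y j) x = fderiv ℝ W x (EuclideanSpace.single i 1) j := by
  rw [pd, (hasFDerivAt_coord hW j).fderiv]
  rfl

theorem divergence_eq_sum_pd {W : E3 → E3} {x : E3} (hW : DifferentiableAt ℝ W x) :
    divergence W x = ∑ i, pd i (fun y => W y i) x := by
  simp only [divergence, pd_coord hW]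

theorem differentiableAt_of_coord {W : E3 → E3} {x : E3}
    (hW : ∀ i, DifferentiableAt ℝ (fun y => W y i) x) : DifferentiableAt ℝ W x :=
  differentiableAt_euclidean.2 hW

theorem divergence_app {A : Mat3} {W : E3 → E3} {x : E3} (hW : DifferentiableAt ℝ W x) :
    divergence (fun y => app A (W y)) x = ∑ i, ∑ j, A i j * pd i (fun y => W y j) x := by
  have hc : ∀ j, DifferentiableAt ℝ (fun y => W y j) x := fun j =>
    (hasFDerivAt_coord hW j).differentiableAt
  have hd : ∀ i, DifferentiableAt ℝ (fun y => app A (W y) i) x := fun i => by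
    simp only [app_apply]
    fun_prop
  rw [divergence_eq_sum_pd (differentiableAt_of_coord hd)]
  refine Finset.sum_congr rfl fun i _ => ?_
  simp only [app_apply, pd]
  rw [fderiv_fun_sum fun j _ => (hc j).const_mul _]
  simp only [sum_apply]
  refine Finset.sum_congr rfl fun j _ => ?_
  rw [fderiv_const_mul (hc j)]
  simp

theorem app_one (v : E3) : app 1 v = v := by
  ext i
  simp [app_apply, Matrix.one_apply]

theorem app_zero (v : E3) : app 0 v = 0 := by
  ext i
  simp [app_apply]

/-! ### Weights of polynomial growth -/

theorem growth_pd {q : E3 → ℝ} (hq : q.HasTemperateGrowth) (i : Fin 3) :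
    (pd i q).HasTemperateGrowth := by
  have h1 : (fderiv ℝ q).HasTemperateGrowth := by
    refine ⟨hq.1.fderiv_right (by simp), fun n => ?_⟩
    obtain ⟨k, C, hC⟩ := hq.2 (n + 1)
    exact ⟨k, C, fun x => by rw [norm_iteratedFDeriv_fderiv]; exact hC x⟩
  have h2 : Function.HasTemperateGrowth
      (ContinuousLinearMap.apply ℝ ℝ (EuclideanSpace.single i (1 : ℝ) : E3)) :=
    ContinuousLinearMap.hasTemperateGrowth _
  exact h2.comp h1

theorem growth_coord (i : Fin 3) : (fun p : E3 => p i).HasTemperateGrowth :=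
  (coordL i).hasTemperateGrowth

theorem growth_one : (fun _ : E3 => (1 : ℝ)).HasTemperateGrowth := .const 1

theorem growth_continuous {q : E3 → ℝ} (hq : q.HasTemperateGrowth) : Continuous q :=
  hq.1.continuous

theorem growth_differentiable {q : E3 → ℝ} (hq : q.HasTemperateGrowth) : Differentiable ℝ q :=
  hq.1.differentiable (by simp)

/-- A momentum envelope: non-negative with finite moments of all orders. -/
structure MomentEnvelope (w : E3 → ℝ) : Prop where
  nonneg : ∀ p, 0 ≤ w p
  int : ∀ k : ℕ, Integrable fun p : E3 => ‖p‖ ^ k * w p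

namespace MomentEnvelope

variable {w : E3 → ℝ} (hw : MomentEnvelope w)
include hw

theorem integrable : Integrable w := by simpa using hw.int 0

theorem integrable_mul {q : E3 → ℝ} (hq : q.HasTemperateGrowth) :
    Integrable fun p => |q p| * w p := by
  obtain ⟨k, C, hC⟩ := hq.2 0
  have hdom : Integrable fun p => |C| * 2 ^ k * (w p + ‖p‖ ^ k * w p) :=
    (hw.integrable.add (hw.int k)).const_mul _
  refine hdom.mono' ((growth_continuous hq).abs.aestronglyMeasurable.mul
    hw.integrable.aestronglyMeasurable) (Eventually.of_forall fun p => ?_)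
  have h1 : |q p| ≤ C * (1 + ‖p‖) ^ k := by simpa using hC p
  have h2 : (1 + ‖p‖) ^ k ≤ 2 ^ k * (1 + ‖p‖ ^ k) := by
    rcases le_total 1 ‖p‖ with h | h
    · calc (1 + ‖p‖) ^ k ≤ (2 * ‖p‖) ^ k := by gcongr; linarith
        _ = 2 ^ k * ‖p‖ ^ k := mul_pow _ _ _
        _ ≤ 2 ^ k * (1 + ‖p‖ ^ k) := by gcongr; linarith
    · calc (1 + ‖p‖) ^ k ≤ 2 ^ k := by gcongr; linarith
        _ ≤ 2 ^ k * (1 + ‖p‖ ^ k) := le_mul_of_one_le_right (by positivity)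
            (by linarith [pow_nonneg (norm_nonneg p) k])
  rw [Real.norm_of_nonneg (mul_nonneg (abs_nonneg _) (hw.nonneg p))]
  calc |q p| * w p ≤ (|C| * (2 ^ k * (1 + ‖p‖ ^ k))) * w p := by
        refine mul_le_mul_of_nonneg_right (h1.trans ?_) (hw.nonneg p)
        exact mul_le_mul (le_abs_self C) h2 (by positivity) (abs_nonneg _)
    _ = _ := by ring

/-- Integrability of a weight against a function dominated by the envelope. -/
theorem integrable_weight {q v : E3 → ℝ} (hq : q.HasTemperateGrowth)
    (hv : AEStronglyMeasurable v) {B : ℝ} (hB : ∀ p, |v p| ≤ B * w p) :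
    Integrable fun p => q p * v p := by
  refine ((hw.integrable_mul hq).const_mul B).mono'
    ((growth_continuous hq).aestronglyMeasurable.mul hv) (Eventually.of_forall fun p => ?_)
  rw [Real.norm_eq_abs, abs_mul]
  calc |q p| * |v p| ≤ |q p| * (B * w p) := by gcongr; exact hB p
    _ = _ := by ring

theorem abs_integral_weight_le {q v : E3 → ℝ} (hq : q.HasTemperateGrowth)
    {B : ℝ} (hB : ∀ p, |v p| ≤ B * w p) :
    |∫ p, q p * v p| ≤ B * ∫ p, |q p| * w p := by
  rw [← integral_const_mul, ← Real.norm_eq_abs]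
  refine norm_integral_le_of_norm_le ((hw.integrable_mul hq).const_mul B)
    (Eventually.of_forall fun p => ?_)
  rw [Real.norm_eq_abs, abs_mul]
  calc |q p| * |v p| ≤ |q p| * (B * w p) := by gcongr; exact hB p
    _ = _ := by ring

end MomentEnvelope

/-! ### Integration by parts in momentum space -/

/-- Functions of the momentum dominated, with two derivatives, by the envelope `w`. -/
structure MomentumJet (w : E3 → ℝ) (B : ℝ) (v : E3 → ℝ) : Prop where
  contDiff : ContDiff ℝ 2 v
  bound₀ : ∀ p, |v p| ≤ B * w p
  bound₁ : ∀ p, ‖gradient v p‖ ≤ B * w p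
  bound₂ : ∀ p, ‖fderiv ℝ (gradient v) p‖ ≤ B * w p

namespace MomentumJet

variable {w : E3 → ℝ} {B : ℝ} {v : E3 → ℝ} (hv : MomentumJet w B v)
include hv

theorem contDiff_pd (j : Fin 3) : ContDiff ℝ 1 (pd j v) :=
  (hv.contDiff.fderiv_right (m := 1) (by norm_num)).clm_apply contDiff_const

theorem abs_pd_le (j : Fin 3) (p : E3) : |pd j v p| ≤ B * w p := by
  rw [← gradient_apply]
  exact (abs_coord_le _ _).trans (hv.bound₁ p)

theorem differentiable_gradient : Differentiable ℝ (gradient v) := fun p =>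
  differentiableAt_of_coord fun i => by
    simp only [gradient_apply]
    exact (hv.contDiff_pd i).differentiable (by norm_num) p

theorem abs_pd_pd_le (i j : Fin 3) (p : E3) : |pd i (pd j v) p| ≤ B * w p := by
  have h : pd j v = fun p => gradient v p j := funext fun p => (gradient_apply v p j).symm
  rw [h, pd_coord (hv.differentiable_gradient p)]
  refine (abs_coord_le _ _).trans ((ContinuousLinearMap.le_opNorm _ _).trans ?_)
  simpa using hv.bound₂ p

theorem integral_weight_mul_pd (hw : MomentEnvelope w) {q : E3 → ℝ} (hq : q.HasTemperateGrowth)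
    (i : Fin 3) : ∫ p, q p * pd i v p = -∫ p, pd i q p * v p :=
  integral_mul_fderiv_eq_neg_fderiv_mul_of_integrable
    (hw.integrable_weight (growth_pd hq i) hv.contDiff.continuous.aestronglyMeasurable hv.bound₀)
    (hw.integrable_weight hq (hv.contDiff_pd i).continuous.aestronglyMeasurable (hv.abs_pd_le i))
    (hw.integrable_weight hq hv.contDiff.continuous.aestronglyMeasurable hv.bound₀)
    (fun p _ => growth_differentiable hq p)
    (fun p _ => hv.contDiff.differentiable (by norm_num) p)

/-- The components of `(p + ∇_p) v`. -/
theorem pd_component (i j : Fin 3) (p : E3) :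
    pd i (fun p => v p * p j + pd j v p) p
      = v p * (if i = j then 1 else 0) + p j * pd i v p + pd i (pd j v) p := by
  have h1 : DifferentiableAt ℝ v p := hv.contDiff.differentiable (by norm_num) p
  have h2 : DifferentiableAt ℝ (fun p : E3 => p j) p :=
    growth_differentiable (growth_coord j) p
  have h3 : DifferentiableAt ℝ (pd j v) p := (hv.contDiff_pd j).differentiable (by norm_num) p
  have h4 : fderiv ℝ (fun p : E3 => p j) p = coordL j :=
    (coordL j).fderiv
  rw [pd, fderiv_fun_add (h1.fun_mul h2) h3, fderiv_fun_mul h1 h2, h4]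
  simp [pd, coordL, eq_comm]

theorem integrable_weight_mul_pd_component (hw : MomentEnvelope w) {q : E3 → ℝ}
    (hq : q.HasTemperateGrowth) (i j : Fin 3) :
    Integrable fun p => q p * pd i (fun p => v p * p j + pd j v p) p := by
  have e : (fun p => q p * pd i (fun p => v p * p j + pd j v p) p)
      = fun p => (if i = j then 1 else 0) * (q p * v p) + (q p * p j) * pd i v p
        + q p * pd i (pd j v) p := by
    funext p
    rw [hv.pd_component]
    ring
  have hc : Continuous (pd i (pd j v)) :=
    ((hv.contDiff_pd j).continuous_fderiv (by norm_num)).clm_apply continuous_const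
  rw [e]
  exact (((hw.integrable_weight hq hv.contDiff.continuous.aestronglyMeasurable
    hv.bound₀).const_mul _).add (hw.integrable_weight (hq.mul (growth_coord j))
    (hv.contDiff_pd i).continuous.aestronglyMeasurable (hv.abs_pd_le i))).add
    (hw.integrable_weight hq hc.aestronglyMeasurable (hv.abs_pd_pd_le i j))

/-- Integration by parts, twice in the diffusion term, moves all derivatives onto the weight. -/
theorem integral_weight_mul_pd_component (hw : MomentEnvelope w) {q : E3 → ℝ}
    (hq : q.HasTemperateGrowth) (i j : Fin 3) :
    ∫ p, q p * pd i (fun p => v p * p j + pd j v p) p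
      = -((∫ p, (pd i q p * p j) * v p) - ∫ p, pd j (pd i q) p * v p) := by
  have hm : AEStronglyMeasurable v := hv.contDiff.continuous.aestronglyMeasurable
  have hm' := fun i => (hv.contDiff_pd i).continuous.aestronglyMeasurable (μ := volume)
  have split : ∀ {q : E3 → ℝ}, q.HasTemperateGrowth →
      Integrable (fun p => q p * p j * v p) ∧ Integrable (fun p => q p * pd j v p) := fun hq =>
    ⟨hw.integrable_weight (hq.mul (growth_coord j)) hm hv.bound₀,
      hw.integrable_weight hq (hm' j) (hv.abs_pd_le j)⟩
  have e : ∀ q : E3 → ℝ, (fun p => q p * (v p * p j + pd j v p))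
      = fun p => q p * p j * v p + q p * pd j v p := fun q => by funext p; ring
  have s1 := split hq
  have s2 := split (growth_pd hq i)
  have i1 : Integrable fun p => q p * (v p * p j + pd j v p) := by
    rw [e]; exact s1.1.add s1.2
  have i2 : Integrable fun p => pd i q p * (v p * p j + pd j v p) := by
    rw [e]; exact s2.1.add s2.2
  have parts := integral_mul_fderiv_eq_neg_fderiv_mul_of_integrable (μ := volume)
    (v := EuclideanSpace.single i 1) i2 (hv.integrable_weight_mul_pd_component hw hq i j) i1
    (fun p _ => growth_differentiable hq p) (fun p _ => by
      have h1 : DifferentiableAt ℝ v p := hv.contDiff.differentiable (by norm_num) p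
      have h2 := growth_differentiable (growth_coord j) p
      have h3 : DifferentiableAt ℝ (pd j v) p :=
        (hv.contDiff_pd j).differentiable (by norm_num) p
      exact (h1.mul h2).add h3)
  change ∫ p, q p * pd i (fun p => v p * p j + pd j v p) p
    = -∫ p, pd i q p * (v p * p j + pd j v p) at parts
  rw [parts, e, integral_add s2.1 s2.2, hv.integral_weight_mul_pd hw (growth_pd hq i),
    ← sub_eq_add_neg]

end MomentumJet

/-! ### Velocity moments and their derivatives -/

/-- The moment `∫ q(p) v(r, p) dp` of a phase-space function with respect to the weight `q`. -/
def mom (q : E3 → ℝ) (v : E3 → E3 → ℝ) (r : E3) : ℝ := ∫ p, q p * v r p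

theorem density_eq_mom (v : E3 → E3 → ℝ) : density v = mom (fun _ => 1) v := by
  funext r
  simp [density, mom]

/-- The envelope `h(r) w(p)` with `h` bounded and `w` having finite moments. -/
structure PhaseEnvelope (h w : E3 → ℝ) : Prop where
  moments : MomentEnvelope w
  nonneg : ∀ r, 0 ≤ h r
  bdd : ∃ H, ∀ r, h r ≤ H

theorem Model.Envelope.phaseEnvelope {S : Model} {h w : E3 → ℝ} (he : S.Envelope h w) :
    PhaseEnvelope h w := ⟨⟨he.w_nonneg, he.w_int⟩, he.h_nonneg, he.h_bdd⟩

/-- On the time window `(s, t₀)` the function `u` is dominated, together with the derivatives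
occurring in the kinetic equation, by `C h(r) w(p)`. -/
structure JetDominated (h w : E3 → ℝ) (t₀ s C : ℝ) (u : ℝ → E3 → E3 → ℝ) : Prop where
  regular : RegularOn t₀ u
  bound : ∀ t ∈ Ioo s t₀, ∀ r p, JetBound u t r p (C * (h r * w p))

namespace JetDominated

variable {h w : E3 → ℝ} {t₀ s C : ℝ} {u : ℝ → E3 → E3 → ℝ}

theorem add {v : ℝ → E3 → E3 → ℝ} {D : ℝ} (hs : 0 ≤ s) (hu : JetDominated h w t₀ s C u)
    (hv : JetDominated h w t₀ s D v) :
    JetDominated h w t₀ s (C + D) (fun t r p => u t r p + v t r p) where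
  regular := ⟨fun t ht => (hu.regular.phase t ht).add (hv.regular.phase t ht),
    fun t ht r p => (hu.regular.time t ht r p).add (hv.regular.time t ht r p)⟩
  bound := fun t ht r p => by
    have ht' : t ∈ Ioo 0 t₀ := ⟨hs.trans_lt ht.1, ht.2⟩
    have hur : DifferentiableAt ℝ (fun x => u t x p) r :=
      ((hu.regular.phase t ht').comp (contDiff_id.prodMk contDiff_const)).differentiable
        (by norm_num) r
    have hvr : DifferentiableAt ℝ (fun x => v t x p) r :=
      ((hv.regular.phase t ht').comp (contDiff_id.prodMk contDiff_const)).differentiable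
        (by norm_num) r
    have hup : ContDiff ℝ 2 (fun q => u t r q) :=
      (hu.regular.phase t ht').comp (contDiff_const.prodMk contDiff_id)
    have hvp : ContDiff ℝ 2 (fun q => v t r q) :=
      (hv.regular.phase t ht').comp (contDiff_const.prodMk contDiff_id)
    obtain ⟨a1, a2, a3, a4, a5⟩ := hu.bound t ht r p
    obtain ⟨b1, b2, b3, b4, b5⟩ := hv.bound t ht r p
    have e4 : ∀ q, gradP (fun r p => u t r p + v t r p) r q
        = gradP (u t) r q + gradP (v t) r q := fun q => by
      unfold gradP gradient
      rw [fderiv_fun_add (hup.differentiable (by norm_num) q)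
        (hvp.differentiable (by norm_num) q), map_add]
    have hg : ∀ {f : E3 → ℝ}, ContDiff ℝ 2 f → Differentiable ℝ (gradient f) := fun hf q => by
      have : DifferentiableAt ℝ (fderiv ℝ _) q :=
        ((hf.fderiv_right (m := 1) (by norm_num)).differentiable (by norm_num) q)
      exact ((InnerProductSpace.toDual ℝ E3).symm.toContinuousLinearEquiv.toContinuousLinearMap
        |>.differentiableAt).comp q this
    rw [add_mul]
    refine ⟨(abs_add_le _ _).trans (add_le_add a1 b1), ?_, ?_, ?_, ?_⟩
    · rw [deriv_fun_add (hu.regular.time t ht' r p) (hv.regular.time t ht' r p)]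
      exact (abs_add_le _ _).trans (add_le_add a2 b2)
    · have : gradR (fun r p => u t r p + v t r p) r p = gradR (u t) r p + gradR (v t) r p := by
        unfold gradR gradient
        rw [fderiv_fun_add hur hvr, map_add]
      rw [this]
      exact (norm_add_le _ _).trans (add_le_add a3 b3)
    · rw [e4]
      exact (norm_add_le _ _).trans (add_le_add a4 b4)
    · simp only [e4]
      have gu : DifferentiableAt ℝ (fun q => gradP (u t) r q) p := hg hup p
      have gv : DifferentiableAt ℝ (fun q => gradP (v t) r q) p := hg hvp p
      rw [fderiv_fun_add gu gv]
      exact (norm_add_le _ _).trans (add_le_add a5 b5)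

theorem const_mul (hu : JetDominated h w t₀ s C u) (c : ℝ) :
    JetDominated h w t₀ s (|c| * C) (fun t r p => c * u t r p) where
  regular := ⟨fun t ht => contDiff_const.mul (hu.regular.phase t ht),
    fun t ht r p => (hu.regular.time t ht r p).const_mul c⟩
  bound := fun t ht r p => by
    obtain ⟨a1, a2, a3, a4, a5⟩ := hu.bound t ht r p
    have e : ∀ (f : E3 → ℝ) x, gradient (fun y => c * f y) x = c • gradient f x := fun f x => by
      unfold gradient
      rw [show (fun y => c * f y) = c • f from rfl, fderiv_const_smul_field]
      simp
    have e4 : gradP (fun r p => c * u t r p) r = c • gradP (u t) r := funext fun q => e _ _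
    have nn := abs_nonneg c
    rw [mul_assoc]
    refine ⟨?_, ?_, ?_, ?_, ?_⟩
    · rw [abs_mul]; gcongr
    · rw [deriv_const_mul_field, abs_mul]; gcongr
    · rw [gradR, e, norm_smul, Real.norm_eq_abs]
      exact mul_le_mul_of_nonneg_left a3 nn
    · rw [e4, Pi.smul_apply, norm_smul, Real.norm_eq_abs]
      gcongr
    · rw [show (fun q => gradP (fun r p => c * u t r p) r q) = c • gradP (u t) r from e4,
        fderiv_const_smul_field, Pi.smul_apply, norm_smul, Real.norm_eq_abs]
      exact mul_le_mul_of_nonneg_left a5 nn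

section Moments

variable (hs : 0 ≤ s) (he : PhaseEnvelope h w) (hu : JetDominated h w t₀ s C u) {t : ℝ}
  (ht : t ∈ Ioo s t₀)
include hs hu ht

theorem phase : ContDiff ℝ 2 (fun z : E3 × E3 => u t z.1 z.2) :=
  hu.regular.phase t ⟨hs.trans_lt ht.1, ht.2⟩

theorem continuous_slice (r : E3) : Continuous (u t r) :=
  (hu.phase hs ht).continuous.comp (Continuous.prodMk_right r)

theorem momentumJet (r : E3) : MomentumJet w (C * h r) (u t r) where
  contDiff := (hu.phase hs ht).comp (contDiff_const.prodMk contDiff_id)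
  bound₀ := fun p => (hu.bound t ht r p).1.trans_eq (mul_assoc _ _ _).symm
  bound₁ := fun p => (hu.bound t ht r p).2.2.2.1.trans_eq (mul_assoc _ _ _).symm
  bound₂ := fun p => (hu.bound t ht r p).2.2.2.2.trans_eq (mul_assoc _ _ _).symm

theorem hasFDerivAt_slice (r p : E3) :
    HasFDerivAt (fun x => u t x p) ((fderiv ℝ (fun z : E3 × E3 => u t z.1 z.2) (r, p)).comp
      (ContinuousLinearMap.inl ℝ E3 E3)) r :=
  HasFDerivAt.comp (g := fun z : E3 × E3 => u t z.1 z.2) (f := fun x => (x, p)) r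
    ((hu.phase hs ht).differentiable (by norm_num) (r, p)).hasFDerivAt
    (hasFDerivAt_prodMk_left r p)

theorem continuous_fderiv_slice :
    Continuous fun z : E3 × E3 => fderiv ℝ (fun x => u t x z.2) z.1 := by
  have : (fun z : E3 × E3 => fderiv ℝ (fun x => u t x z.2) z.1) = fun z =>
      (fderiv ℝ (fun z : E3 × E3 => u t z.1 z.2) z).comp (ContinuousLinearMap.inl ℝ E3 E3) :=
    funext fun z => (hu.hasFDerivAt_slice hs ht z.1 z.2).fderiv
  rw [this]
  exact ((hu.phase hs ht).continuous_fderiv (by norm_num)).clm_comp continuous_const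

omit hs in
theorem norm_fderiv_slice_le (r p : E3) :
    ‖fderiv ℝ (fun x => u t x p) r‖ ≤ C * (h r * w p) := by
  rw [← norm_gradient]
  exact (hu.bound t ht r p).2.2.1

include he

theorem integrable_mom {q : E3 → ℝ} (hq : q.HasTemperateGrowth) (r : E3) :
    Integrable fun p => q p * u t r p :=
  he.moments.integrable_weight hq (hu.continuous_slice hs ht r).aestronglyMeasurable
    (hu.momentumJet hs ht r).bound₀

theorem abs_mom_le {q : E3 → ℝ} (hq : q.HasTemperateGrowth) (r : E3) :
    |mom q (u t) r| ≤ C * h r * ∫ p, |q p| * w p :=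
  he.moments.abs_integral_weight_le hq (hu.momentumJet hs ht r).bound₀

theorem hasFDerivAt_mom {q : E3 → ℝ} (hq : q.HasTemperateGrowth) (r : E3) :
    HasFDerivAt (mom q (u t)) (∫ p, q p • fderiv ℝ (fun x => u t x p) r) r := by
  obtain ⟨H, hH⟩ := he.bdd
  refine hasFDerivAt_integral_of_dominated_of_fderiv_le (s := univ)
    (bound := fun p => |C| * H * (|q p| * w p)) (F := fun r p => q p * u t r p)
    (F' := fun r p => q p • fderiv ℝ (fun x => u t x p) r) univ_mem
    (Eventually.of_forall fun r => (hu.integrable_mom hs he ht hq r).aestronglyMeasurable)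
    (hu.integrable_mom hs he ht hq r) ?_ (Eventually.of_forall fun p x _ => ?_)
    ((he.moments.integrable_mul hq).const_mul _) (Eventually.of_forall fun p x _ => ?_)
  · exact ((growth_continuous hq).smul ((hu.continuous_fderiv_slice hs ht).comp
      (Continuous.prodMk_right r))).aestronglyMeasurable
  · rw [norm_smul, Real.norm_eq_abs]
    have h1 : C * (h x * w p) ≤ |C| * (H * w p) :=
      mul_le_mul (le_abs_self C) (mul_le_mul_of_nonneg_right (hH x) (he.moments.nonneg p))
        (mul_nonneg (he.nonneg x) (he.moments.nonneg p)) (abs_nonneg C)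
    calc |q p| * ‖fderiv ℝ (fun x => u t x p) x‖ ≤ |q p| * (|C| * (H * w p)) := by
          gcongr
          exact (hu.norm_fderiv_slice_le ht x p).trans h1
      _ = _ := by ring
  · have := (hu.hasFDerivAt_slice hs ht x p).differentiableAt.hasFDerivAt.const_mul (q p)
    exact this

/-- Differentiation of a moment under the integral sign. -/
theorem pd_mom {q : E3 → ℝ} (hq : q.HasTemperateGrowth) (r : E3) (l : Fin 3) :
    pd l (mom q (u t)) r = ∫ p, q p * gradR (u t) r p l := by
  have hint : Integrable fun p => q p • fderiv ℝ (fun x => u t x p) r := by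
    refine ((he.moments.integrable_mul hq).const_mul (C * h r)).mono'
      ((growth_continuous hq).smul ((hu.continuous_fderiv_slice hs ht).comp
        (Continuous.prodMk_right r))).aestronglyMeasurable (Eventually.of_forall fun p => ?_)
    rw [norm_smul, Real.norm_eq_abs]
    calc |q p| * ‖fderiv ℝ (fun x => u t x p) r‖ ≤ |q p| * (C * (h r * w p)) := by
          gcongr; exact hu.norm_fderiv_slice_le ht r p
      _ = _ := by ring
  rw [pd, (hu.hasFDerivAt_mom hs he ht hq r).fderiv, ContinuousLinearMap.integral_apply hint]
  refine integral_congr_ae (Eventually.of_forall fun p => ?_)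
  simp only [gradR, gradient_apply, pd]
  rfl

theorem contDiff_mom {q : E3 → ℝ} (hq : q.HasTemperateGrowth) : ContDiff ℝ 1 (mom q (u t)) := by
  rw [contDiff_one_iff_fderiv]
  refine ⟨fun r => (hu.hasFDerivAt_mom hs he ht hq r).differentiableAt, ?_⟩
  obtain ⟨H, hH⟩ := he.bdd
  have : fderiv ℝ (mom q (u t)) = fun r => ∫ p, q p • fderiv ℝ (fun x => u t x p) r :=
    funext fun r => (hu.hasFDerivAt_mom hs he ht hq r).fderiv
  rw [this]
  refine continuous_of_dominated (bound := fun p => |C| * H * (|q p| * w p)) (fun r => ?_)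
    (fun x => Eventually.of_forall fun p => ?_) ((he.moments.integrable_mul hq).const_mul _)
    (Eventually.of_forall fun p => ?_)
  · exact ((growth_continuous hq).smul ((hu.continuous_fderiv_slice hs ht).comp
      (Continuous.prodMk_right r))).aestronglyMeasurable
  · rw [norm_smul, Real.norm_eq_abs]
    have h1 : C * (h x * w p) ≤ |C| * (H * w p) :=
      mul_le_mul (le_abs_self C) (mul_le_mul_of_nonneg_right (hH x) (he.moments.nonneg p))
        (mul_nonneg (he.nonneg x) (he.moments.nonneg p)) (abs_nonneg C)
    calc |q p| * ‖fderiv ℝ (fun x => u t x p) x‖ ≤ |q p| * (|C| * (H * w p)) := by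
          gcongr
          exact (hu.norm_fderiv_slice_le ht x p).trans h1
      _ = _ := by ring
  · exact ((hu.continuous_fderiv_slice hs ht).comp (Continuous.prodMk_left p)).const_smul (q p)

theorem norm_fderiv_mom_le {q : E3 → ℝ} (hq : q.HasTemperateGrowth) (r : E3) :
    ‖fderiv ℝ (mom q (u t)) r‖ ≤ C * h r * ∫ p, |q p| * w p := by
  rw [(hu.hasFDerivAt_mom hs he ht hq r).fderiv, ← integral_const_mul]
  refine norm_integral_le_of_norm_le ((he.moments.integrable_mul hq).const_mul _)
    (Eventually.of_forall fun p => ?_)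
  rw [norm_smul, Real.norm_eq_abs]
  calc |q p| * ‖fderiv ℝ (fun x => u t x p) r‖ ≤ |q p| * (C * (h r * w p)) := by
        gcongr; exact hu.norm_fderiv_slice_le ht r p
    _ = _ := by ring

omit he in
/-- The time derivative is a pointwise limit of measurable difference quotients; its continuity in
the momentum is not assumed. -/
theorem aestronglyMeasurable_deriv (r : E3) :
    AEStronglyMeasurable (fun p => deriv (fun s => u s r p) t) := by
  have ht' : t ∈ Ioo 0 t₀ := ⟨hs.trans_lt ht.1, ht.2⟩
  classical
  refine aestronglyMeasurable_of_tendsto_ae (𝓝[≠] t)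
    (f := fun y p => if y ∈ Ioo 0 t₀ then slope (fun s => u s r p) t y else 0) (fun y => ?_)
    (Eventually.of_forall fun p => ?_)
  · by_cases hy : y ∈ Ioo 0 t₀
    · simp only [hy, if_true, slope_def_field]
      have c1 : Continuous (u y r) :=
        (hu.regular.phase y hy).continuous.comp (Continuous.prodMk_right r)
      exact ((c1.sub (hu.continuous_slice hs ht r)).div_const _).aestronglyMeasurable
    · simp only [hy, if_false]
      exact aestronglyMeasurable_const
  · have h1 := hasDerivAt_iff_tendsto_slope.1 (hu.regular.time t ht' r p).hasDerivAt
    refine h1.congr' ?_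
    filter_upwards [nhdsWithin_le_nhds (Ioo_mem_nhds ht'.1 ht'.2)] with y hy
    simp [show y ∈ Ioo 0 t₀ from hy]

theorem hasDerivAt_mom {q : E3 → ℝ} (hq : q.HasTemperateGrowth) (r : E3) :
    HasDerivAt (fun s => mom q (u s) r) (∫ p, q p * deriv (fun s => u s r p) t) t := by
  refine (hasDerivAt_integral_of_dominated_loc_of_deriv_le (s := Ioo s t₀)
    (bound := fun p => C * h r * (|q p| * w p)) (F := fun t p => q p * u t r p)
    (F' := fun t p => q p * deriv (fun s => u s r p) t) (Ioo_mem_nhds ht.1 ht.2) ?_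
    (hu.integrable_mom hs he ht hq r) ?_ (Eventually.of_forall fun p x hx => ?_)
    ((he.moments.integrable_mul hq).const_mul _) (Eventually.of_forall fun p x hx => ?_)).2
  · filter_upwards [Ioo_mem_nhds ht.1 ht.2] with x hx
    exact (hu.integrable_mom hs he hx hq r).aestronglyMeasurable
  · exact (growth_continuous hq).aestronglyMeasurable.mul
      (hu.aestronglyMeasurable_deriv hs ht r)
  · rw [norm_mul, Real.norm_eq_abs, Real.norm_eq_abs]
    calc |q p| * |deriv (fun s => u s r p) x| ≤ |q p| * (C * (h r * w p)) := by
          gcongr; exact (hu.bound x hx r p).2.1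
      _ = _ := by ring
  · exact (hu.regular.time x ⟨hs.trans_lt hx.1, hx.2⟩ r p).hasDerivAt.const_mul (q p)

theorem abs_deriv_mom_le {q : E3 → ℝ} (hq : q.HasTemperateGrowth) (r : E3) :
    |deriv (fun s => mom q (u s) r) t| ≤ C * h r * ∫ p, |q p| * w p := by
  rw [(hu.hasDerivAt_mom hs he ht hq r).deriv]
  exact he.moments.abs_integral_weight_le hq fun p =>
    (hu.bound t ht r p).2.1.trans_eq (mul_assoc _ _ _).symm

theorem mom_pd {q : E3 → ℝ} (hq : q.HasTemperateGrowth) (r : E3) (l : Fin 3) :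
    ∫ p, q p * gradP (u t) r p l = -mom (pd l q) (u t) r := by
  have : ∀ p, gradP (u t) r p l = pd l (u t r) p := fun p => gradient_apply _ _ _
  simp only [this]
  exact (hu.momentumJet hs ht r).integral_weight_mul_pd he.moments hq l

end Moments

end JetDominated

/-! ### Pair kernels integrated against densities -/

section Kernel

variable {F : Type*} [NormedAddCommGroup F] [NormedSpace ℝ F]
  {h w : E3 → ℝ} {K : E3 → F} {B : ℝ}

theorem norm_smul_kernel_le (hpos : ∀ r, 0 < h r) {x : E3} {y D : ℝ} (hy : |y| ≤ D * h x) :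
    ‖y • K x‖ ≤ D * ‖h x • K x‖ := by
  rw [norm_smul, norm_smul, Real.norm_eq_abs, Real.norm_of_nonneg (hpos x).le, ← mul_assoc]
  exact mul_le_mul_of_nonneg_right hy (norm_nonneg _)

/-- Dividing by the strictly positive envelope `h` shows that a kernel which is integrable against
`h` is measurable. -/
theorem aestronglyMeasurable_kernel (hpos : ∀ r, 0 < h r) (hint : Integrable h)
    (hK : Integrable fun x => h x • K x) : AEStronglyMeasurable K := by
  have h1 : AEStronglyMeasurable (fun x => (h x)⁻¹ • (h x • K x)) :=
    (hint.aestronglyMeasurable.aemeasurable.inv.aestronglyMeasurable).smul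
      hK.aestronglyMeasurable
  refine h1.congr (Eventually.of_forall fun x => ?_)
  simp only [smul_smul, inv_mul_cancel₀ (hpos x).ne', one_smul]

theorem integrable_smul_kernel (hpos : ∀ r, 0 < h r) (hint : Integrable h)
    (hK : Integrable fun x => h x • K x) {σ : E3 → ℝ} (hσ : AEStronglyMeasurable σ)
    (hB : ∀ x, |σ x| ≤ B * h x) : Integrable fun x => σ x • K x :=
  (hK.norm.const_mul B).mono' (hσ.smul (aestronglyMeasurable_kernel hpos hint hK))
    (Eventually.of_forall fun x => norm_smul_kernel_le hpos (hB x))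

theorem norm_integral_smul_kernel_le (hpos : ∀ r, 0 < h r)
    (hK : Integrable fun x => h x • K x) {σ : E3 → ℝ}
    (hB : ∀ x, |σ x| ≤ B * h x) : ‖∫ x, σ x • K x‖ ≤ B * ∫ x, ‖h x • K x‖ := by
  rw [← integral_const_mul]
  exact norm_integral_le_of_norm_le (hK.norm.const_mul B)
    (Eventually.of_forall fun x => norm_smul_kernel_le hpos (hB x))

/-- Fubini's theorem: the momentum variable can be integrated out first. -/
theorem integral_phase_smul_kernel [CompleteSpace F] (hpos : ∀ r, 0 < h r) (hint : Integrable h)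
    (hK : Integrable fun x => h x • K x) (hw : Integrable w) {v : E3 → E3 → ℝ}
    (hv : Continuous fun z : E3 × E3 => v z.1 z.2) (hB : ∀ r p, |v r p| ≤ B * (h r * w p)) :
    ∫ z : E3 × E3, v z.1 z.2 • K z.1 = ∫ x, density v x • K x := by
  have i1 : Integrable (fun z : E3 × E3 => v z.1 z.2 • K z.1) (volume.prod volume) := by
    refine ((hK.norm.mul_prod hw).const_mul B).mono' (hv.aestronglyMeasurable.smul
      (aestronglyMeasurable_kernel hpos hint hK).comp_fst) (Eventually.of_forall fun z => ?_)
    calc ‖v z.1 z.2 • K z.1‖ ≤ (B * w z.2) * ‖h z.1 • K z.1‖ :=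
          norm_smul_kernel_le hpos ((hB _ _).trans_eq (by ring))
      _ = _ := by ring
  rw [Measure.volume_eq_prod, integral_prod _ i1]
  refine integral_congr_ae (Eventually.of_forall fun x => ?_)
  exact integral_smul_const (fun p => v x p) (K x)

end Kernel

namespace Model

variable {S : Model} {h w : E3 → ℝ}

theorem meanZ₁_apply (ρ : E3 → ℝ) (r : E3) (i j : Fin 3) :
    S.meanZ₁ ρ r i j = ∫ r', ρ r' • (S.g r r' * S.Z₁ r r' i j) := by
  simp only [meanZ₁, Matrix.of_apply, smul_eq_mul]
  exact integral_congr_ae (Eventually.of_forall fun x => by ring)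

theorem meanForce_eq (ρ : E3 → ℝ) (r : E3) :
    S.meanForce ρ r = ∫ r', ρ r' • (S.g r r' • gradient (fun x => S.V₂ x r') r) := by
  simp only [meanForce, smul_smul]

theorem Envelope.kernel_Z₁ (he : S.Envelope h w) (r : E3) (i j : Fin 3) :
    Integrable fun r' => h r' • (S.g r r' * S.Z₁ r r' i j) := by
  refine (he.Z₁_int r i j).congr (Eventually.of_forall fun x => ?_)
  simp only [smul_eq_mul]
  ring

theorem Envelope.kernel_g (he : S.Envelope h w) (r : E3) :
    Integrable fun r' => h r' • S.g r r' := by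
  refine (he.g_int r).congr (Eventually.of_forall fun x => ?_)
  simp only [smul_eq_mul]
  ring

theorem Envelope.kernel_V₂ (he : S.Envelope h w) (r : E3) :
    Integrable fun r' => h r' • (S.g r r' • gradient (fun x => S.V₂ x r') r) := by
  simpa only [smul_smul] using he.V₂_int r

/-- The envelope is strictly positive, as it dominates a positive solution. -/
theorem Envelope.h_pos (he : S.Envelope h w) {t₀ ε C : ℝ} {f : ℝ → E3 → E3 → ℝ}
    (hf : S.IsOneBodySolution t₀ ε f) {t : ℝ} (ht : t ∈ Icc 0 t₀)
    (hC : ∀ r p, |f t r p| ≤ C * (h r * w p)) (r : E3) : 0 < h r := by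
  refine lt_of_le_of_ne (he.h_nonneg r) fun h0 => ?_
  have h1 := hC r 0
  rw [← h0, zero_mul, mul_zero] at h1
  have h2 := hf.pos t ht r 0
  linarith [le_abs_self (f t r 0)]

/-! ### Moments of the kinetic equation -/

/-- The total force on a particle, external plus mean, in units of `k_B T` and up to sign. -/
def totalForce (S : Model) (t : ℝ) (ρ : E3 → ℝ) (r : E3) : E3 :=
  gradient (S.V₁ t) r + S.meanForce ρ r

/-- The kinetic operator of a dominated solution in terms of its density only. -/
theorem deriv_eq_of_isOneBodySolution (he : S.Envelope h w) (hpos : ∀ r, 0 < h r)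
    (hZ₂ : ∀ r r', S.Z₂ r r' = 0) {t₀ ε s C : ℝ} {f : ℝ → E3 → E3 → ℝ} (hs : 0 ≤ s)
    (hf : S.IsOneBodySolution t₀ ε f) (hu : JetDominated h w t₀ s C f) {t : ℝ}
    (ht : t ∈ Ioo s t₀) (r p : E3) :
    deriv (fun s => f s r p) t =
      (1 / ε) * (-(∑ l, p l * gradR (f t) r p l)
        + ∑ l, S.totalForce t (density (f t)) r l * gradP (f t) r p l)
      + (1 / ε ^ 2) * ∑ i, ∑ j, (1 + S.meanZ₁ (density (f t)) r) i j
        * pd i (fun p => f t r p * p j + pd j (f t r) p) p := by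
  have hcont : Continuous fun z : E3 × E3 => f t z.1 z.2 := (hu.phase hs ht).continuous
  have hB : ∀ r p, |f t r p| ≤ C * (h r * w p) := fun r p => (hu.bound t ht r p).1
  have hw := he.phaseEnvelope.moments.integrable
  have hM : (Matrix.of fun i j => ∫ z : E3 × E3, S.g r z.1 * S.Z₁ r z.1 i j * f t z.1 z.2)
      = S.meanZ₁ (density (f t)) r := by
    ext i j
    rw [meanZ₁_apply, ← integral_phase_smul_kernel hpos he.h_int (he.kernel_Z₁ r i j) hw hcont hB]
    simp only [Matrix.of_apply, smul_eq_mul, mul_comm]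
  have hF : ∫ z : E3 × E3, (f t z.1 z.2 * S.g r z.1) • gradient (fun x => S.V₂ x z.1) r
      = S.meanForce (density (f t)) r := by
    rw [meanForce_eq, ← integral_phase_smul_kernel hpos he.h_int (he.kernel_V₂ r) hw hcont hB]
    simp only [smul_smul]
  have hjet := hu.momentumJet hs ht r
  have hWcoord : ∀ j, (fun y => pAddGradP (f t) r y j)
      = fun y => f t r y * y j + pd j (f t r) y := fun j => by
    funext y
    simp [pAddGradP, gradP, gradient_apply]
  have hW : DifferentiableAt ℝ (fun y => pAddGradP (f t) r y) p :=
    differentiableAt_of_coord fun j => by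
      rw [hWcoord]
      exact ((hjet.contDiff.differentiable (by norm_num) p).mul
        (growth_differentiable (growth_coord j) p)).add
        ((hjet.contDiff_pd j).differentiable (by norm_num) p)
  have hL0 : L₀ (f t) r p = ∑ i, ∑ j, (1 : Mat3) i j
      * pd i (fun p => f t r p * p j + pd j (f t r) p) p := by
    have := divergence_app (A := 1) hW
    simp only [app_one, hWcoord] at this
    exact this
  have hN0 : S.N₀ (f t) (f t) r p = ∑ i, ∑ j, S.meanZ₁ (density (f t)) r i j
      * pd i (fun p => f t r p * p j + pd j (f t r) p) p := by
    have := divergence_app (A := S.meanZ₁ (density (f t)) r) hW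
    simp only [hWcoord] at this
    simp only [N₀, hZ₂, app_zero, smul_zero, integral_zero, add_zero, hM]
    exact this
  rw [hf.equation t ⟨hs.trans_lt ht.1, ht.2⟩ r p, hL0, hN0, L₁, N₁, hF]
  have hsum : inner ℝ (gradient (S.V₁ t) r) (gradP (f t) r p)
      + inner ℝ (S.meanForce (density (f t)) r) (gradP (f t) r p)
      = ∑ l, S.totalForce t (density (f t)) r l * gradP (f t) r p l := by
    rw [← inner_add_left, inner_eq_sum]
    rfl
  have h2 : ∀ A B : Mat3, ∀ X : Fin 3 → Fin 3 → ℝ,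
      ∑ i, ∑ j, A i j * X i j + ∑ i, ∑ j, B i j * X i j = ∑ i, ∑ j, (A + B) i j * X i j :=
    fun A B X => by simp only [Matrix.add_apply, add_mul, Finset.sum_add_distrib]
  rw [h2, add_assoc, hsum, inner_eq_sum]

/-- The exact equation for the moment with weight `q` of a solution of the kinetic equation,
obtained by integrating by parts in the momentum variable. -/
theorem moment_equation (he : S.Envelope h w) (hpos : ∀ r, 0 < h r)
    (hZ₂ : ∀ r r', S.Z₂ r r' = 0) {t₀ ε s C : ℝ} {f : ℝ → E3 → E3 → ℝ} (hs : 0 ≤ s)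
    (hf : S.IsOneBodySolution t₀ ε f) (hu : JetDominated h w t₀ s C f) {t : ℝ}
    (ht : t ∈ Ioo s t₀) {q : E3 → ℝ} (hq : q.HasTemperateGrowth) (r : E3) :
    deriv (fun s => mom q (f s) r) t =
      -(1 / ε) * (∑ l, pd l (mom (fun p => q p * p l) (f t)) r
        + ∑ l, S.totalForce t (density (f t)) r l * mom (pd l q) (f t) r)
      - (1 / ε ^ 2) * ∑ i, ∑ j, (1 + S.meanZ₁ (density (f t)) r) i j
        * (mom (fun p => pd i q p * p j) (f t) r - mom (pd j (pd i q)) (f t) r) := by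
  have hp := he.phaseEnvelope
  have hjet := hu.momentumJet hs ht r
  set A := 1 + S.meanZ₁ (density (f t)) r with hA
  set G := S.totalForce t (density (f t)) r with hG
  have hgradR : ∀ l, Integrable fun p => (q p * p l) * gradR (f t) r p l := fun l => by
    refine hp.moments.integrable_weight (hq.mul (growth_coord l)) ?_
      (B := C * h r) fun p => ?_
    · have hc : (fun p => gradR (f t) r p l) = fun p =>
          fderiv ℝ (fun x => f t x p) r (EuclideanSpace.single l 1) :=
        funext fun p => gradient_apply _ _ _
      rw [hc]
      exact (((hu.continuous_fderiv_slice hs ht).comp (Continuous.prodMk_right r)).clm_apply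
        continuous_const).aestronglyMeasurable
    · exact (abs_coord_le _ _).trans ((hu.bound t ht r p).2.2.1.trans_eq (mul_assoc _ _ _).symm)
  have hgradP : ∀ l, Integrable fun p => q p * gradP (f t) r p l := fun l => by
    have e : ∀ p, gradP (f t) r p l = pd l (f t r) p := fun p => gradient_apply _ _ _
    simp only [e]
    exact hp.moments.integrable_weight hq (hjet.contDiff_pd l).continuous.aestronglyMeasurable
      (hjet.abs_pd_le l)
  have hdiv : ∀ i j, Integrable fun p =>
      q p * pd i (fun p => f t r p * p j + pd j (f t r) p) p := fun i j =>
    hjet.integrable_weight_mul_pd_component hp.moments hq i j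
  rw [(hu.hasDerivAt_mom hs hp ht hq r).deriv]
  have e : ∀ p, q p * deriv (fun s => f s r p) t =
      ((1 / ε) * (-(∑ l, (q p * p l) * gradR (f t) r p l)
        + ∑ l, G l * (q p * gradP (f t) r p l)))
      + (1 / ε ^ 2) * ∑ i, ∑ j, A i j
        * (q p * pd i (fun p => f t r p * p j + pd j (f t r) p) p) := fun p => by
    rw [deriv_eq_of_isOneBodySolution he hpos hZ₂ hs hf hu ht r p]
    have a1 : ∑ l, (q p * p l) * gradR (f t) r p l = q p * ∑ l, p l * gradR (f t) r p l := by
      rw [Finset.mul_sum]; exact Finset.sum_congr rfl fun l _ => by ring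
    have a2 : ∑ l, G l * (q p * gradP (f t) r p l) = q p * ∑ l, G l * gradP (f t) r p l := by
      rw [Finset.mul_sum]; exact Finset.sum_congr rfl fun l _ => by ring
    have a3 : ∑ i, ∑ j, A i j * (q p * pd i (fun p => f t r p * p j + pd j (f t r) p) p)
        = q p * ∑ i, ∑ j, A i j * pd i (fun p => f t r p * p j + pd j (f t r) p) p := by
      rw [Finset.mul_sum]
      refine Finset.sum_congr rfl fun i _ => ?_
      rw [Finset.mul_sum]
      exact Finset.sum_congr rfl fun j _ => by ring
    rw [a1, a2, a3]
    ring
  simp only [e]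
  have s1 : Integrable fun p => ∑ l, (q p * p l) * gradR (f t) r p l :=
    integrable_finsetSum _ fun l _ => hgradR l
  have s2 : Integrable fun p => ∑ l, G l * (q p * gradP (f t) r p l) :=
    integrable_finsetSum _ fun l _ => (hgradP l).const_mul _
  have s3' : ∀ i, Integrable fun p => ∑ j, A i j
      * (q p * pd i (fun p => f t r p * p j + pd j (f t r) p) p) := fun i =>
    integrable_finsetSum _ fun j _ => (hdiv i j).const_mul _
  have s3 : Integrable fun p => ∑ i, ∑ j, A i j
      * (q p * pd i (fun p => f t r p * p j + pd j (f t r) p) p) :=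
    integrable_finsetSum _ fun i _ => s3' i
  have s1n : Integrable fun p => -∑ l, (q p * p l) * gradR (f t) r p l := s1.neg
  have s12 : Integrable fun p => -(∑ l, (q p * p l) * gradR (f t) r p l)
      + ∑ l, G l * (q p * gradP (f t) r p l) := s1n.add s2
  rw [integral_add (s12.const_mul _) (s3.const_mul _), integral_const_mul,
    integral_const_mul, integral_add s1n s2, integral_neg,
    integral_finsetSum _ fun l _ => hgradR l,
    integral_finsetSum _ fun l _ => (hgradP l).const_mul _,
    integral_finsetSum _ fun i _ => s3' i]
  have t1 : ∀ l, ∫ p, (q p * p l) * gradR (f t) r p l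
      = pd l (mom (fun p => q p * p l) (f t)) r := fun l =>
    (hu.pd_mom hs hp ht (hq.mul (growth_coord l)) r l).symm
  have t3 : ∀ i, ∫ p, ∑ j, A i j * (q p * pd i (fun p => f t r p * p j + pd j (f t r) p) p)
      = ∑ j, A i j * -(mom (fun p => pd i q p * p j) (f t) r - mom (pd j (pd i q)) (f t) r) :=
    fun i => by
      rw [integral_finsetSum _ fun j _ => (hdiv i j).const_mul _]
      refine Finset.sum_congr rfl fun j _ => ?_
      rw [integral_const_mul, hjet.integral_weight_mul_pd_component hp.moments hq i j]
      rfl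
  simp only [t1, t3, integral_const_mul, hu.mom_pd hs hp ht hq r, mul_neg,
    Finset.sum_neg_distrib]
  ring

end Model

/-! ### Expansion of linear functionals of the distribution -/

/-- A functional which is linear and bounded on jet-dominated functions. -/
structure IsJetFunctional (h w : E3 → ℝ) (t₀ s : ℝ) (L : (ℝ → E3 → E3 → ℝ) → ℝ) : Prop where
  add : ∀ u v C D, JetDominated h w t₀ s C u → JetDominated h w t₀ s D v →
    L (fun t r p => u t r p + v t r p) = L u + L v
  const_mul : ∀ u C c, JetDominated h w t₀ s C u → L (fun t r p => c * u t r p) = c * L u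
  bound : ∃ K, ∀ u C, JetDominated h w t₀ s C u → |L u| ≤ K * C

section Functionals

variable {h w : E3 → ℝ} {t₀ s t : ℝ}

theorem mom_add_eq (hs : 0 ≤ s) (he : PhaseEnvelope h w) (ht : t ∈ Ioo s t₀) {q : E3 → ℝ}
    (hq : q.HasTemperateGrowth) {u v : ℝ → E3 → E3 → ℝ} {C D : ℝ}
    (hu : JetDominated h w t₀ s C u) (hv : JetDominated h w t₀ s D v) (r : E3) :
    mom q (fun r p => u t r p + v t r p) r = mom q (u t) r + mom q (v t) r := by
  simp only [mom, mul_add]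
  exact integral_add (hu.integrable_mom hs he ht hq r) (hv.integrable_mom hs he ht hq r)

theorem mom_const_mul_eq (q : E3 → ℝ) (c : ℝ) (v : E3 → E3 → ℝ) (r : E3) :
    mom q (fun r p => c * v r p) r = c * mom q v r := by
  simp only [mom, ← integral_const_mul]
  exact integral_congr_ae (Eventually.of_forall fun p => by ring)

variable (hs : 0 ≤ s) (he : PhaseEnvelope h w) (ht : t ∈ Ioo s t₀)
include hs he ht

theorem isJetFunctional_mom {q : E3 → ℝ} (hq : q.HasTemperateGrowth) (r : E3) :
    IsJetFunctional h w t₀ s fun u => mom q (u t) r where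
  add := fun u v C D hu hv => mom_add_eq hs he ht hq hu hv r
  const_mul := fun u C c _ => mom_const_mul_eq q c (u t) r
  bound := ⟨h r * ∫ p, |q p| * w p, fun u C hu =>
    (hu.abs_mom_le hs he ht hq r).trans_eq (by ring)⟩

theorem isJetFunctional_deriv_mom {q : E3 → ℝ} (hq : q.HasTemperateGrowth) (r : E3) :
    IsJetFunctional h w t₀ s fun u => deriv (fun s => mom q (u s) r) t where
  add := fun u v C D hu hv => by
    rw [← deriv_fun_add (hu.hasDerivAt_mom hs he ht hq r).differentiableAt
      (hv.hasDerivAt_mom hs he ht hq r).differentiableAt]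
    refine EventuallyEq.deriv_eq ?_
    filter_upwards [Ioo_mem_nhds ht.1 ht.2] with x hx
    exact mom_add_eq hs he hx hq hu hv r
  const_mul := fun u C c hu => by
    rw [← deriv_const_mul c (hu.hasDerivAt_mom hs he ht hq r).differentiableAt]
    simp only [mom_const_mul_eq]
  bound := ⟨h r * ∫ p, |q p| * w p, fun u C hu =>
    (hu.abs_deriv_mom_le hs he ht hq r).trans_eq (by ring)⟩

theorem isJetFunctional_pd_mom {q : E3 → ℝ} (hq : q.HasTemperateGrowth) (r : E3) (l : Fin 3) :
    IsJetFunctional h w t₀ s fun u => pd l (mom q (u t)) r where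
  add := fun u v C D hu hv => by
    have : mom q (fun r p => u t r p + v t r p) = fun r => mom q (u t) r + mom q (v t) r :=
      funext fun r => mom_add_eq hs he ht hq hu hv r
    rw [this, pd, fderiv_fun_add (hu.hasFDerivAt_mom hs he ht hq r).differentiableAt
      (hv.hasFDerivAt_mom hs he ht hq r).differentiableAt]
    rfl
  const_mul := fun u C c hu => by
    have : mom q (fun r p => c * u t r p) = fun r => c * mom q (u t) r :=
      funext fun r => mom_const_mul_eq q c (u t) r
    rw [this, pd, fderiv_const_mul (hu.hasFDerivAt_mom hs he ht hq r).differentiableAt]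
    rfl
  bound := ⟨h r * ∫ p, |q p| * w p, fun u C hu =>
    ((abs_pd_le _ _ _).trans (hu.norm_fderiv_mom_le hs he ht hq r)).trans_eq (by ring)⟩

theorem JetDominated.density_continuous {u : ℝ → E3 → E3 → ℝ} {C : ℝ}
    (hu : JetDominated h w t₀ s C u) : Continuous (density (u t)) := by
  rw [density_eq_mom]
  exact (hu.contDiff_mom hs he ht growth_one).continuous

theorem JetDominated.abs_density_le {u : ℝ → E3 → E3 → ℝ} {C : ℝ}
    (hu : JetDominated h w t₀ s C u) (r : E3) :
    |density (u t) r| ≤ (C * ∫ p, w p) * h r := by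
  rw [density_eq_mom]
  exact (hu.abs_mom_le hs he ht growth_one r).trans_eq (by simp; ring)

/-- Integration of the density against a pair kernel. -/
theorem kernel_functional {F : Type*} [NormedAddCommGroup F] [NormedSpace ℝ F]
    (hpos : ∀ r, 0 < h r) (hint : Integrable h) {K : E3 → F}
    (hK : Integrable fun x => h x • K x) :
    (∀ (u v : ℝ → E3 → E3 → ℝ) C D, JetDominated h w t₀ s C u → JetDominated h w t₀ s D v →
      ∫ x, density (fun r p => u t r p + v t r p) x • K x
        = (∫ x, density (u t) x • K x) + ∫ x, density (v t) x • K x) ∧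
    (∀ (u : ℝ → E3 → E3 → ℝ) c, ∫ x, density (fun r p => c * u t r p) x • K x
        = c • ∫ x, density (u t) x • K x) ∧
    (∀ (u : ℝ → E3 → E3 → ℝ) C, JetDominated h w t₀ s C u →
      ‖∫ x, density (u t) x • K x‖ ≤ ((∫ p, w p) * ∫ x, ‖h x • K x‖) * C) := by
  refine ⟨fun u v C D hu hv => ?_, fun u c => ?_, fun u C hu => ?_⟩
  · have e : ∀ x, density (fun r p => u t r p + v t r p) x = density (u t) x + density (v t) x :=
      fun x => by simp only [density_eq_mom]; exact mom_add_eq hs he ht growth_one hu hv x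
    simp only [e, add_smul]
    exact integral_add
      (integrable_smul_kernel hpos hint hK (hu.density_continuous hs he ht).aestronglyMeasurable
        (hu.abs_density_le hs he ht))
      (integrable_smul_kernel hpos hint hK (hv.density_continuous hs he ht).aestronglyMeasurable
        (hv.abs_density_le hs he ht))
  · have e : ∀ x, density (fun r p => c * u t r p) x = c * density (u t) x :=
      fun x => by simp only [density_eq_mom, mom_const_mul_eq]
    simp only [e, mul_smul]
    exact integral_smul c _
  · exact (norm_integral_smul_kernel_le hpos hK (hu.abs_density_le hs he ht)).trans_eq (by ring)

theorem isJetFunctional_meanZ₁ {S : Model} (hS : S.Envelope h w) (hpos : ∀ r, 0 < h r)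
    (r : E3) (i j : Fin 3) :
    IsJetFunctional h w t₀ s fun u => S.meanZ₁ (density (u t)) r i j := by
  obtain ⟨h1, h2, h3⟩ := kernel_functional hs he ht hpos hS.h_int (hS.kernel_Z₁ r i j)
  refine ⟨fun u v C D hu hv => ?_, fun u C c _ => ?_,
    (∫ p, w p) * ∫ x, ‖h x • (S.g r x * S.Z₁ r x i j)‖, fun u C hu => ?_⟩
  · simp only [Model.meanZ₁_apply]; exact h1 u v C D hu hv
  · simp only [Model.meanZ₁_apply]; exact h2 u c
  · simp only [Model.meanZ₁_apply]; exact h3 u C hu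

theorem isJetFunctional_meanForce {S : Model} (hS : S.Envelope h w) (hpos : ∀ r, 0 < h r)
    (r : E3) (l : Fin 3) :
    IsJetFunctional h w t₀ s fun u => S.meanForce (density (u t)) r l := by
  obtain ⟨h1, h2, h3⟩ := kernel_functional hs he ht hpos hS.h_int (hS.kernel_V₂ r)
  refine ⟨fun u v C D hu hv => ?_, fun u C c _ => ?_,
    (∫ p, w p) * ∫ x, ‖h x • (S.g r x • gradient (fun y => S.V₂ y x) r)‖, fun u C hu => ?_⟩
  · simp only [Model.meanForce_eq, h1 u v C D hu hv, PiLp.add_apply]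
  · simp only [Model.meanForce_eq, h2 u c, PiLp.smul_apply, smul_eq_mul]
  · simp only [Model.meanForce_eq]; exact (abs_coord_le _ _).trans (h3 u C hu)

end Functionals

theorem expansion_decomposition (f : ℝ → ℝ → E3 → E3 → ℝ) (c : ℕ → ℝ → E3 → E3 → ℝ) (ε : ℝ) :
    f ε = fun t r p =>
    (f ε t r p - ∑ n ∈ Finset.range 3, ε ^ n * c n t r p)
      + (c 0 t r p + (ε * c 1 t r p + ε ^ 2 * c 2 t r p)) := by
  funext t r p
  simp only [Finset.sum_range_succ, Finset.sum_range_zero]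
  ring

theorem tendsto_rate (B : ℝ) : Tendsto (fun ε : ℝ => B * ε * (1 + ε)) (𝓝[>] 0) (𝓝 0) := by
  have : Continuous fun ε : ℝ => B * ε * (1 + ε) := by fun_prop
  simpa using (this.tendsto 0).mono_left nhdsWithin_le_nhds

/-- Everything that is assumed about the model, its solutions and their expansion, in the absence
of off-diagonal friction. -/
structure Setting (S : Model) (t₀ ε₀ : ℝ) (h w : E3 → ℝ) (f : ℝ → ℝ → E3 → E3 → ℝ)
    (c : ℕ → ℝ → E3 → E3 → ℝ) : Prop where
  t₀_pos : 0 < t₀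
  ε₀_pos : 0 < ε₀
  standing : S.Standing t₀
  Z₂_eq_zero : ∀ r r', S.Z₂ r r' = 0
  envelope : S.Envelope h w
  solution : ∀ ε ∈ Ioo 0 ε₀, S.IsOneBodySolution t₀ ε (f ε)
  expansion : HilbertExpansion h w t₀ ε₀ f c

namespace Setting

variable {S : Model} {t₀ ε₀ : ℝ} {h w : E3 → ℝ} {f : ℝ → ℝ → E3 → E3 → ℝ}
  {c : ℕ → ℝ → E3 → E3 → ℝ} (D : Setting S t₀ ε₀ h w f c)
include D

theorem phaseEnvelope : PhaseEnvelope h w := D.envelope.phaseEnvelope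

theorem h_pos (r : E3) : 0 < h r := by
  have hε : ε₀ / 2 ∈ Ioo 0 ε₀ := ⟨by linarith [D.ε₀_pos], by linarith [D.ε₀_pos]⟩
  have ht : (0 : ℝ) ∈ Icc 0 t₀ := ⟨le_rfl, D.t₀_pos.le⟩
  obtain ⟨C, hC⟩ := D.expansion.decay _ hε 0 ht
  exact D.envelope.h_pos (D.solution _ hε) ht hC r

theorem jetDominated_coeff {s : ℝ} (hs : s ∈ Ioo 0 t₀) {n : ℕ} (hn : n < 3) :
    ∃ C, JetDominated h w t₀ s C (c n) := by
  obtain ⟨C, hC⟩ := D.expansion.bound n hn s hs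
  exact ⟨C, D.expansion.regular n hn, hC⟩

/-- The remainder of the expansion. -/
theorem jetDominated_remainder {s : ℝ} (hs : s ∈ Ioo 0 t₀) :
    ∃ C, ∀ ε ∈ Ioo 0 ε₀, JetDominated h w t₀ s (C * ε ^ 3)
      (fun t r p => f ε t r p - ∑ n ∈ Finset.range 3, ε ^ n * c n t r p) := by
  obtain ⟨C, hC⟩ := D.expansion.remainder s hs
  refine ⟨C, fun ε hε => ⟨⟨fun t ht => ?_, fun t ht r p => ?_⟩, hC ε hε⟩⟩
  · refine ((D.solution ε hε).regular.phase t ht).sub (ContDiff.sum fun n hn => ?_)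
    exact contDiff_const.mul ((D.expansion.regular n (Finset.mem_range.1 hn)).phase t ht)
  · refine ((D.solution ε hε).regular.time t ht r p).sub (DifferentiableAt.fun_sum fun n hn => ?_)
    exact ((D.expansion.regular n (Finset.mem_range.1 hn)).time t ht r p).const_mul _

theorem jetDominated_solution {s : ℝ} (hs : s ∈ Ioo 0 t₀) {ε : ℝ} (hε : ε ∈ Ioo 0 ε₀) :
    ∃ C, JetDominated h w t₀ s C (f ε) := by
  obtain ⟨C, hC⟩ := D.jetDominated_remainder hs
  obtain ⟨C0, h0⟩ := D.jetDominated_coeff hs (n := 0) (by norm_num)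
  obtain ⟨C1, h1⟩ := D.jetDominated_coeff hs (n := 1) (by norm_num)
  obtain ⟨C2, h2⟩ := D.jetDominated_coeff hs (n := 2) (by norm_num)
  rw [expansion_decomposition f c ε]
  exact ⟨_, (hC ε hε).add hs.1.le
    (h0.add hs.1.le ((h1.const_mul ε).add hs.1.le (h2.const_mul (ε ^ 2))))⟩

/-- Jet functionals of the solution inherit the expansion in powers of `ε`. -/
theorem hasExp {s : ℝ} (hs : s ∈ Ioo 0 t₀) {L : (ℝ → E3 → E3 → ℝ) → ℝ}
    (hL : IsJetFunctional h w t₀ s L) :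
    HasExp (fun ε => L (f ε)) (L (c 0)) (L (c 1)) (L (c 2)) := by
  obtain ⟨C, hC⟩ := D.jetDominated_remainder hs
  obtain ⟨C0, h0⟩ := D.jetDominated_coeff hs (n := 0) (by norm_num)
  obtain ⟨C1, h1⟩ := D.jetDominated_coeff hs (n := 1) (by norm_num)
  obtain ⟨C2, h2⟩ := D.jetDominated_coeff hs (n := 2) (by norm_num)
  obtain ⟨K, hK⟩ := hL.bound
  refine IsBigO.of_bound (K * C) ?_
  filter_upwards [Ioo_mem_nhdsGT D.ε₀_pos] with ε hε
  have i12 := (h1.const_mul ε).add hs.1.le (h2.const_mul (ε ^ 2))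
  have e : L (f ε) = L (fun t r p => f ε t r p - ∑ n ∈ Finset.range 3, ε ^ n * c n t r p)
      + (L (c 0) + (ε * L (c 1) + ε ^ 2 * L (c 2))) := by
    conv_lhs => rw [expansion_decomposition f c ε]
    rw [hL.add _ _ _ _ (hC ε hε) (h0.add hs.1.le i12), hL.add _ _ _ _ h0 i12,
      hL.add _ _ _ _ (h1.const_mul ε) (h2.const_mul (ε ^ 2)), hL.const_mul _ _ _ h1,
      hL.const_mul _ _ _ h2]
  have e2 : L (f ε) - (L (c 0) + ε * L (c 1) + ε ^ 2 * L (c 2))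
      = L (fun t r p => f ε t r p - ∑ n ∈ Finset.range 3, ε ^ n * c n t r p) := by
    rw [e]; ring
  rw [e2, Real.norm_eq_abs, Real.norm_of_nonneg (pow_nonneg hε.1.le 3), mul_assoc]
  exact hK _ _ (hC ε hε)

/-! ### Positive definiteness along the solution and in the limit -/

theorem aestronglyMeasurable_density {ε t : ℝ} (hε : ε ∈ Ioo 0 ε₀) (ht : t ∈ Icc 0 t₀) :
    AEStronglyMeasurable (density (f ε t)) :=
  (((D.solution ε hε).cont_phase t ht).stronglyMeasurable.integral_prod_right').aestronglyMeasurable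

theorem abs_density_le {ε t : ℝ} (hε : ε ∈ Ioo 0 ε₀) (ht : t ∈ Icc 0 t₀) :
    ∃ B, ∀ r, |density (f ε t) r| ≤ B * h r := by
  obtain ⟨C, hC⟩ := D.expansion.decay ε hε t ht
  refine ⟨C * ∫ p, w p, fun r => ?_⟩
  have := D.phaseEnvelope.moments.abs_integral_weight_le growth_one (v := f ε t r) (B := C * h r)
    fun p => (hC r p).trans_eq (mul_assoc _ _ _).symm
  rw [density]
  refine (by simpa using this : |∫ p, f ε t r p| ≤ C * h r * ∫ p, w p).trans_eq (by ring)

theorem density_nonneg {ε t : ℝ} (hε : ε ∈ Ioo 0 ε₀) (ht : t ∈ Icc 0 t₀) (r : E3) :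
    0 ≤ density (f ε t) r :=
  integral_nonneg fun p => ((D.solution ε hε).pos t ht r p).le

theorem posDef_solution {ε t : ℝ} (hε : ε ∈ Ioo 0 ε₀) (ht : t ∈ Icc 0 t₀) (r : E3) :
    (1 + S.meanZ₁ (density (f ε t)) r).PosDef := by
  have hsol := D.solution ε hε
  have hen := hsol.enskog t ht
  have hp := hsol.pos t ht
  obtain ⟨B, hB⟩ := D.abs_density_le hε ht
  refine D.standing.posDef_one_add_meanZ₁
    (fun r' => mul_nonneg (hen.g_nonneg hp r r') (D.density_nonneg hε ht r'))
    (hen.integral_g_mul_density D.standing.two_le hp r) fun i j => ?_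
  refine (integrable_smul_kernel D.h_pos D.envelope.h_int (D.envelope.kernel_Z₁ r i j)
    (D.aestronglyMeasurable_density hε ht) hB).congr (Eventually.of_forall fun x => ?_)
  simp only [smul_eq_mul]
  ring

/-- The density converges to its leading part, in the norm weighted by the envelope. -/
theorem density_sub_le {t : ℝ} (ht : t ∈ Icc 0 t₀) : ∃ B, ∀ ε ∈ Ioo 0 ε₀, ∀ r,
    |density (f ε t) r - density (c 0 t) r| ≤ (B * ε * (1 + ε)) * h r := by
  obtain ⟨C, hC⟩ := D.expansion.density_remainder
  obtain ⟨C', hC'⟩ := D.expansion.density_bound 1 (by norm_num)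
  refine ⟨|C| + |C'|, fun ε hε r => ?_⟩
  have h1 := hC ε hε t ht r
  have h2 := hC' t ht r
  simp only [Finset.sum_range_succ, Finset.sum_range_zero, zero_add, pow_zero, one_mul,
    pow_one] at h1
  have hh := (D.h_pos r).le
  have e1 : C * ε ^ 2 * h r ≤ |C| * ε ^ 2 * h r := by gcongr; exact le_abs_self C
  have e2 : C' * h r ≤ |C'| * h r := by gcongr; exact le_abs_self C'
  have hε' := hε.1.le
  calc |density (f ε t) r - density (c 0 t) r|
      = |(density (f ε t) r - (density (c 0 t) r + ε * density (c 1 t) r))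
          + ε * density (c 1 t) r| := by congr 1; ring
    _ ≤ |C| * ε ^ 2 * h r + ε * (|C'| * h r) := by
        refine (abs_add_le _ _).trans (add_le_add (h1.trans e1) ?_)
        rw [abs_mul, abs_of_nonneg hε']
        gcongr
        exact h2.trans e2
    _ ≤ _ := by
        have := mul_nonneg (mul_nonneg (abs_nonneg C) hε') hh
        have := mul_nonneg (mul_nonneg (abs_nonneg C') (mul_nonneg hε' hε')) hh
        nlinarith

theorem tendsto_density {t : ℝ} (ht : t ∈ Icc 0 t₀) (r : E3) :
    Tendsto (fun ε => density (f ε t) r) (𝓝[>] 0) (𝓝 (density (c 0 t) r)) := by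
  obtain ⟨B, hB⟩ := D.density_sub_le ht
  rw [tendsto_iff_norm_sub_tendsto_zero]
  have h1 := (tendsto_rate B).mul_const (h r)
  rw [zero_mul] at h1
  refine squeeze_zero' (Eventually.of_forall fun ε => norm_nonneg _) ?_ h1
  filter_upwards [Ioo_mem_nhdsGT D.ε₀_pos] with ε hε using hB ε hε r

theorem aestronglyMeasurable_leading {t : ℝ} (ht : t ∈ Icc 0 t₀) :
    AEStronglyMeasurable (density (c 0 t)) := by
  classical
  refine aestronglyMeasurable_of_tendsto_ae (𝓝[>] (0 : ℝ))
    (f := fun ε r => if ε ∈ Ioo 0 ε₀ then density (f ε t) r else 0) (fun ε => ?_)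
    (Eventually.of_forall fun r => ?_)
  · by_cases hε : ε ∈ Ioo 0 ε₀
    · simp only [hε, if_true]
      exact D.aestronglyMeasurable_density hε ht
    · simp only [hε, if_false]
      exact aestronglyMeasurable_const
  · refine (D.tendsto_density ht r).congr' ?_
    filter_upwards [Ioo_mem_nhdsGT D.ε₀_pos] with ε hε
    simp [show ε ∈ Ioo 0 ε₀ from hε]

/-- The mean friction matrix of the leading density is positive definite: the normalization
`∫ g ρ dr' = N - 1` survives the limit `ε → 0`, since `g h` is integrable. -/
theorem posDef_leading {t : ℝ} (ht : t ∈ Icc 0 t₀) (r : E3) :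
    (1 + S.meanZ₁ (density (c 0 t)) r).PosDef := by
  obtain ⟨B, hB⟩ := D.expansion.density_bound 0 (by norm_num)
  obtain ⟨B', hB'⟩ := D.density_sub_le ht
  have hm := D.aestronglyMeasurable_leading ht
  have hint : ∀ {K : E3 → ℝ}, (Integrable fun x => h x • K x) →
      Integrable fun x => density (c 0 t) x • K x := fun hK =>
    integrable_smul_kernel D.h_pos D.envelope.h_int hK hm (hB t ht)
  have lim : Tendsto (fun ε => ∫ r', density (f ε t) r' • S.g r r') (𝓝[>] 0)
      (𝓝 (∫ r', density (c 0 t) r' • S.g r r')) := by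
    rw [tendsto_iff_norm_sub_tendsto_zero]
    have h1 := (tendsto_rate B').mul_const (∫ x, ‖h x • S.g r x‖)
    rw [zero_mul] at h1
    refine squeeze_zero' (Eventually.of_forall fun ε => norm_nonneg _) ?_ h1
    filter_upwards [Ioo_mem_nhdsGT D.ε₀_pos] with ε hε
    obtain ⟨B₁, hB₁⟩ := D.abs_density_le hε ht
    rw [← integral_sub (integrable_smul_kernel D.h_pos D.envelope.h_int (D.envelope.kernel_g r)
      (D.aestronglyMeasurable_density hε ht) hB₁) (hint (D.envelope.kernel_g r))]
    simp only [← sub_smul]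
    exact norm_integral_smul_kernel_le D.h_pos (D.envelope.kernel_g r) (hB' ε hε)
  have hnorm : ∫ r', S.g r r' * density (c 0 t) r' = (S.N : ℝ) - 1 := by
    have e : ∫ r', S.g r r' * density (c 0 t) r' = ∫ r', density (c 0 t) r' • S.g r r' := by
      simp only [smul_eq_mul, mul_comm]
    rw [e]
    refine tendsto_nhds_unique lim (tendsto_const_nhds.congr' ?_)
    filter_upwards [Ioo_mem_nhdsGT D.ε₀_pos] with ε hε
    rw [← ((D.solution ε hε).enskog t ht).integral_g_mul_density D.standing.two_le
      ((D.solution ε hε).pos t ht) r]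
    simp only [smul_eq_mul, mul_comm]
  refine D.standing.posDef_one_add_meanZ₁ (fun r' => ?_) hnorm fun i j => ?_
  · refine ge_of_tendsto ((D.tendsto_density ht r').const_mul (S.g r r')) ?_
    filter_upwards [Ioo_mem_nhdsGT D.ε₀_pos] with ε hε
    exact mul_nonneg (((D.solution ε hε).enskog t ht).g_nonneg ((D.solution ε hε).pos t ht) r r')
      (D.density_nonneg hε ht r')
  · refine (hint (D.envelope.kernel_Z₁ r i j)).congr (Eventually.of_forall fun x => ?_)
    simp only [smul_eq_mul]
    ring

end Setting

/-! ### Monomial weights -/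

theorem pd_const (i : Fin 3) (a : ℝ) : pd i (fun _ => a) = fun _ => 0 := by
  funext p
  simp [pd]

theorem pd_coordinate (i a : Fin 3) : pd i (fun p : E3 => p a) = fun _ => (1 : Mat3) i a := by
  funext p
  have : fderiv ℝ (fun p : E3 => p a) p = coordL a := (coordL a).fderiv
  rw [pd, this]
  simp [coordL, Matrix.one_apply, eq_comm]

theorem pd_mul {q₁ q₂ : E3 → ℝ} (h₁ : q₁.HasTemperateGrowth) (h₂ : q₂.HasTemperateGrowth)
    (i : Fin 3) : pd i (fun p => q₁ p * q₂ p) = fun p => q₁ p * pd i q₂ p + q₂ p * pd i q₁ p := by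
  funext p
  rw [pd, fderiv_fun_mul (growth_differentiable h₁ p) (growth_differentiable h₂ p)]
  rfl

theorem pd_add {q₁ q₂ : E3 → ℝ} (h₁ : q₁.HasTemperateGrowth) (h₂ : q₂.HasTemperateGrowth)
    (i : Fin 3) : pd i (fun p => q₁ p + q₂ p) = fun p => pd i q₁ p + pd i q₂ p := by
  funext p
  rw [pd, fderiv_fun_add (growth_differentiable h₁ p) (growth_differentiable h₂ p)]
  rfl

theorem pd_const_mul {q : E3 → ℝ} (hq : q.HasTemperateGrowth) (a : ℝ) (i : Fin 3) :
    pd i (fun p => a * q p) = fun p => a * pd i q p := by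
  rw [pd_mul (.const a) hq, pd_const]
  simp

theorem growth_add {q₁ q₂ : E3 → ℝ} (h₁ : q₁.HasTemperateGrowth) (h₂ : q₂.HasTemperateGrowth) :
    (fun p => q₁ p + q₂ p).HasTemperateGrowth :=
  h₁.add h₂

theorem growth_mul {q₁ q₂ : E3 → ℝ} (h₁ : q₁.HasTemperateGrowth) (h₂ : q₂.HasTemperateGrowth) :
    (fun p => q₁ p * q₂ p).HasTemperateGrowth :=
  h₁.mul h₂

theorem growth_coord_mul (a b : Fin 3) : (fun p : E3 => p a * p b).HasTemperateGrowth :=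
  (growth_coord a).mul (growth_coord b)

theorem growth_const_mul {q : E3 → ℝ} (hq : q.HasTemperateGrowth) (a : ℝ) :
    (fun p => a * q p).HasTemperateGrowth :=
  (Function.HasTemperateGrowth.const a).mul hq

theorem growth_coord_mul_mul (a b c : Fin 3) :
    (fun p : E3 => p a * p b * p c).HasTemperateGrowth :=
  (growth_coord_mul a b).mul (growth_coord c)

theorem pd_coord_mul (i a b : Fin 3) : pd i (fun p : E3 => p a * p b)
    = fun p => (1 : Mat3) i a * p b + (1 : Mat3) i b * p a := by
  rw [pd_mul (growth_coord a) (growth_coord b), pd_coordinate, pd_coordinate]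
  funext p
  ring

theorem pd_coord_mul_mul (i a b c : Fin 3) : pd i (fun p : E3 => p a * p b * p c)
    = fun p => (1 : Mat3) i a * (p b * p c) + (1 : Mat3) i b * (p a * p c)
      + (1 : Mat3) i c * (p a * p b) := by
  rw [pd_mul (growth_coord_mul a b) (growth_coord c), pd_coord_mul, pd_coordinate]
  funext p
  ring

/-- The first velocity moment. -/
def flux (v : E3 → E3 → ℝ) (r : E3) (a : Fin 3) : ℝ := mom (fun p => p a) v r

/-- The second velocity moment. -/
def stress (v : E3 → E3 → ℝ) (r : E3) (a b : Fin 3) : ℝ := mom (fun p => p a * p b) v r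

/-- The third velocity moment. -/
def heat (v : E3 → E3 → ℝ) (r : E3) (a b c : Fin 3) : ℝ := mom (fun p => p a * p b * p c) v r

/-- The coefficient of the friction matrix entry `(i, j)` in the equation for the moment with
weight `q`. -/
def dragMoment (q : E3 → ℝ) (v : E3 → E3 → ℝ) (r : E3) (i j : Fin 3) : ℝ :=
  mom (fun p => pd i q p * p j) v r - mom (pd j (pd i q)) v r

theorem stress_comm (v : E3 → E3 → ℝ) (r : E3) (a b : Fin 3) :
    stress v r a b = stress v r b a := by
  simp only [stress, mul_comm]

theorem heat_swap₁₂ (v : E3 → E3 → ℝ) (r : E3) (a b c : Fin 3) :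
    heat v r a b c = heat v r b a c := by
  unfold heat
  congr 1
  funext p
  ring

theorem heat_swap₂₃ (v : E3 → E3 → ℝ) (r : E3) (a b c : Fin 3) :
    heat v r a b c = heat v r a c b := by
  unfold heat
  congr 1
  funext p
  ring

section Weights

variable {v : E3 → E3 → ℝ} {r : E3}
  (hv : ∀ q : E3 → ℝ, q.HasTemperateGrowth → Integrable fun p => q p * v r p)
include hv

theorem mom_weight_add {q₁ q₂ : E3 → ℝ} (h₁ : q₁.HasTemperateGrowth)
    (h₂ : q₂.HasTemperateGrowth) :
    mom (fun p => q₁ p + q₂ p) v r = mom q₁ v r + mom q₂ v r := by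
  simp only [mom, add_mul]
  exact integral_add (hv _ h₁) (hv _ h₂)

omit hv in
theorem mom_weight_const_mul (a : ℝ) (q : E3 → ℝ) :
    mom (fun p => a * q p) v r = a * mom q v r := by
  simp only [mom, mul_assoc]
  exact integral_const_mul _ _

omit hv in
theorem mom_weight_const (a : ℝ) : mom (fun _ => a) v r = a * density v r := by
  simp only [mom, density]
  exact integral_const_mul _ _

omit hv in
theorem dragMoment_coord (a i j : Fin 3) :
    dragMoment (fun p => p a) v r i j = (1 : Mat3) i a * flux v r j := by
  simp only [dragMoment, pd_coordinate, pd_const, mom_weight_const_mul, flux]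
  simp [mom]

theorem dragMoment_coord_mul (a b i j : Fin 3) :
    dragMoment (fun p => p a * p b) v r i j
      = (1 : Mat3) i a * (stress v r j b - (1 : Mat3) j b * density v r)
        + (1 : Mat3) i b * (stress v r j a - (1 : Mat3) j a * density v r) := by
  have e1 : (fun p : E3 => ((1 : Mat3) i a * p b + (1 : Mat3) i b * p a) * p j)
      = fun p => (1 : Mat3) i a * (p j * p b) + (1 : Mat3) i b * (p j * p a) := by
    funext p; ring
  have e2 : pd j (fun p : E3 => (1 : Mat3) i a * p b + (1 : Mat3) i b * p a)
      = fun _ => (1 : Mat3) i a * (1 : Mat3) j b + (1 : Mat3) i b * (1 : Mat3) j a := by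
    rw [pd_add (growth_const_mul (growth_coord b) _) (growth_const_mul (growth_coord a) _),
      pd_const_mul (growth_coord b), pd_const_mul (growth_coord a), pd_coordinate, pd_coordinate]
  rw [dragMoment, pd_coord_mul, e1, e2, mom_weight_add hv
    (growth_const_mul (growth_coord_mul j b) _) (growth_const_mul (growth_coord_mul j a) _),
    mom_weight_const_mul, mom_weight_const_mul, mom_weight_const, stress, stress]
  ring

/-- Without flux, the drag term of the third moments involves third moments only. -/
theorem dragMoment_coord_mul_mul (hj : ∀ a, flux v r a = 0) (a b c i j : Fin 3) :
    dragMoment (fun p => p a * p b * p c) v r i j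
      = (1 : Mat3) i a * heat v r j b c + (1 : Mat3) i b * heat v r j a c
        + (1 : Mat3) i c * heat v r j a b := by
  have g1 : ∀ (x : ℝ) (a b : Fin 3), (fun p : E3 => x * (p a * p b)).HasTemperateGrowth :=
    fun x a b => growth_const_mul (growth_coord_mul a b) x
  have g2 : ∀ (x : ℝ) (a b c : Fin 3), (fun p : E3 => x * (p a * p b * p c)).HasTemperateGrowth :=
    fun x a b c => growth_const_mul (growth_coord_mul_mul a b c) x
  have g3 : ∀ (x : ℝ) (a : Fin 3), (fun p : E3 => x * p a).HasTemperateGrowth :=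
    fun x a => growth_const_mul (growth_coord a) x
  have e1 : (fun p : E3 => ((1 : Mat3) i a * (p b * p c) + (1 : Mat3) i b * (p a * p c)
      + (1 : Mat3) i c * (p a * p b)) * p j)
      = fun p => (1 : Mat3) i a * (p j * p b * p c) + (1 : Mat3) i b * (p j * p a * p c)
        + (1 : Mat3) i c * (p j * p a * p b) := by
    funext p; ring
  have e2 : pd j (fun p : E3 => (1 : Mat3) i a * (p b * p c) + (1 : Mat3) i b * (p a * p c)
      + (1 : Mat3) i c * (p a * p b))
      = fun p => ((1 : Mat3) i b * (1 : Mat3) j c + (1 : Mat3) i c * (1 : Mat3) j b) * p a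
        + ((1 : Mat3) i a * (1 : Mat3) j c + (1 : Mat3) i c * (1 : Mat3) j a) * p b
        + ((1 : Mat3) i a * (1 : Mat3) j b + (1 : Mat3) i b * (1 : Mat3) j a) * p c := by
    rw [pd_add (growth_add (g1 _ b c) (g1 _ a c)) (g1 _ a b), pd_add (g1 _ b c) (g1 _ a c),
      pd_const_mul (growth_coord_mul b c), pd_const_mul (growth_coord_mul a c),
      pd_const_mul (growth_coord_mul a b), pd_coord_mul, pd_coord_mul, pd_coord_mul]
    funext p
    ring
  have z : ∀ a, mom (fun p => p a) v r = 0 := hj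
  rw [dragMoment, pd_coord_mul_mul, e1, e2, mom_weight_add hv (growth_add (g2 _ j b c) (g2 _ j a c))
    (g2 _ j a b), mom_weight_add hv (g2 _ j b c) (g2 _ j a c),
    mom_weight_add hv (growth_add (g3 _ a) (g3 _ b)) (g3 _ c), mom_weight_add hv (g3 _ a) (g3 _ b)]
  simp only [mom_weight_const_mul, z, heat]
  ring

end Weights

theorem sum_sum_one_mul (A : Mat3) (a : Fin 3) (X : Fin 3 → ℝ) :
    ∑ i, ∑ j, A i j * ((1 : Mat3) i a * X j) = ∑ j, A a j * X j := by
  rw [Finset.sum_eq_single a]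
  · simp
  · intro b _ hb
    simp [Matrix.one_apply_ne hb]
  · simp

/-- The divergence of an isotropic stress is the gradient of the density. -/
theorem sum_pd_isotropic {v : E3 → E3 → ℝ}
    (hv : ∀ r a b, stress v r a b = (1 : Mat3) a b * density v r) (r : E3) (a : Fin 3) :
    ∑ l, pd l (mom (fun p => p a * p l) v) r = pd a (density v) r := by
  have e : ∀ l, pd l (mom (fun p => p a * p l) v) r = (1 : Mat3) a l * pd l (density v) r :=
    fun l => by
      have : mom (fun p => p a * p l) v = fun r => (1 : Mat3) a l * density v r :=
        funext fun r => hv r a l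
      rw [this, pd, show (fun r => (1 : Mat3) a l * density v r) = (1 : Mat3) a l • density v
        from rfl, fderiv_const_smul_field]
      rfl
  simp only [e]
  simp [Matrix.one_apply]

/-! ### The hierarchy of moment equations -/

namespace Setting

variable {S : Model} {t₀ ε₀ : ℝ} {h w : E3 → ℝ} {f : ℝ → ℝ → E3 → E3 → ℝ}
  {c : ℕ → ℝ → E3 → E3 → ℝ} (D : Setting S t₀ ε₀ h w f c)
include D

/-- The coefficients of `ε⁻²`, `ε⁻¹` and `1` in the moment equation with weight `q`. -/
theorem order_equations {t : ℝ} (ht : t ∈ Ioo 0 t₀) {q : E3 → ℝ} (hq : q.HasTemperateGrowth)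
    (r : E3) :
    (∑ i, ∑ j, (1 + S.meanZ₁ (density (c 0 t)) r) i j * dragMoment q (c 0 t) r i j = 0) ∧
    ((∑ l, pd l (mom (fun p => q p * p l) (c 0 t)) r
        + ∑ l, S.totalForce t (density (c 0 t)) r l * mom (pd l q) (c 0 t) r)
      + ∑ i, ∑ j, ((1 + S.meanZ₁ (density (c 0 t)) r) i j * dragMoment q (c 1 t) r i j
        + S.meanZ₁ (density (c 1 t)) r i j * dragMoment q (c 0 t) r i j) = 0) ∧
    (deriv (fun s => mom q (c 0 s) r) t
      + (∑ l, pd l (mom (fun p => q p * p l) (c 1 t)) r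
        + ∑ l, (S.totalForce t (density (c 0 t)) r l * mom (pd l q) (c 1 t) r
          + S.meanForce (density (c 1 t)) r l * mom (pd l q) (c 0 t) r))
      + ∑ i, ∑ j, ((1 + S.meanZ₁ (density (c 0 t)) r) i j * dragMoment q (c 2 t) r i j
        + S.meanZ₁ (density (c 1 t)) r i j * dragMoment q (c 1 t) r i j
        + S.meanZ₁ (density (c 2 t)) r i j * dragMoment q (c 0 t) r i j) = 0) := by
  have hs : t / 2 ∈ Ioo 0 t₀ := ⟨by linarith [ht.1], by linarith [ht.1, ht.2]⟩
  have ht' : t ∈ Ioo (t / 2) t₀ := ⟨by linarith [ht.1], ht.2⟩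
  have hp := D.phaseEnvelope
  -- the moment equation is multiplied by `ε²`, so that `coeff_eq_zero` applies
  have E1 := (D.hasExp hs (isJetFunctional_deriv_mom hs.1.le hp ht' hq r)).eps_mul.eps_mul
  have Ea := HasExp.sum Finset.univ fun l => D.hasExp hs
    (isJetFunctional_pd_mom hs.1.le hp ht' (growth_mul hq (growth_coord l)) r l)
  have Eb := HasExp.sum Finset.univ fun l => ((HasExp.const (gradient (S.V₁ t) r l)).add
    (D.hasExp hs (isJetFunctional_meanForce hs.1.le hp ht' D.envelope D.h_pos r l))).mul
    (D.hasExp hs (isJetFunctional_mom hs.1.le hp ht' (growth_pd hq l) r))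
  have E2 := (Ea.add Eb).eps_mul
  have E3 := HasExp.sum Finset.univ fun i => HasExp.sum Finset.univ fun j =>
    ((HasExp.const ((1 : Mat3) i j)).add
    (D.hasExp hs (isJetFunctional_meanZ₁ hs.1.le hp ht' D.envelope D.h_pos r i j))).mul
    ((D.hasExp hs (isJetFunctional_mom hs.1.le hp ht'
      (growth_mul (growth_pd hq i) (growth_coord j)) r)).sub
     (D.hasExp hs (isJetFunctional_mom hs.1.le hp ht' (growth_pd (growth_pd hq i) j) r)))
  have total := ((E1.add E2).add E3).congr' (y := fun _ => 0) (by
    filter_upwards [Ioo_mem_nhdsGT D.ε₀_pos] with ε hε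
    obtain ⟨C, hC⟩ := D.jetDominated_solution hs hε
    have key := Model.moment_equation D.envelope D.h_pos D.Z₂_eq_zero hs.1.le
      (D.solution ε hε) hC ht' hq r
    have hne := hε.1.ne'
    rw [key]
    simp only [Model.totalForce, PiLp.add_apply, Matrix.add_apply]
    field_simp
    ring)
  obtain ⟨h0, h1, h2⟩ := total.coeff_eq_zero
  simp only [zero_add] at h0 h1 h2
  exact ⟨h0, h1, h2⟩

/-- The expansion of the continuity equation, which holds to one order more. -/
theorem continuity_equations {t : ℝ} (ht : t ∈ Ioo 0 t₀) (r : E3) :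
    deriv (fun s => density (c 0 s) r) t = -∑ l, pd l (fun x => flux (c 1 t) x l) r ∧
    deriv (fun s => density (c 1 s) r) t = -∑ l, pd l (fun x => flux (c 2 t) x l) r := by
  have hs : t / 2 ∈ Ioo 0 t₀ := ⟨by linarith [ht.1], by linarith [ht.1, ht.2]⟩
  have ht' : t ∈ Ioo (t / 2) t₀ := ⟨by linarith [ht.1], ht.2⟩
  have hp := D.phaseEnvelope
  have E1 := (D.hasExp hs (isJetFunctional_deriv_mom hs.1.le hp ht' growth_one r)).eps_mul
  have Ea := HasExp.sum Finset.univ fun l => D.hasExp hs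
    (isJetFunctional_pd_mom hs.1.le hp ht' (growth_coord l) r l)
  have total := (E1.add Ea).congr' (y := fun _ => 0) (by
    filter_upwards [Ioo_mem_nhdsGT D.ε₀_pos] with ε hε
    obtain ⟨C, hC⟩ := D.jetDominated_solution hs hε
    have key := Model.moment_equation D.envelope D.h_pos D.Z₂_eq_zero hs.1.le
      (D.solution ε hε) hC ht' growth_one r
    have z : mom (fun _ => 0) (f ε t) r = 0 := by simp [mom]
    simp only [pd_const, one_mul, zero_mul, z, mul_zero, Finset.sum_const_zero, add_zero,
      sub_zero] at key
    have hne := hε.1.ne'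
    rw [key]
    field_simp
    ring)
  obtain ⟨-, h1, h2⟩ := total.coeff_eq_zero
  simp only [density_eq_mom]
  exact ⟨eq_neg_of_add_eq_zero_left h1, eq_neg_of_add_eq_zero_left h2⟩

theorem integrable_coeff {t : ℝ} (ht : t ∈ Ioo 0 t₀) {n : ℕ} (hn : n < 3) (r : E3)
    (q : E3 → ℝ) (hq : q.HasTemperateGrowth) : Integrable fun p => q p * c n t r p := by
  have hs : t / 2 ∈ Ioo 0 t₀ := ⟨by linarith [ht.1], by linarith [ht.1, ht.2]⟩
  obtain ⟨C, hC⟩ := D.jetDominated_coeff hs hn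
  exact hC.integrable_mom hs.1.le D.phaseEnvelope ⟨by linarith [ht.1], ht.2⟩ hq r

/-- The leading distribution carries no flux. -/
theorem flux_leading {t : ℝ} (ht : t ∈ Ioo 0 t₀) (r : E3) (a : Fin 3) :
    flux (c 0 t) r a = 0 := by
  refine congrFun (posDef_solve_unique (D.posDef_leading (Ioo_subset_Icc_self ht) r)
    (flux (c 0 t) r) fun a => ?_) a
  have := (D.order_equations ht (growth_coord a) r).1
  simpa only [dragMoment_coord, sum_sum_one_mul] using this

/-- The momenta of the leading distribution are isotropic. -/
theorem stress_leading {t : ℝ} (ht : t ∈ Ioo 0 t₀) (r : E3) (a b : Fin 3) :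
    stress (c 0 t) r a b = (1 : Mat3) a b * density (c 0 t) r := by
  have symm : ∀ a b : Fin 3, (1 : Mat3) a b = (1 : Mat3) b a := fun a b => by
    simp [Matrix.one_apply, eq_comm]
  refine sub_eq_zero.1 (posDef_lyapunov_unique (D.posDef_leading (Ioo_subset_Icc_self ht) r)
    (fun a b => stress (c 0 t) r a b - (1 : Mat3) a b * density (c 0 t) r)
    (fun a b => by rw [stress_comm, symm]) (fun a b => ?_) a b)
  have := (D.order_equations ht (growth_coord_mul a b) r).1
  simpa only [dragMoment_coord_mul (D.integrable_coeff ht (n := 0) (by norm_num) r), mul_add,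
    Finset.sum_add_distrib, sum_sum_one_mul] using this

/-- The third moments of the leading distribution vanish. -/
theorem heat_leading {t : ℝ} (ht : t ∈ Ioo 0 t₀) (r : E3) (a b d : Fin 3) :
    heat (c 0 t) r a b d = 0 := by
  refine posDef_lyapunov_three_unique (D.posDef_leading (Ioo_subset_Icc_self ht) r)
    (heat (c 0 t) r) (heat_swap₁₂ _ r) (heat_swap₂₃ _ r) (fun a b d => ?_) a b d
  have := (D.order_equations ht (growth_coord_mul_mul a b d) r).1
  simpa only [dragMoment_coord_mul_mul (D.integrable_coeff ht (n := 0) (by norm_num) r)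
    (D.flux_leading ht r), mul_add, Finset.sum_add_distrib, sum_sum_one_mul] using this

theorem dragMoment_leading {t : ℝ} (ht : t ∈ Ioo 0 t₀) (r : E3) (a b i j : Fin 3) :
    dragMoment (fun p => p a) (c 0 t) r i j = 0 ∧
    dragMoment (fun p => p a * p b) (c 0 t) r i j = 0 := by
  constructor
  · rw [dragMoment_coord, D.flux_leading ht, mul_zero]
  · rw [dragMoment_coord_mul (D.integrable_coeff ht (n := 0) (by norm_num) r),
      D.stress_leading ht, D.stress_leading ht]
    ring

/-- At first order the momenta are still isotropic: the third moment of the leading distribution,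
whose divergence could drive an anisotropy, vanishes. -/
theorem stress_first {t : ℝ} (ht : t ∈ Ioo 0 t₀) (r : E3) (a b : Fin 3) :
    stress (c 1 t) r a b = (1 : Mat3) a b * density (c 1 t) r := by
  have symm : ∀ a b : Fin 3, (1 : Mat3) a b = (1 : Mat3) b a := fun a b => by
    simp [Matrix.one_apply, eq_comm]
  refine sub_eq_zero.1 (posDef_lyapunov_unique (D.posDef_leading (Ioo_subset_Icc_self ht) r)
    (fun a b => stress (c 1 t) r a b - (1 : Mat3) a b * density (c 1 t) r)
    (fun a b => by rw [stress_comm, symm]) (fun a b => ?_) a b)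
  have key := (D.order_equations ht (growth_coord_mul a b) r).2.1
  have z1 : ∀ l, pd l (mom (fun p => p a * p b * p l) (c 0 t)) r = 0 := fun l => by
    have : mom (fun p => p a * p b * p l) (c 0 t) = fun _ => 0 :=
      funext fun r => D.heat_leading ht r a b l
    rw [this, pd_const]
  have z2 : ∀ l, mom (pd l fun p => p a * p b) (c 0 t) r = 0 := fun l => by
    have hf : ∀ a, mom (fun p => p a) (c 0 t) r = 0 := D.flux_leading ht r
    rw [pd_coord_mul, mom_weight_add (D.integrable_coeff ht (n := 0) (by norm_num) r)
      (growth_const_mul (growth_coord b) _) (growth_const_mul (growth_coord a) _),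
      mom_weight_const_mul, mom_weight_const_mul, hf, hf, mul_zero, mul_zero, add_zero]
  simpa only [z1, z2, (D.dragMoment_leading ht r a b _ _).2, mul_zero, Finset.sum_const_zero,
    zero_add, add_zero, dragMoment_coord_mul (D.integrable_coeff ht (n := 1) (by norm_num) r),
    mul_add, Finset.sum_add_distrib, sum_sum_one_mul] using key

/-- The equation for the flux at first order, which is the flux of the leading density. -/
theorem flux_first {t : ℝ} (ht : t ∈ Ioo 0 t₀) (r : E3) (a : Fin 3) :
    ∑ j, (1 + S.meanZ₁ (density (c 0 t)) r) a j * flux (c 1 t) r j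
      = -(pd a (density (c 0 t)) r
        + S.totalForce t (density (c 0 t)) r a * density (c 0 t) r) := by
  have key := (D.order_equations ht (growth_coord a) r).2.1
  rw [sum_pd_isotropic (D.stress_leading ht)] at key
  have hm : ∀ l, S.totalForce t (density (c 0 t)) r l
      * mom (pd l fun p => p a) (c 0 t) r
      = (1 : Mat3) a l * (S.totalForce t (density (c 0 t)) r l * density (c 0 t) r) := fun l => by
    rw [pd_coordinate, mom_weight_const, Matrix.one_apply, Matrix.one_apply]
    simp only [eq_comm (a := l)]
    ring
  have hsum : ∀ X : Fin 3 → ℝ, ∑ l, (1 : Mat3) a l * X l = X a := fun X => by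
    simp [Matrix.one_apply]
  simp only [hm, hsum, (D.dragMoment_leading ht r a a _ _).1, mul_zero, add_zero,
    dragMoment_coord, sum_sum_one_mul] at key
  linarith

/-- The equation for the flux at second order. -/
theorem flux_second {t : ℝ} (ht : t ∈ Ioo 0 t₀) (r : E3) (a : Fin 3) :
    ∑ j, (1 + S.meanZ₁ (density (c 0 t)) r) a j * flux (c 2 t) r j
      + ∑ j, S.meanZ₁ (density (c 1 t)) r a j * flux (c 1 t) r j
      = -(pd a (density (c 1 t)) r
        + S.totalForce t (density (c 0 t)) r a * density (c 1 t) r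
        + S.meanForce (density (c 1 t)) r a * density (c 0 t) r) := by
  have key := (D.order_equations ht (growth_coord a) r).2.2
  have hd : deriv (fun s => mom (fun p => p a) (c 0 s) r) t = 0 := by
    have : (fun s => mom (fun p => p a) (c 0 s) r) =ᶠ[𝓝 t] fun _ => 0 := by
      filter_upwards [Ioo_mem_nhds ht.1 ht.2] with s hs using D.flux_leading hs r a
    rw [this.deriv_eq, deriv_const]
  rw [hd, sum_pd_isotropic (D.stress_first ht)] at key
  have hm : ∀ l, (S.totalForce t (density (c 0 t)) r l
      * mom (pd l fun p => p a) (c 1 t) r + S.meanForce (density (c 1 t)) r l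
      * mom (pd l fun p => p a) (c 0 t) r)
      = (1 : Mat3) a l * (S.totalForce t (density (c 0 t)) r l * density (c 1 t) r
        + S.meanForce (density (c 1 t)) r l * density (c 0 t) r) := fun l => by
    rw [pd_coordinate, mom_weight_const, mom_weight_const, Matrix.one_apply, Matrix.one_apply]
    simp only [eq_comm (a := l)]
    ring
  have hsum : ∀ X : Fin 3 → ℝ, ∑ l, (1 : Mat3) a l * X l = X a := fun X => by
    simp [Matrix.one_apply]
  simp only [hm, hsum, (D.dragMoment_leading ht r a a _ _).1, mul_zero, add_zero,
    dragMoment_coord, Finset.sum_add_distrib, sum_sum_one_mul] at key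
  linarith

end Setting

/-! ### Fluxes as vector fields -/

theorem app_add_matrix (A B : Mat3) (v : E3) : app (A + B) v = app A v + app B v := by
  simp [app]

theorem app_neg_matrix (A : Mat3) (v : E3) : app (-A) v = -app A v := by
  ext i
  simp [app_apply]

theorem app_neg (A : Mat3) (v : E3) : app A (-v) = -app A v := by
  simp [app]

theorem app_smul_matrix (κ : ℝ) (A : Mat3) (v : E3) : app (κ • A) v = κ • app A v := by
  simp [app]

theorem app_app (A B : Mat3) (v : E3) : app A (app B v) = app (A * B) v := by
  ext i
  simp only [app_apply, Matrix.mul_apply, Finset.mul_sum, Finset.sum_mul]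
  rw [Finset.sum_comm]
  exact Finset.sum_congr rfl fun j _ => Finset.sum_congr rfl fun k _ => by ring

theorem app_inv_app {A : Mat3} (hA : A.PosDef) (v : E3) : app A⁻¹ (app A v) = v := by
  rw [app_app, Matrix.nonsing_inv_mul _ ((Matrix.isUnit_iff_isUnit_det _).1 hA.isUnit), app_one]

theorem norm_le_sum_coord (v : E3) : ‖v‖ ≤ ∑ i, |v i| := by
  rw [EuclideanSpace.norm_eq]
  refine Real.sqrt_le_iff.2 ⟨Finset.sum_nonneg fun i _ => abs_nonneg _, ?_⟩
  simp only [Fin.sum_univ_three, Real.norm_eq_abs]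
  nlinarith [mul_nonneg (abs_nonneg (v 0)) (abs_nonneg (v 1)),
    mul_nonneg (abs_nonneg (v 0)) (abs_nonneg (v 2)),
    mul_nonneg (abs_nonneg (v 1)) (abs_nonneg (v 2))]

theorem gradient_const_smul (a : ℝ) (q : E3 → ℝ) (x : E3) :
    gradient (fun y => a * q y) x = a • gradient q x := by
  unfold gradient
  rw [show (fun y => a * q y) = a • q from rfl, fderiv_const_smul_field]
  simp

theorem divergence_const_smul {W : E3 → E3} (a : ℝ) (x : E3) :
    divergence (fun y => a • W y) x = a * divergence W x := by
  have : fderiv ℝ (fun y => a • W y) x = a • fderiv ℝ W x := by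
    rw [show (fun y => a • W y) = a • W from rfl, fderiv_const_smul_field]
    rfl
  simp only [divergence, this, Finset.mul_sum]
  rfl

/-- The first velocity moment as a vector field. -/
def fluxField (v : E3 → E3 → ℝ) (r : E3) : E3 := WithLp.toLp 2 (flux v r)

theorem fluxField_apply (v : E3 → E3 → ℝ) (r : E3) (i : Fin 3) :
    fluxField v r i = flux v r i := rfl

namespace JetDominated

variable {h w : E3 → ℝ} {t₀ s C t : ℝ} {u : ℝ → E3 → E3 → ℝ} (hs : 0 ≤ s)
  (he : PhaseEnvelope h w) (hu : JetDominated h w t₀ s C u) (ht : t ∈ Ioo s t₀)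
include hs he hu ht

theorem differentiableAt_fluxField (r : E3) : DifferentiableAt ℝ (fluxField (u t)) r :=
  differentiableAt_of_coord fun i =>
    (hu.hasFDerivAt_mom hs he ht (growth_coord i) r).differentiableAt

theorem divergence_fluxField (r : E3) :
    divergence (fluxField (u t)) r = ∑ l, pd l (fun x => flux (u t) x l) r :=
  divergence_eq_sum_pd (hu.differentiableAt_fluxField hs he ht r)

theorem norm_fluxField_le (r : E3) :
    ‖fluxField (u t) r‖ ≤ (∑ i : Fin 3, C * ∫ p, |p i| * w p) * h r := by
  refine (norm_le_sum_coord _).trans ?_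
  rw [Finset.sum_mul]
  refine Finset.sum_le_sum fun i _ => ?_
  exact (hu.abs_mom_le hs he ht (growth_coord i) r).trans_eq (by ring)

theorem hasDerivAt_density (r : E3) :
    HasDerivAt (fun s => density (u s) r) (deriv (fun s => density (u s) r) t) t := by
  simp only [density_eq_mom]
  exact (hu.hasDerivAt_mom hs he ht growth_one r).differentiableAt.hasDerivAt

end JetDominated

namespace Model

variable {S : Model}

/-! ### The evolution equation of the first correction -/

theorem meanZ₁_neg (ρ : E3 → ℝ) (r : E3) : S.meanZ₁ (fun x => -ρ x) r = -S.meanZ₁ ρ r := by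
  ext i j
  rw [Matrix.neg_apply, meanZ₁_apply, meanZ₁_apply, ← integral_neg]
  simp only [neg_smul]

theorem meanForce_neg (ρ : E3 → ℝ) (r : E3) :
    S.meanForce (fun x => -ρ x) r = -S.meanForce ρ r := by
  rw [meanForce_eq, meanForce_eq, ← integral_neg]
  simp only [neg_smul]

theorem meanZ₂_neg (b : E3 → E3) (r : E3) : S.meanZ₂ (fun x => -b x) r = -S.meanZ₂ b r := by
  simp only [meanZ₂, app_neg, smul_neg, integral_neg]

theorem gradient_neg (q : E3 → ℝ) (x : E3) : gradient (fun y => -q y) x = -gradient q x := by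
  have := gradient_const_smul (-1) q x
  simpa using this

/-- The equation for `ψ` is linear, and in particular invariant under `ψ ↦ -ψ`. -/
theorem IsPsiSolution.neg {h : E3 → ℝ} {t₀ : ℝ} {ρ ψ : ℝ → E3 → ℝ} {a : ℝ → E3 → E3}
    (hψ : S.IsPsiSolution h t₀ ρ a ψ) :
    S.IsPsiSolution h t₀ ρ a (fun t r => -ψ t r) where
  cont := fun r => (hψ.cont r).neg
  bound := by simpa only [abs_neg] using hψ.bound
  smooth := fun t ht => (hψ.smooth t ht).neg
  deriv_bound := fun s hs => by
    obtain ⟨C, hC⟩ := hψ.deriv_bound s hs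
    refine ⟨C, fun t ht r => ?_⟩
    rw [gradient_neg, norm_neg, deriv.fun_neg, abs_neg]
    exact hC t ht r
  equation := by
    obtain ⟨a₂, hb, he⟩ := hψ.equation
    refine ⟨fun t r => -a₂ t r, fun s hs => ?_, fun t ht r => ?_⟩
    · simpa only [norm_neg] using hb s hs
    · obtain ⟨h1, h2, h3⟩ := he t ht r
      refine ⟨h1.neg, ?_, ?_⟩
      · have e1 : S.resist (ρ t) (fun r => -a₂ t r) r = -S.resist (ρ t) (a₂ t) r := by
          simp only [resist, app_neg, meanZ₂_neg, smul_neg]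
          abel
        have e2 : S.psiDrive t (ρ t) (a t) (fun r => -ψ t r) r
            = -S.psiDrive t (ρ t) (a t) (ψ t) r := by
          simp only [psiDrive, gradient_neg, meanForce_neg, meanZ₁_neg, app_neg_matrix, smul_neg,
            neg_smul]
          abel
        change S.resist (ρ t) (fun r => -a₂ t r) r
          = -S.psiDrive t (ρ t) (a t) (fun r => -ψ t r) r
        rw [e1, e2, h2]
      · have := divergence_const_smul (W := a₂ t) (-1) r
        simp only [neg_smul, one_smul, neg_mul, one_mul] at this
        change HasDerivAt (fun s => -ψ s r) (-divergence (fun r => -a₂ t r) r) t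
        rw [this]
        exact h3.neg

theorem resist_eq (hZ₂ : ∀ r r', S.Z₂ r r' = 0) (ρ : E3 → ℝ) (b : E3 → E3) (r : E3) :
    S.resist ρ b r = app (1 + S.meanZ₁ ρ r) (b r) := by
  have : S.meanZ₂ b r = 0 := by simp [meanZ₂, hZ₂, app_zero]
  rw [resist, this, smul_zero, add_zero, app_add_matrix, app_one]

/-! ### The Smoluchowski flux in rescaled variables -/

theorem gradient_V₁ (t : ℝ) (r : E3) :
    gradient (S.V₁ t) r = (1 / S.kBT) • gradient (S.U₁ t) r := by
  rw [← gradient_const_smul]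
  congr 1
  funext x
  rw [V₁]
  ring

theorem gradient_V₂ (r r' : E3) :
    gradient (fun x => S.V₂ x r') r = (1 / S.kBT) • gradient (fun x => S.U₂ x r') r := by
  rw [← gradient_const_smul]
  congr 1
  funext x
  rw [V₂]
  ring

/-- The Smoluchowski field in rescaled variables; the factor `ρ r` of the two-body density leaves the
integral. -/
theorem smolField_eq (γ t : ℝ) (ρ : E3 → ℝ) (r : E3) :
    S.smolField γ (S.U₁ t) ρ r = S.diff₀ γ • app (1 + S.meanZ₁ ρ r)⁻¹
      (gradient ρ r + ρ r • S.totalForce t ρ r) := by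
  have e : (1 / S.kBT) • ∫ r', S.rho2 ρ r r' • gradient (fun x => S.U₂ x r') r
      = ρ r • S.meanForce ρ r := by
    rw [meanForce, ← integral_smul, ← integral_smul]
    refine integral_congr_ae (Eventually.of_forall fun x => ?_)
    simp only [gradient_V₂, smul_smul, rho2]
    congr 1
    ring
  rw [smolField, diffusionTensor, app_smul_matrix, e, totalForce, smul_add, gradient_V₁,
    smul_comm (ρ r), ← add_assoc]

end Model

namespace HasExp

theorem tendsto {x : ℝ → ℝ} {a₀ a₁ a₂ : ℝ} (hx : HasExp x a₀ a₁ a₂) :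
    Tendsto x (𝓝[>] 0) (𝓝 a₀) := by
  have t0 : Tendsto (fun ε : ℝ => ε ^ 3) (𝓝[>] 0) (𝓝 0) := by
    simpa using ((continuous_pow 3).tendsto (0 : ℝ)).mono_left (nhdsWithin_le_nhds (s := Ioi 0))
  have t1 : Tendsto (fun ε : ℝ => a₀ + ε * a₁ + ε ^ 2 * a₂) (𝓝[>] 0) (𝓝 a₀) := by
    have : Continuous fun ε : ℝ => a₀ + ε * a₁ + ε ^ 2 * a₂ := by fun_prop
    simpa using (this.tendsto 0).mono_left (nhdsWithin_le_nhds (s := Ioi 0))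
  simpa using (IsBigO.trans_tendsto hx t0).add t1

theorem isBigO_sq {x : ℝ → ℝ} {a₂ : ℝ} (hx : HasExp x 0 0 a₂) :
    x =O[𝓝[>] 0] fun ε : ℝ => ε ^ 2 := by
  have h1 := IsBigO.trans hx (isBigO_pow (show 2 ≤ 3 by norm_num))
  have h2 : (fun ε : ℝ => ε ^ 2 * a₂) =O[𝓝[>] 0] fun ε : ℝ => ε ^ 2 :=
    (isBigO_refl (fun ε : ℝ => ε ^ 2) _).mul (isBigO_const_const a₂ one_ne_zero _) |>.congr_right
      fun ε => mul_one _
  exact (h1.add h2).congr_left fun ε => by ring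

end HasExp

/-- Matrix inversion is continuous at a positive definite matrix. -/
theorem tendsto_matrix_inv {A : ℝ → Mat3} {A₀ : Mat3} (hA₀ : A₀.PosDef)
    (hA : ∀ i j, Tendsto (fun ε => A ε i j) (𝓝[>] 0) (𝓝 (A₀ i j))) (i j : Fin 3) :
    Tendsto (fun ε => (A ε)⁻¹ i j) (𝓝[>] 0) (𝓝 (A₀⁻¹ i j)) := by
  have hA' : Tendsto A (𝓝[>] 0) (𝓝 A₀) :=
    tendsto_pi_nhds.2 fun i => tendsto_pi_nhds.2 fun j => hA i j
  have hdet : Tendsto (fun ε => (A ε).det) (𝓝[>] 0) (𝓝 A₀.det) :=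
    ((continuous_id.matrix_det).tendsto A₀).comp hA'
  have hadj : Tendsto (fun ε => (A ε).adjugate i j) (𝓝[>] 0) (𝓝 (A₀.adjugate i j)) :=
    ((continuous_id.matrix_adjugate.matrix_elem i j).tendsto A₀).comp hA'
  have := (hdet.inv₀ hA₀.det_pos.ne').mul hadj
  simpa only [Matrix.inv_def, Ring.inverse_eq_inv', Matrix.smul_apply, smul_eq_mul] using this

namespace Setting

variable {S : Model} {t₀ ε₀ : ℝ} {h w : E3 → ℝ} {f : ℝ → ℝ → E3 → E3 → ℝ}
  {c : ℕ → ℝ → E3 → E3 → ℝ} (D : Setting S t₀ ε₀ h w f c)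
include D

theorem exists_jet_coeff {t : ℝ} (ht : t ∈ Ioo 0 t₀) {n : ℕ} (hn : n < 3) :
    ∃ s C, s ∈ Ioo 0 t₀ ∧ t ∈ Ioo s t₀ ∧ JetDominated h w t₀ s C (c n) := by
  have hs : t / 2 ∈ Ioo 0 t₀ := ⟨by linarith [ht.1], by linarith [ht.1, ht.2]⟩
  obtain ⟨C, hC⟩ := D.jetDominated_coeff hs hn
  exact ⟨t / 2, C, hs, ⟨by linarith [ht.1], ht.2⟩, hC⟩

theorem exists_jet_solution {t : ℝ} (ht : t ∈ Ioo 0 t₀) {ε : ℝ} (hε : ε ∈ Ioo 0 ε₀) :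
    ∃ s C, s ∈ Ioo 0 t₀ ∧ t ∈ Ioo s t₀ ∧ JetDominated h w t₀ s C (f ε) := by
  have hs : t / 2 ∈ Ioo 0 t₀ := ⟨by linarith [ht.1], by linarith [ht.1, ht.2]⟩
  obtain ⟨C, hC⟩ := D.jetDominated_solution hs hε
  exact ⟨t / 2, C, hs, ⟨by linarith [ht.1], ht.2⟩, hC⟩

theorem differentiableAt_fluxField {t : ℝ} (ht : t ∈ Ioo 0 t₀) {n : ℕ} (hn : n < 3) (r : E3) :
    DifferentiableAt ℝ (fluxField (c n t)) r := by
  obtain ⟨s, C, hs, hst, hC⟩ := D.exists_jet_coeff ht hn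
  exact hC.differentiableAt_fluxField hs.1.le D.phaseEnvelope hst r

theorem contDiff_density {t : ℝ} (ht : t ∈ Ioo 0 t₀) {n : ℕ} (hn : n < 3) :
    ContDiff ℝ 1 (density (c n t)) := by
  obtain ⟨s, C, hs, hst, hC⟩ := D.exists_jet_coeff ht hn
  rw [density_eq_mom]
  exact hC.contDiff_mom hs.1.le D.phaseEnvelope hst growth_one

/-- The continuity equation at orders zero and one. -/
theorem hasDerivAt_density {t : ℝ} (ht : t ∈ Ioo 0 t₀) {n : ℕ} (hn : n < 2) (r : E3) :
    HasDerivAt (fun s => density (c n s) r) (-divergence (fluxField (c (n + 1) t)) r) t := by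
  obtain ⟨s, C, hs, hst, hC⟩ := D.exists_jet_coeff ht (n := n) (by omega)
  obtain ⟨s', C', hs', hst', hC'⟩ := D.exists_jet_coeff ht (n := n + 1) (by omega)
  rw [hC'.divergence_fluxField hs'.1.le D.phaseEnvelope hst' r]
  have h1 := hC.hasDerivAt_density hs.1.le D.phaseEnvelope hst r
  have h2 := D.continuity_equations ht r
  interval_cases n
  · rwa [h2.1] at h1
  · rwa [h2.2] at h1

/-- `Setting.flux_first` in vector form. -/
theorem app_flux_first {t : ℝ} (ht : t ∈ Ioo 0 t₀) (r : E3) :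
    app (1 + S.meanZ₁ (density (c 0 t)) r) (fluxField (c 1 t) r)
      = -(gradient (density (c 0 t)) r
        + density (c 0 t) r • S.totalForce t (density (c 0 t)) r) := by
  ext a
  simp only [app_apply, fluxField_apply, PiLp.neg_apply, PiLp.add_apply, PiLp.smul_apply,
    smul_eq_mul, gradient_apply, D.flux_first ht r a]
  ring

theorem isFlux {t : ℝ} (ht : t ∈ Ioo 0 t₀) :
    S.IsFlux t (density (c 0 t)) (fluxField (c 1 t)) := fun r => by
  rw [Model.resist_eq D.Z₂_eq_zero, D.app_flux_first ht, Model.totalForce, smul_add, add_assoc]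

/-- The first correction to the density solves the linear equation for `ψ`. -/
theorem isPsiSolution : S.IsPsiSolution h t₀ (fun t => density (c 0 t))
    (fun t => fluxField (c 1 t)) (fun t => density (c 1 t)) where
  cont := D.expansion.density_cont 1 (by norm_num)
  bound := D.expansion.density_bound 1 (by norm_num)
  smooth := fun t ht => D.contDiff_density ht (by norm_num)
  deriv_bound := fun s hs => by
    obtain ⟨C, hC⟩ := D.jetDominated_coeff hs (n := 1) (by norm_num)
    refine ⟨C * ∫ p, |(1 : ℝ)| * w p, fun t ht r => ⟨?_, ?_⟩⟩
    · simp only [density_eq_mom, norm_gradient]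
      exact (hC.norm_fderiv_mom_le hs.1.le D.phaseEnvelope ht growth_one r).trans_eq (by ring)
    · simp only [density_eq_mom]
      exact (hC.abs_deriv_mom_le hs.1.le D.phaseEnvelope ht growth_one r).trans_eq (by ring)
  equation := by
    refine ⟨fun t => fluxField (c 2 t), fun s hs => ?_, fun t ht r => ⟨?_, ?_, ?_⟩⟩
    · obtain ⟨C, hC⟩ := D.jetDominated_coeff hs (n := 2) (by norm_num)
      exact ⟨_, fun t ht r => hC.norm_fluxField_le hs.1.le D.phaseEnvelope ht r⟩
    · exact D.differentiableAt_fluxField ht (by norm_num) r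
    · have hz : S.meanZ₂ (fluxField (c 1 t)) r = 0 := by
        simp [Model.meanZ₂, D.Z₂_eq_zero, app_zero]
      rw [Model.resist_eq D.Z₂_eq_zero, Model.psiDrive, hz, smul_zero, add_zero]
      ext a
      have key := D.flux_second ht r a
      simp only [app_apply, fluxField_apply, PiLp.neg_apply, PiLp.add_apply, PiLp.smul_apply,
        smul_eq_mul, gradient_apply, Model.totalForce] at key ⊢
      linarith
    · exact D.hasDerivAt_density ht (n := 1) (by norm_num) r

/-- For an initial density independent of `ε`, all of it is carried by the leading term. -/
theorem initial {ρ₀ : E3 → ℝ} (h0 : ∀ ε ∈ Ioo 0 ε₀, ∀ r, density (f ε 0) r = ρ₀ r) (r : E3) :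
    density (c 0 0) r = ρ₀ r ∧ density (c 1 0) r = 0 := by
  obtain ⟨C, hC⟩ := D.expansion.density_remainder
  -- multiplying by `ε` turns the error `O(ε²)` at the initial time into the `O(ε³)` of `HasExp`
  have key : HasExp (fun _ => 0) 0 (density (c 0 0) r - ρ₀ r) (density (c 1 0) r) := by
    refine IsBigO.of_bound (C * h r) ?_
    filter_upwards [Ioo_mem_nhdsGT D.ε₀_pos] with ε hε
    have h1 := hC ε hε 0 ⟨le_rfl, D.t₀_pos.le⟩ r
    simp only [Finset.sum_range_succ, Finset.sum_range_zero, zero_add, pow_zero, one_mul,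
      pow_one, h0 ε hε r] at h1
    rw [Real.norm_eq_abs, Real.norm_of_nonneg (pow_nonneg hε.1.le 3)]
    calc |0 - (0 + ε * (density (c 0 0) r - ρ₀ r) + ε ^ 2 * density (c 1 0) r)|
        = |ε * (ρ₀ r - (density (c 0 0) r + ε * density (c 1 0) r))| := by congr 1; ring
      _ = ε * |ρ₀ r - (density (c 0 0) r + ε * density (c 1 0) r)| := by
          rw [abs_mul, abs_of_nonneg hε.1.le]
      _ ≤ ε * (C * ε ^ 2 * h r) := mul_le_mul_of_nonneg_left h1 hε.1.le
      _ = _ := by ring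
  obtain ⟨-, h1, h2⟩ := key.coeff_eq_zero
  exact ⟨sub_eq_zero.1 h1, h2⟩

/-- Both `ψ` and `-ψ` solve the linear equation with zero initial datum, so preservation of
non-negativity forces `ψ = 0`. -/
theorem density_first_eq_zero (hψ : S.PreservesNonneg h t₀ fun t => density (c 0 t))
    (h0 : ∀ r, density (c 1 0) r = 0) {t : ℝ} (ht : t ∈ Icc 0 t₀) (r : E3) :
    density (c 1 t) r = 0 := by
  have hf := fun t (ht : t ∈ Ioo 0 t₀) => D.isFlux ht
  have h1 := hψ _ hf _ D.isPsiSolution h0 t ht r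
  have h2 := hψ _ hf _ D.isPsiSolution.neg (fun r => by simp [h0 r]) t ht r
  linarith

/-! ### The flux of the true density -/

theorem hasDerivAt_density_solution {t : ℝ} (ht : t ∈ Ioo 0 t₀) {ε : ℝ} (hε : ε ∈ Ioo 0 ε₀)
    (r : E3) : DifferentiableAt ℝ (density (f ε t)) r ∧
      DifferentiableAt ℝ (fluxField (f ε t)) r ∧
      HasDerivAt (fun s => density (f ε s) r)
        (-(1 / ε) * divergence (fluxField (f ε t)) r) t := by
  obtain ⟨s, C, hs, hst, hC⟩ := D.exists_jet_solution ht hε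
  have hp := D.phaseEnvelope
  refine ⟨?_, hC.differentiableAt_fluxField hs.1.le hp hst r, ?_⟩
  · rw [density_eq_mom]
    exact (hC.hasFDerivAt_mom hs.1.le hp hst growth_one r).differentiableAt
  · have h1 := hC.hasDerivAt_density hs.1.le hp hst r
    have key := Model.moment_equation D.envelope D.h_pos D.Z₂_eq_zero hs.1.le
      (D.solution ε hε) hC hst growth_one r
    have z : mom (fun _ => 0) (f ε t) r = 0 := by simp [mom]
    simp only [pd_const, one_mul, zero_mul, z, mul_zero, Finset.sum_const_zero, add_zero,
      sub_zero] at key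
    rw [hC.divergence_fluxField hs.1.le hp hst r]
    have e : deriv (fun s => density (f ε s) r) t
        = -(1 / ε) * ∑ l, pd l (fun x => flux (f ε t) x l) r := by
      simp only [density_eq_mom]
      exact key
    rwa [e] at h1

/-- The flux of the true density is the Smoluchowski flux up to `O(ε²)`: the momentum balance
expresses the difference through the anisotropic part of the stress and the time derivative of
the flux, both of which vanish at the orders `ε⁰` and `ε¹`. -/
theorem flux_error_isBigO {t : ℝ} (ht : t ∈ Ioo 0 t₀) (r : E3) :
    (fun ε => -(1 / ε) • fluxField (f ε t) r - app (1 + S.meanZ₁ (density (f ε t)) r)⁻¹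
      (gradient (density (f ε t)) r
        + density (f ε t) r • S.totalForce t (density (f ε t)) r))
      =O[𝓝[>] 0] fun ε : ℝ => ε ^ 2 := by
  have hs : t / 2 ∈ Ioo 0 t₀ := ⟨by linarith [ht.1], by linarith [ht.1, ht.2]⟩
  have ht' : t ∈ Ioo (t / 2) t₀ := ⟨by linarith [ht.1], ht.2⟩
  have hp := D.phaseEnvelope
  -- the residual of the momentum balance: inertia and anisotropic stress
  set k : Fin 3 → ℝ → ℝ := fun a ε => ε * deriv (fun s => mom (fun p => p a) (f ε s) r) t
    + ∑ l, pd l (mom (fun p => p a * p l) (f ε t)) r - pd a (density (f ε t)) r with hk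
  have hkO : ∀ a, k a =O[𝓝[>] 0] fun ε : ℝ => ε ^ 2 := fun a => by
    have E1 := (D.hasExp hs
      (isJetFunctional_deriv_mom hs.1.le hp ht' (growth_coord a) r)).eps_mul
    have E2 := HasExp.sum Finset.univ fun l => D.hasExp hs
      (isJetFunctional_pd_mom hs.1.le hp ht' (growth_coord_mul a l) r l)
    have E3 := D.hasExp hs (isJetFunctional_pd_mom hs.1.le hp ht' growth_one r a)
    have E := (E1.add E2).sub E3
    have hd : deriv (fun s => mom (fun p => p a) (c 0 s) r) t = 0 := by
      have : (fun s => mom (fun p => p a) (c 0 s) r) =ᶠ[𝓝 t] fun _ => 0 := by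
        filter_upwards [Ioo_mem_nhds ht.1 ht.2] with s hs using D.flux_leading hs r a
      rw [this.deriv_eq, deriv_const]
    simp only [hd, sum_pd_isotropic (D.stress_leading ht), sum_pd_isotropic (D.stress_first ht),
      ← density_eq_mom, zero_add, sub_self] at E
    exact E.isBigO_sq
  set B : ℝ → Mat3 := fun ε => (1 + S.meanZ₁ (density (f ε t)) r)⁻¹ with hB
  have hBO : ∀ i j, (fun ε => B ε i j) =O[𝓝[>] 0] fun _ => (1 : ℝ) := fun i j => by
    refine (tendsto_matrix_inv (D.posDef_leading (Ioo_subset_Icc_self ht) r) (fun i j => ?_)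
      i j).isBigO_one ℝ
    exact ((HasExp.const ((1 : Mat3) i j)).add (D.hasExp hs
      (isJetFunctional_meanZ₁ hs.1.le hp ht' D.envelope D.h_pos r i j))).tendsto
  have hfin : (fun ε => ∑ i, |∑ j, B ε i j * k j ε|) =O[𝓝[>] 0] fun ε : ℝ => ε ^ 2 :=
    IsBigO.fun_sum fun i _ => IsBigO.abs_left <| IsBigO.fun_sum fun j _ =>
      ((hBO i j).mul (hkO j)).congr_right fun ε => one_mul _
  refine IsBigO.trans (IsBigO.of_bound 1 ?_) hfin
  filter_upwards [Ioo_mem_nhdsGT D.ε₀_pos] with ε hε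
  have hne := hε.1.ne'
  obtain ⟨C, hC⟩ := D.jetDominated_solution hs hε
  set A : Mat3 := 1 + S.meanZ₁ (density (f ε t)) r with hA
  have hApd : A.PosDef := D.posDef_solution hε (Ioo_subset_Icc_self ht) r
  -- the exact momentum balance, multiplied by `ε`
  have hbal : app A (-(1 / ε) • fluxField (f ε t) r)
      = WithLp.toLp 2 (fun a => k a ε) + (gradient (density (f ε t)) r
        + density (f ε t) r • S.totalForce t (density (f ε t)) r) := by
    ext a
    have key := Model.moment_equation D.envelope D.h_pos D.Z₂_eq_zero hs.1.le
      (D.solution ε hε) hC ht' (growth_coord a) r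
    have hdrag : ∀ i j, mom (fun p => pd i (fun p : E3 => p a) p * p j) (f ε t) r
        - mom (pd j (pd i fun p : E3 => p a)) (f ε t) r
        = (1 : Mat3) i a * flux (f ε t) r j := dragMoment_coord a
    have hm : ∀ l, S.totalForce t (density (f ε t)) r l
        * mom (pd l fun p : E3 => p a) (f ε t) r
        = (1 : Mat3) a l * (S.totalForce t (density (f ε t)) r l * density (f ε t) r) :=
      fun l => by
        rw [pd_coordinate, mom_weight_const, Matrix.one_apply, Matrix.one_apply]
        simp only [eq_comm (a := l)]
        ring
    have hsum : ∀ X : Fin 3 → ℝ, ∑ l, (1 : Mat3) a l * X l = X a := fun X => by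
      simp [Matrix.one_apply]
    simp only [hdrag, hm, hsum, sum_sum_one_mul] at key
    simp only [app_apply, PiLp.smul_apply, PiLp.add_apply, smul_eq_mul, fluxField_apply,
      gradient_apply, hk, key]
    have hpull : ∑ j, A a j * (-(1 / ε) * flux (f ε t) r j)
        = -(1 / ε) * ∑ j, A a j * flux (f ε t) r j := by
      rw [Finset.mul_sum]
      exact Finset.sum_congr rfl fun j _ => by ring
    rw [hpull]
    field_simp
    ring
  have hsol : -(1 / ε) • fluxField (f ε t) r - app A⁻¹ (gradient (density (f ε t)) r
        + density (f ε t) r • S.totalForce t (density (f ε t)) r)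
      = app A⁻¹ (WithLp.toLp 2 fun a => k a ε) := by
    have := congrArg (app A⁻¹) hbal
    rw [app_inv_app hApd] at this
    rw [this]
    simp [app]
  rw [hsol, one_mul, Real.norm_of_nonneg (Finset.sum_nonneg fun i _ => abs_nonneg _)]
  exact norm_le_sum_coord _

end Setting

/-- The Maxwellian is normalized. -/
theorem density_maxwellian (x : ℝ) :
    ∫ p : E3, ((2 * Real.pi) ^ (3 / 2 : ℝ))⁻¹ * Real.exp (-‖p‖ ^ 2 / 2) * x = x := by
  have h1 : ∫ p : E3, Real.exp (-‖p‖ ^ 2 / 2) = (2 * Real.pi) ^ (3 / 2 : ℝ) := by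
    have := GaussianFourier.integral_rexp_neg_mul_sq_norm (V := E3) (b := 1 / 2) (by norm_num)
    have e : ∀ p : E3, Real.exp (-(1 / 2) * ‖p‖ ^ 2) = Real.exp (-‖p‖ ^ 2 / 2) := fun p => by
      congr 1; ring
    simp only [e] at this
    rw [this, finrank_euclideanSpace_fin]
    congr 1
    · ring
  have hpos : (0 : ℝ) < (2 * Real.pi) ^ (3 / 2 : ℝ) :=
    Real.rpow_pos_of_pos (by positivity) _
  rw [integral_mul_const, integral_const_mul, h1, inv_mul_cancel₀ hpos.ne', one_mul]

namespace Model

variable {S : Model} {t₀ : ℝ} (hS : S.Standing t₀)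
include hS

theorem Standing.diff₀_pos {γ : ℝ} (hγ : 0 < γ) : 0 < S.diff₀ γ :=
  div_pos hS.kBT_pos (mul_pos hS.m_pos hγ)

theorem Standing.eps_pos {γ : ℝ} (hγ : 0 < γ) : 0 < S.eps γ :=
  div_pos (Real.sqrt_pos.2 (div_pos hS.kBT_pos hS.m_pos)) hγ

theorem Standing.tendsto_eps : Tendsto S.eps atTop (𝓝[>] 0) :=
  tendsto_nhdsWithin_iff.2 ⟨tendsto_const_nhds.div_atTop tendsto_id, by
    filter_upwards [eventually_gt_atTop 0] with γ hγ using hS.eps_pos hγ⟩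

theorem Standing.rescale_Icc {γ τ : ℝ} (hγ : 0 < γ) (hτ : τ ∈ Icc 0 (t₀ / S.diff₀ γ)) :
    S.diff₀ γ * τ ∈ Icc 0 t₀ := by
  have hκ := hS.diff₀_pos hγ
  have := (le_div_iff₀ hκ).1 hτ.2
  exact ⟨mul_nonneg hκ.le hτ.1, by linarith⟩

theorem Standing.rescale_Ioo {γ τ : ℝ} (hγ : 0 < γ) (hτ : τ ∈ Ioo 0 (t₀ / S.diff₀ γ)) :
    S.diff₀ γ * τ ∈ Ioo 0 t₀ := by
  have hκ := hS.diff₀_pos hγ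
  have := (lt_div_iff₀ hκ).1 hτ.2
  exact ⟨mul_pos hκ hτ.1, by linarith⟩

end Model

theorem hasDerivAt_comp_const_mul {φ : ℝ → ℝ} {φ' κ τ : ℝ} (hφ : HasDerivAt φ φ' (κ * τ)) :
    HasDerivAt (fun s => φ (κ * s)) (κ * φ') τ := by
  have h1 : HasDerivAt (fun s => κ * s) κ τ := by simpa using (hasDerivAt_id τ).const_mul κ
  rw [mul_comm]
  exact hφ.comp τ h1

end Colloid

end

theorem corollary4p2
    (S : Colloid.Model) (t₀ ε₀ : ℝ) (ht₀ : 0 < t₀) (hε₀ : 0 < ε₀)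
    (hS : S.Standing t₀)
    -- the hypothesis that distinguishes the corollary from the general case
    (hZ₂ : ∀ r r', S.Z₂ r r' = 0)
    (h w : Colloid.E3 → ℝ) (henv : S.Envelope h w)
    -- the one-body distributions `f ε t r p`, in rescaled time
    (f : ℝ → ℝ → Colloid.E3 → Colloid.E3 → ℝ)
    (hf : ∀ ε ∈ Ioo 0 ε₀, S.IsOneBodySolution t₀ ε (f ε))
    -- the initial condition: Maxwellian in momentum and independent of `ε`
    (ρinit : Colloid.E3 → ℝ)
    (hinit : ∀ ε ∈ Ioo 0 ε₀, ∀ r p,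
      f ε 0 r p = ((2 * Real.pi) ^ (3 / 2 : ℝ))⁻¹ * Real.exp (-‖p‖ ^ 2 / 2) * ρinit r)
    -- the expansion in powers of `ε`
    (c : ℕ → ℝ → Colloid.E3 → Colloid.E3 → ℝ)
    (hexp : Colloid.HilbertExpansion h w t₀ ε₀ f c)
    (hψ : S.PreservesNonneg h t₀ (fun t => Colloid.density (c 0 t)))
    -- `ρ γ τ` is the true density and `R γ τ` its leading part, in the original time `τ`
    (ρ R : ℝ → ℝ → Colloid.E3 → ℝ)
    (hρ : ∀ γ τ, ρ γ τ = Colloid.density (f (S.eps γ) (S.diff₀ γ * τ)))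
    (hR : ∀ γ τ, R γ τ = Colloid.density (c 0 (S.diff₀ γ * τ))) :
    -- the leading part solves the Smoluchowski equation, with the given initial density
    (∀ γ : ℝ, 0 < γ →
      (∀ r, R γ 0 r = ρinit r) ∧
      (∀ r, ContinuousOn (fun τ => R γ τ r) (Icc 0 (t₀ / S.diff₀ γ))) ∧
      ∀ τ ∈ Ioo 0 (t₀ / S.diff₀ γ), ∀ r,
        DifferentiableAt ℝ (R γ τ) r ∧
        DifferentiableAt ℝ (S.smolField γ (S.U₁ (S.diff₀ γ * τ)) (R γ τ)) r ∧
        HasDerivAt (fun s => R γ s r)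
          (Colloid.divergence (S.smolField γ (S.U₁ (S.diff₀ γ * τ)) (R γ τ)) r) τ) ∧
    -- the true density differs from it by `O(ε²)`, uniformly in space and time
    (∃ C : ℝ, ∀ γ : ℝ, 0 < γ → S.eps γ < ε₀ →
      ∀ τ ∈ Icc 0 (t₀ / S.diff₀ γ), ∀ r, |ρ γ τ r - R γ τ r| ≤ C * S.eps γ ^ 2) ∧
    -- the true density itself solves the Smoluchowski equation up to `O(ε²)` in the flux
    (∃ err : ℝ → ℝ → Colloid.E3 → Colloid.E3,
      (∀ t ∈ Ioo 0 t₀, ∀ r, (fun γ => err γ t r) =O[atTop] (fun γ => S.eps γ ^ 2)) ∧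
      ∀ γ : ℝ, 0 < γ → S.eps γ < ε₀ → ∀ τ ∈ Ioo 0 (t₀ / S.diff₀ γ), ∀ r,
        DifferentiableAt ℝ (ρ γ τ) r ∧
        DifferentiableAt ℝ (fun x => S.smolField γ (S.U₁ (S.diff₀ γ * τ)) (ρ γ τ) x
          + S.diff₀ γ • err γ (S.diff₀ γ * τ) x) r ∧
        HasDerivAt (fun s => ρ γ s r)
          (Colloid.divergence (fun x => S.smolField γ (S.U₁ (S.diff₀ γ * τ)) (ρ γ τ) x
            + S.diff₀ γ • err γ (S.diff₀ γ * τ) x) r) τ) ∧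
    -- the diffusion tensors are positive definite
    (∀ γ : ℝ, 0 < γ → ∀ τ ∈ Icc 0 (t₀ / S.diff₀ γ), ∀ r,
      (S.diffusionTensor γ (R γ τ) r).PosDef ∧
      (S.eps γ < ε₀ → (S.diffusionTensor γ (ρ γ τ) r).PosDef)) := by
  have D : Colloid.Setting S t₀ ε₀ h w f c := ⟨ht₀, hε₀, hS, hZ₂, henv, hf, hexp⟩
  have hdens : ∀ ε ∈ Ioo 0 ε₀, ∀ r, Colloid.density (f ε 0) r = ρinit r := fun ε hε r => by
    simp only [Colloid.density, hinit ε hε r]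
    exact Colloid.density_maxwellian _
  have hinit' := D.initial hdens
  refine ⟨fun γ hγ => ⟨fun r => ?_, fun r => ?_, fun τ hτ r => ?_⟩, ?_, ?_,
    fun γ hγ τ hτ r => ⟨?_, fun hγ₀ => ?_⟩⟩
  · rw [hR, mul_zero]
    exact (hinit' r).1
  · simp only [hR]
    exact (hexp.density_cont 0 (by norm_num) r).comp (by fun_prop)
      fun τ hτ => hS.rescale_Icc hγ hτ
  · have ht := hS.rescale_Ioo hγ hτ
    have hfield : S.smolField γ (S.U₁ (S.diff₀ γ * τ)) (R γ τ)
        = fun x => (-S.diff₀ γ) • Colloid.fluxField (c 1 (S.diff₀ γ * τ)) x := by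
      funext x
      rw [hR, Colloid.Model.smolField_eq, ← neg_eq_iff_eq_neg.2 (D.app_flux_first ht x),
        Colloid.app_neg, Colloid.app_inv_app (D.posDef_leading (Ioo_subset_Icc_self ht) x),
        smul_neg, neg_smul]
    rw [hfield]
    refine ⟨?_, (D.differentiableAt_fluxField ht (n := 1) (by norm_num) r).fun_const_smul _, ?_⟩
    · rw [hR]
      exact (D.contDiff_density ht (by norm_num)).differentiable (by norm_num) r
    · rw [Colloid.divergence_const_smul]
      simp only [hR]
      have := Colloid.hasDerivAt_comp_const_mul (D.hasDerivAt_density ht (n := 0) (by norm_num) r)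
      rwa [mul_neg, ← neg_mul] at this
  · obtain ⟨C, hC⟩ := hexp.density_remainder
    obtain ⟨H, hH⟩ := henv.h_bdd
    refine ⟨|C| * H, fun γ hγ hγ₀ τ hτ r => ?_⟩
    have ht := hS.rescale_Icc hγ hτ
    have hz := D.density_first_eq_zero hψ (fun r => (hinit' r).2) ht r
    have h1 := hC _ ⟨hS.eps_pos hγ, hγ₀⟩ _ ht r
    simp only [Finset.sum_range_succ, Finset.sum_range_zero, zero_add, pow_zero, one_mul,
      pow_one, hz, mul_zero, add_zero] at h1
    rw [hρ, hR]
    calc _ ≤ C * S.eps γ ^ 2 * h r := h1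
      _ ≤ |C| * S.eps γ ^ 2 * H := by
          have := henv.h_nonneg r
          gcongr
          · exact le_abs_self C
          · exact hH r
      _ = _ := by ring
  · refine ⟨fun γ t r => -(1 / S.eps γ) • Colloid.fluxField (f (S.eps γ) t) r
      - Colloid.app (1 + S.meanZ₁ (Colloid.density (f (S.eps γ) t)) r)⁻¹
        (gradient (Colloid.density (f (S.eps γ) t)) r + Colloid.density (f (S.eps γ) t) r
          • S.totalForce t (Colloid.density (f (S.eps γ) t)) r), fun t ht r => ?_,
      fun γ hγ hγ₀ τ hτ r => ?_⟩
    · exact (D.flux_error_isBigO ht r).comp_tendsto hS.tendsto_eps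
    · have ht := hS.rescale_Ioo hγ hτ
      obtain ⟨d1, d2, d3⟩ := D.hasDerivAt_density_solution ht ⟨hS.eps_pos hγ, hγ₀⟩ r
      simp only [hρ, Colloid.Model.smolField_eq, ← smul_add, add_sub_cancel, smul_smul]
      refine ⟨d1, d2.fun_const_smul _, ?_⟩
      rw [Colloid.divergence_const_smul, mul_assoc]
      exact Colloid.hasDerivAt_comp_const_mul d3
  · rw [hR]
    exact (D.posDef_leading (hS.rescale_Icc hγ hτ) r).inv.smul (hS.diff₀_pos hγ)
  · rw [hρ]
    exact (D.posDef_solution ⟨hS.eps_pos hγ, hγ₀⟩ (hS.rescale_Icc hγ hτ) r).inv.smul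
      (hS.diff₀_pos hγ)
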